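/- Let $\mathscr A=(Q,\Sigma,\delta)$ be a finite deterministic complete automaton with $n=|Q|$ states; write $q\cdot w$ for the state reached from $q$ by the word $w\in\Sigma^*$ and $S\cdot w^{-1}=\{q\in Q: q\cdot w\in S\}$. A set $S\subseteq Q$ is totally extensible if $S\cdot w^{-1}=Q$ for some $w$, and $\mathscr A$ is synchronizing if $|Q\cdot w|=1$ for some $w$. A sink component is a strongly connected component that no transition leaves. Theorem. (1) Every synchronizing automaton has exactly one sink component $C$; every state of $C$ is reachable from every state of $Q$; and a set $S\subseteq Q$ is totally extensible if and only if $S\cap C\neq\emptyset$. (2) There is an algorithm which, given a synchronizing automaton (as a transition table) and $S\subseteq Q$, decides in time $O(|\Sigma|n)$ whether $S$ is totally extensible. (Time is unit-cost time on a random access machine with words of $O(\log(|\Sigma|n+2))$ bits; for $\Sigma=\emptyset$, where necessarily $n=1$, the time is $O(1)$.) (3) The promise problem "given a synchronizing automaton and $S\subseteq Q$, is $S$ totally extensible?" is NL-complete: some language in NL contains all yes-instances and no no-instances, and every language in NL reduces to the problem by a deterministic logarithmic-space many-one reduction, all of whose values are instances with a synchronizing automaton. Moreover, $s$-$t$ connectivity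 (given a finite directed graph and vertices $s,t$, is there a path from $s$ to $t$?) reduces to the problem by such a logarithmic-space reduction, which maps encodings of triples $(G,s,t)$ to instances with a synchronizing automaton. -/

import Mathlib

/-! ## Automata -/

/-- A deterministic complete (semi)automaton with state set `Q` and alphabet `α`. -/
structure Semiautomaton (Q : Type*) (α : Type*) where
  /-- the transition function -/
  step : Q → α → Q

namespace Semiautomaton

variable {Q : Type*} {α : Type*} (A : Semiautomaton Q α)

/-- `q · w`: the transition function extended to words. -/
def run (q : Q) (w : List α) : Q := w.foldl A.step q

/-- `S · w⁻¹`. -/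
def preimage (S : Set Q) (w : List α) : Set Q := {q | A.run q w ∈ S}

/-- `S` is totally extensible: `S · w⁻¹ = Q` for some word `w`. -/
def TotallyExtensible (S : Set Q) : Prop := ∃ w : List α, A.preimage S w = Set.univ

/-- `w` is a reset word: it has rank one, that is `|Q · w| = 1`. -/
def IsReset (w : List α) : Prop := (Set.range fun q => A.run q w).ncard = 1

/-- The automaton admits a reset word. -/
def Synchronizing : Prop := ∃ w : List α, A.IsReset w

/-- `q` is reachable from `p`. -/
def Reaches (p q : Q) : Prop := ∃ w : List α, A.run p w = q

/-- `C` is a strongly connected component (a class of mutual reachability). -/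
def IsStronglyConnectedComponent (C : Set Q) : Prop :=
  C.Nonempty ∧ ∀ p ∈ C, ∀ q, q ∈ C ↔ A.Reaches p q ∧ A.Reaches q p

/-- `C` is a sink component: a strongly connected component that no transition leaves. -/
def IsSinkComponent (C : Set Q) : Prop :=
  A.IsStronglyConnectedComponent C ∧ ∀ p ∈ C, ∀ a, A.step p a ∈ C

end Semiautomaton

/-! ## Random access machines, for running times

A machine has a fixed program that uses finitely many registers, and a memory array; every
instruction takes one unit of time. The size of the words is bounded in `RAM.Decides`. -/

/-- Instructions; `d`, `a`, `b` are register numbers and `l` is a position in the program. -/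
inductive RAMInstr where
  /-- `r_d := v` -/
  | const (d v : ℕ)
  /-- `r_d := r_a + r_b` -/
  | add (d a b : ℕ)
  /-- `r_d := r_a - r_b` (zero if negative) -/
  | sub (d a b : ℕ)
  /-- `r_d := r_a * r_b` -/
  | mul (d a b : ℕ)
  /-- `r_d := memory[r_a]` -/
  | load (d a : ℕ)
  /-- `memory[r_a] := r_b` -/
  | store (a b : ℕ)
  /-- go to position `l` -/
  | jump (l : ℕ)
  /-- go to position `l` if `r_a < r_b` -/
  | jumpLt (a b l : ℕ)
  /-- halt and answer yes -/
  | accept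
  /-- halt and answer no -/
  | reject

/-- A program. -/
abbrev RAM : Type := List RAMInstr

/-- A configuration of a random access machine. -/
structure RAMConfig where
  /-- position in the program -/
  pc : ℕ
  /-- contents of the registers -/
  reg : ℕ → ℕ
  /-- contents of the memory -/
  mem : ℕ → ℕ

namespace RAM

/-- The effect of one instruction; a halted machine does not change any more. -/
def exec (c : RAMConfig) : RAMInstr → RAMConfig
  | .const d v => ⟨c.pc + 1, Function.update c.reg d v, c.mem⟩
  | .add d a b => ⟨c.pc + 1, Function.update c.reg d (c.reg a + c.reg b), c.mem⟩
  | .sub d a b => ⟨c.pc + 1, Function.update c.reg d (c.reg a - c.reg b), c.mem⟩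
  | .mul d a b => ⟨c.pc + 1, Function.update c.reg d (c.reg a * c.reg b), c.mem⟩
  | .load d a => ⟨c.pc + 1, Function.update c.reg d (c.mem (c.reg a)), c.mem⟩
  | .store a b => ⟨c.pc + 1, c.reg, Function.update c.mem (c.reg a) (c.reg b)⟩
  | .jump l => ⟨l, c.reg, c.mem⟩
  | .jumpLt a b l => ⟨if c.reg a < c.reg b then l else c.pc + 1, c.reg, c.mem⟩
  | .accept => c
  | .reject => c

/-- One step of the program `P`. -/
def step (P : RAM) (c : RAMConfig) : RAMConfig :=
  match P[c.pc]? with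
  | some i => exec c i
  | none => c

/-- The initial configuration: the input words stand in the memory from address `0` on, and
everything else is zero. -/
def initial (input : List ℕ) : RAMConfig where
  pc := 0
  reg := fun _ => 0
  mem := fun i => input.getD i 0

/-- The configuration after `t` steps. -/
def after (P : RAM) (input : List ℕ) (t : ℕ) : RAMConfig := (step P)^[t] (initial input)

/-- On the given input the program answers the question `p` correctly after at most `T` steps,
and no register and no memory cell ever holds a number greater than `W`. -/
def Decides (P : RAM) (input : List ℕ) (p : Prop) (T W : ℕ) : Prop :=
  (∃ t ≤ T, (p ∧ P[(P.after input t).pc]? = some .accept) ∨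
    (¬ p ∧ P[(P.after input t).pc]? = some .reject)) ∧
  ∀ t i, (P.after input t).reg i ≤ W ∧ (P.after input t).mem i ≤ W

end RAM

/-! ## Turing machines, for logarithmic space

A machine has a two-way read-only input tape with end markers, `k` work tapes that are infinite
to the right, and a one-way write-only output tape (which a machine that accepts a language
may leave empty). Only the work tapes count as space. -/

/-- Movements of a head. -/
inductive HeadMove where
  | left
  | stay
  | right

/-- What the input head can read. -/
inductive InputSymbol where
  | leftEnd
  | bit (b : Bool)
  | rightEnd

/-- What a machine does in one step. -/
structure TMAction (k : ℕ) (Γ State : Type) where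
  /-- the next state -/
  next : State
  /-- movement of the input head -/
  inMove : HeadMove
  /-- the symbols written on the work tapes -/
  write : Fin k → Γ
  /-- movements of the heads of the work tapes, after writing -/
  workMove : Fin k → HeadMove
  /-- the bit appended to the output, if any -/
  out : Option Bool

/-- A nondeterministic Turing machine. -/
structure TM where
  /-- number of work tapes -/
  k : ℕ
  /-- the work alphabet -/
  Γ : Type
  finite_Γ : Finite Γ
  /-- the blank symbol -/
  blank : Γ
  /-- the set of states -/
  State : Type
  finite_State : Finite State
  /-- the initial state -/
  start : State
  /-- the accepting states -/
  accepting : Set State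
  /-- the possible actions, given the state and the symbols that are read -/
  trans : State → InputSymbol → (Fin k → Γ) → Set (TMAction k Γ State)

/-- A configuration. The cells of each work tape are numbered from `0`; the input word occupies
the positions `1, …, |x|` between the end markers at `0` and `|x| + 1`. -/
structure TMConfig (M : TM) where
  /-- the current state -/
  state : M.State
  /-- position of the input head -/
  inPos : ℕ
  /-- contents of the work tapes -/
  tape : Fin M.k → ℕ → M.Γ
  /-- positions of the heads of the work tapes -/
  head : Fin M.k → ℕ
  /-- the output so far -/
  output : List Bool

namespace TM

/-- The symbol at a position of the input tape. -/
def readInput (x : List Bool) : ℕ → InputSymbol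
  | 0 => .leftEnd
  | p + 1 => match x[p]? with
    | some b => .bit b
    | none => .rightEnd

/-- Moving a head; at the left end of a tape, a movement to the left has no effect. -/
def moveHead : HeadMove → ℕ → ℕ
  | .left, p => p - 1
  | .stay, p => p
  | .right, p => p + 1

variable (M : TM)

/-- The initial configuration. -/
def initial : TMConfig M where
  state := M.start
  inPos := 0
  tape := fun _ _ => M.blank
  head := fun _ => 0
  output := []

/-- The effect of an action on a configuration, for the input `x`. The input head cannot leave
the part of the tape between the end markers. -/
def act (x : List Bool) (c : TMConfig M) (a : TMAction M.k M.Γ M.State) : TMConfig M where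
  state := a.next
  inPos := min (moveHead a.inMove c.inPos) (x.length + 1)
  tape := fun i => Function.update (c.tape i) (c.head i) (a.write i)
  head := fun i => moveHead (a.workMove i) (c.head i)
  output := c.output ++ a.out.toList

/-- The actions that are possible in a configuration. -/
def possible (x : List Bool) (c : TMConfig M) : Set (TMAction M.k M.Γ M.State) :=
  M.trans c.state (readInput x c.inPos) fun i => c.tape i (c.head i)

/-- One step of a computation on the input `x`. -/
def Step (x : List Bool) (c c' : TMConfig M) : Prop := ∃ a ∈ M.possible x c, c' = M.act x c a

/-- `c` occurs in some computation on the input `x`. -/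
def Reachable (x : List Bool) (c : TMConfig M) : Prop :=
  Relation.ReflTransGen (M.Step x) M.initial c

/-- On inputs of length `N`, no computation visits more than `O(log N)` cells of the work tapes. -/
def LogSpace : Prop :=
  ∃ C : ℕ, ∀ (x : List Bool) (c : TMConfig M), M.Reachable x c →
    ∀ i, c.head i ≤ C * (Nat.log 2 x.length + 1)

/-- Some computation on `x` is accepting. -/
def Accepts (x : List Bool) : Prop := ∃ c, M.Reachable x c ∧ c.state ∈ M.accepting

/-- In every situation there is at most one possible action. -/
def Deterministic : Prop := ∀ q s g, (M.trans q s g).Subsingleton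

/-- On every input `x` the computation halts with output `f x` (for a deterministic machine). -/
def Computes (f : List Bool → List Bool) : Prop :=
  ∀ x, ∃ c, M.Reachable x c ∧ M.possible x c = ∅ ∧ c.output = f x

end TM

/-- The class NL. -/
def classNL : Set (Set (List Bool)) :=
  {L | ∃ M : TM, M.LogSpace ∧ ∀ x, x ∈ L ↔ M.Accepts x}

/-- Functions computable by a deterministic Turing machine in logarithmic space. -/
def LogSpaceComputable (f : List Bool → List Bool) : Prop :=
  ∃ M : TM, M.Deterministic ∧ M.LogSpace ∧ M.Computes f

/-! ## Promise problems -/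

/-- A promise problem: the question is whether an instance is a yes-instance, and it is put only
for the instances that are yes- or no-instances. -/
structure PromiseProblem where
  /-- the yes-instances -/
  yes : Set (List Bool)
  /-- the no-instances -/
  no : Set (List Bool)

namespace PromiseProblem

/-- A language, as a problem with the empty promise. -/
def ofLanguage (L : Set (List Bool)) : PromiseProblem := ⟨L, Lᶜ⟩

/-- Logarithmic-space many-one reducibility. -/
def LogSpaceReduces (P R : PromiseProblem) : Prop :=
  ∃ f : List Bool → List Bool, LogSpaceComputable f ∧
    (∀ x ∈ P.yes, f x ∈ R.yes) ∧ ∀ x ∈ P.no, f x ∈ R.no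

/-- The problem is solved by a nondeterministic machine in logarithmic space. -/
def InNL (P : PromiseProblem) : Prop :=
  ∃ L ∈ classNL, P.yes ⊆ L ∧ Disjoint P.no L

/-- Every language in NL reduces to the problem in logarithmic space. -/
def NLHard (P : PromiseProblem) : Prop :=
  ∀ L ∈ classNL, (ofLanguage L).LogSpaceReduces P

/-- The problem is complete for NL under logarithmic-space reductions. -/
def NLComplete (P : PromiseProblem) : Prop := P.InNL ∧ P.NLHard

end PromiseProblem

/-! ## Instances -/

/-- An automaton with states `0, …, n - 1` and letters `0, …, k - 1`, and a set of states, as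
words for a random access machine: `n`, `k`, the transition table row by row, and the
characteristic vector of the set. -/
def instanceWords {n k : ℕ} (A : Semiautomaton (Fin n) (Fin k)) (S : Finset (Fin n)) : List ℕ :=
  [n, k] ++
  ((List.finRange n).flatMap fun q => (List.finRange k).map fun a => (A.step q a : ℕ)) ++
  (List.finRange n).map fun q => if q ∈ S then 1 else 0

/-- The same as a string of bits: `1ⁿ 0 1ᵏ 0`, then for all `q`, `a`, `p` in lexicographic order
the bit that tells whether `q · a = p`, then the characteristic vector of the set. -/
def instanceBits {n k : ℕ} (A : Semiautomaton (Fin n) (Fin k)) (S : Finset (Fin n)) :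
    List Bool :=
  List.replicate n true ++ [false] ++ List.replicate k true ++ [false] ++
  ((List.finRange n).flatMap fun q => (List.finRange k).flatMap fun a =>
    (List.finRange n).map fun p => decide (A.step q a = p)) ++
  (List.finRange n).map fun q => decide (q ∈ S)

/-- A directed graph with vertices `0, …, n - 1` and two vertices `s`, `t`, as a string of bits:
`1ⁿ 0`, the adjacency matrix row by row, and the characteristic vectors of `s` and `t`. -/
def graphBits {n : ℕ} (E : Fin n → Fin n → Bool) (s t : Fin n) : List Bool :=
  List.replicate n true ++ [false] ++
  ((List.finRange n).flatMap fun u => (List.finRange n).map fun v => E u v) ++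
  ((List.finRange n).map fun v => decide (v = s)) ++
  (List.finRange n).map fun v => decide (v = t)

/-- Given a synchronizing automaton and a set `S` of states, is `S` totally extensible? -/
def totallyExtensibleSync : PromiseProblem where
  yes := {x | ∃ (n k : ℕ) (A : Semiautomaton (Fin n) (Fin k)) (S : Finset (Fin n)),
    A.Synchronizing ∧ A.TotallyExtensible (S : Set (Fin n)) ∧ x = instanceBits A S}
  no := {x | ∃ (n k : ℕ) (A : Semiautomaton (Fin n) (Fin k)) (S : Finset (Fin n)),
    A.Synchronizing ∧ ¬ A.TotallyExtensible (S : Set (Fin n)) ∧ x = instanceBits A S}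

/-- Given a directed graph and vertices `s`, `t`, is there a path from `s` to `t`? -/
def stConnectivity : PromiseProblem where
  yes := {x | ∃ (n : ℕ) (E : Fin n → Fin n → Bool) (s t : Fin n),
    Relation.ReflTransGen (fun u v => E u v = true) s t ∧ x = graphBits E s t}
  no := {x | ∃ (n : ℕ) (E : Fin n → Fin n → Bool) (s t : Fin n),
    ¬ Relation.ReflTransGen (fun u v => E u v = true) s t ∧ x = graphBits E s t}

/-! Let `w` be a reset word and `c` the state to which it sends every state. Since every state
reaches `c`, the states reachable from `c` form a strongly connected set that no transition leaves.
Every nonempty set that no transition leaves contains `c`, which gives uniqueness of the sink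
component (`exists_sinkComponent`). After `w` one may read any word that leads from `c` into `S`;
hence `S` is totally extensible if and only if from every state some state of `S` can be reached
(`totallyExtensible_iff`). Both algorithms test this condition and compute neither the sink
component nor a reset word.

Linear time: a search from `S` against the direction of the transitions visits exactly the states
from which `S` can be reached. The transitions are grouped by target in linked lists that overwrite
the transition table. Every transition has one target, so it is inspected at most once
(`sum_length_inLinks_le`). The work per state is also covered by the bound, because a synchronizing
automaton without letters has only one state.

Hardness: let every letter act as a partial function on the vertices of a graph, complete it by
loops, and add one letter that sends every state to `s`. The result is synchronizing. A word only
leads from `s` to vertices that are reachable from `s`, and the new letter brings every state to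
`s`; so a set is totally extensible if and only if it can be reached from `s`
(`totallyExtensible_resetAutomaton`). For a given graph, the letters are the vertices, and letter
`a` follows the edge to `a`; this handles `s`-`t` connectivity. For a nondeterministic machine in
logarithmic space, the graph is its configuration graph: configurations become numbers below a
polynomial bound, the letters are the transitions of the machine, and the numbers reachable from the
initial code are exactly the codes of reachable configurations (`reach_codeTrans_iff`).

Membership in NL: a loop runs through all states and guesses for each a path to `S`; as many rounds
as there are states suffice (`exists_short_path`). The universal quantifier over states is a loop,
so no complementation is needed.

The claims about space need actual Turing machines. Counter machines keep each counter in binary on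
its own tape, so that polynomially bounded counters need logarithmic space (`runs_image`,
`exists_image`). Structured programs compile to counter machines with finitely many control states.
Their program logic, `Wp` and then `Hp`, speaks about all runs at once and yields termination, the
bound on the counters and soundness of acceptance; `Ex` speaks about one run and yields completeness
of the guesses. -/

/-! ## Runs of transition systems -/

/-- Every maximal run from a configuration is finite, satisfies `good` throughout and ends in (or
passes through) a configuration that satisfies `post`. -/
inductive Runs {σ : Type*} (R : σ → σ → Prop) (good post : σ → Prop) : σ → Prop
  | done (c : σ) : good c → post c → Runs R good post c
  | step (c : σ) : good c → (∃ c', R c c') → (∀ c', R c c' → Runs R good post c') →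
      Runs R good post c

namespace Runs

variable {σ : Type*} {R : σ → σ → Prop} {good post : σ → Prop}

theorem exists_post {c : σ} (h : Runs R good post c) :
    ∃ c', Relation.ReflTransGen R c c' ∧ good c' ∧ post c' := by
  induction h with
  | done c hg hp => exact ⟨c, .refl, hg, hp⟩
  | step c _ he _ ih =>
    obtain ⟨c', hc'⟩ := he
    obtain ⟨d, hd, h⟩ := ih c' hc'
    exact ⟨d, .head hc' hd, h⟩

/-- Every successor inherits `Runs`, provided that configurations with `post` have no successors;
otherwise a run could go on uncontrolled after `done`. -/
theorem good_of_reach {c d : σ} (h : Runs R good post c) (hpost : ∀ c, post c → ∀ c', ¬ R c c')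
    (hr : Relation.ReflTransGen R c d) : good d := by
  have key : Runs R good post d := by
    induction hr with
    | refl => exact h
    | tail _ hs ih =>
      cases ih with
      | done _ hg hp => exact absurd hs (hpost _ hp _)
      | step _ _ _ hall => exact hall _ hs
  cases key <;> assumption

theorem of_functional {c c' : σ} (hg : good c) (hR : ∀ d, R c d ↔ d = c')
    (h : Runs R good post c') : Runs R good post c :=
  .step c hg ⟨c', (hR c').2 rfl⟩ fun d hd => by rw [(hR d).1 hd]; exact h

end Runs

/-! ## Counter machines -/

/-- The operations of a counter machine with counters `ι` and control states `T`; it also has a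
two-way input head and an output tape. -/
inductive Op (ι T : Type*) where
  | halt
  | inc (i : ι) (t : T)
  | dec (i : ι) (t t' : T)
  | read (f : InputSymbol → T)
  | move (d : HeadMove) (t : T)
  | out (b : Bool) (t : T)
  | choice (t t' : T)

namespace Op

/-- The control states to which an operation may lead. -/
def targets {ι T : Type*} : Op ι T → Set T
  | halt => ∅
  | inc _ t => {t}
  | dec _ t t' => {t, t'}
  | read f => Set.range f
  | move _ t => {t}
  | out _ t => {t}
  | choice t t' => {t, t'}

/-- The operation has at most one successor. -/
def IsDet {ι T : Type*} : Op ι T → Prop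
  | choice _ _ => False
  | _ => True

end Op

/-- The memory of a counter machine. -/
@[ext]
structure Mem (ι : Type*) where
  reg : ι → ℕ
  pos : ℕ
  out : List Bool

/-- The initial memory. -/
def Mem.init (ι : Type*) : Mem ι := ⟨fun _ => 0, 0, []⟩

/-- One step of a counter machine. -/
def CStep {ι T : Type*} [DecidableEq ι] (code : T → Op ι T) (x : List Bool) (c c' : T × Mem ι) :
    Prop :=
  match code c.1 with
  | .halt => False
  | .inc i t => c' = (t, { c.2 with reg := Function.update c.2.reg i (c.2.reg i + 1) })
  | .dec i t t' =>
    c' = if c.2.reg i = 0 then (t', c.2)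
      else (t, { c.2 with reg := Function.update c.2.reg i (c.2.reg i - 1) })
  | .read f => c' = (f (TM.readInput x c.2.pos), c.2)
  | .move d t => c' = (t, { c.2 with pos := min (TM.moveHead d c.2.pos) (x.length + 1) })
  | .out b t => c' = (t, { c.2 with out := c.2.out ++ [b] })
  | .choice t t' => c' = (t, c.2) ∨ c' = (t', c.2)

/-! ## Binary counters on a tape -/

/-- The value of a list of bits, the least significant bit first. -/
def bitsVal : List Bool → ℕ
  | [] => 0
  | b :: l => b.toNat + 2 * bitsVal l

/-- The work tape that holds a list of bits, after a mark in cell `0`. -/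
def bitsTape (l : List Bool) : ℕ → Option (Option Bool)
  | 0 => none
  | j + 1 => some l[j]?

theorem bitsVal_replicate_append (b : Bool) (j : ℕ) (l : List Bool) :
    bitsVal (List.replicate j b ++ l) = (2 ^ j - 1) * b.toNat + 2 ^ j * bitsVal l := by
  induction j with
  | zero => simp
  | succ j ih =>
    have h : (1 : ℕ) ≤ 2 ^ j := Nat.one_le_two_pow
    rw [List.replicate_succ, List.cons_append, bitsVal, ih]
    cases b
    · simp; ring
    · simp only [Bool.toNat_true]
      obtain ⟨m, hm⟩ := Nat.exists_eq_add_of_le h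
      rw [pow_succ, hm, show 1 + m - 1 = m by omega, show (1 + m) * 2 - 1 = 2 * m + 1 by omega]
      ring

theorem bitsVal_replicate (b : Bool) (j : ℕ) :
    bitsVal (List.replicate j b) = (2 ^ j - 1) * b.toNat := by
  simpa [bitsVal] using bitsVal_replicate_append b j []

/-- The net effect of a carry or borrow: the head turns in cell `j + 1`, where it writes `a`, and
overwrites the cells `1, …, j` by `b` on its way back. For empty `l` the list grows by one digit,
which `l.tail = []` covers. -/
theorem bitsTape_flip (a b c : Bool) (j : ℕ) (l : List Bool) (p : ℕ) :
    (if 1 ≤ p ∧ p ≤ j then some (some b)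
      else if p = j + 1 then some (some a) else bitsTape (List.replicate j c ++ l) p) =
    bitsTape (List.replicate j b ++ a :: l.tail) p := by
  rcases p with _ | p
  · simp [bitsTape]
  · simp only [bitsTape]
    by_cases h : p + 1 ≤ j
    · simp [h, List.getElem?_append_left (show p < (List.replicate j b).length by
        simpa using h), List.getElem?_replicate]
      omega
    · by_cases h2 : p = j
      · subst h2
        simp
      · have h3 : j < p := by omega
        obtain ⟨q, rfl⟩ := Nat.exists_eq_add_of_lt h3
        rw [if_neg (by omega), if_neg (by omega), List.getElem?_append_right (by simp; omega),
          List.getElem?_append_right (by simp; omega)]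
        simp only [List.length_replicate, show j + q + 1 - j = q + 1 by omega]
        simp

/-- Needed for decrementing zero: the head has passed only zeros and rewrites them as zeros. -/
theorem bitsTape_keep (b : Bool) (j : ℕ) (l : List Bool) (p : ℕ) :
    (if 1 ≤ p ∧ p ≤ j then some (some b) else bitsTape (List.replicate j b ++ l) p) =
    bitsTape (List.replicate j b ++ l) p := by
  rcases p with _ | p
  · simp
  · by_cases h : p + 1 ≤ j
    · simp [h, bitsTape, List.getElem?_append_left (show p < (List.replicate j b).length by
        simpa using h), List.getElem?_replicate]
      omega
    · simp [h]

theorem bitsTape_replicate_append (b : Bool) (j : ℕ) (l : List Bool) :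
    bitsTape (List.replicate j b ++ l) (j + 1) = some l[0]? := by
  simp [bitsTape, List.getElem?_append_right]

theorem bitsTape_ne_none (l : List Bool) {p : ℕ} (hp : 1 ≤ p) : bitsTape l p ≠ none := by
  obtain ⟨p, rfl⟩ := Nat.exists_eq_add_of_le' hp
  simp [bitsTape]

/-! ## Counter machines on Turing machines -/

/-- The states of the Turing machine that simulates a counter machine. -/
inductive MicroState (ι F : Type) where
  | boot
  | idle (t : F)
  | up (i : ι) (t : F)
  | down (i : ι) (t t' : F)
  | back (i : ι) (b : Bool) (t : F)

namespace MicroState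

instance (ι F : Type) [Finite ι] [Finite F] : Finite (MicroState ι F) := by
  let g : MicroState ι F → Option (F ⊕ (ι × F) ⊕ (ι × F × F) ⊕ (ι × Bool × F)) := fun s =>
    match s with
    | boot => none
    | idle t => some (.inl t)
    | up i t => some (.inr (.inl (i, t)))
    | down i t t' => some (.inr (.inr (.inl (i, t, t'))))
    | back i b t => some (.inr (.inr (.inr (i, b, t))))
  refine Finite.of_injective g fun a b h => ?_
  cases a <;> cases b <;> simp_all [g]

end MicroState

namespace CounterTM

/-- The action that leaves the work tapes unchanged. -/
def quiet {k : ℕ} {Γ S : Type} (s : S) (d : HeadMove) (o : Option Bool) (g : Fin k → Γ) :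
    TMAction k Γ S := ⟨s, d, g, fun _ => .stay, o⟩

/-- The action that works on one tape only. -/
def onTape {k : ℕ} {Γ S : Type} (s : S) (i : Fin k) (γ : Γ) (d : HeadMove) (g : Fin k → Γ) :
    TMAction k Γ S :=
  ⟨s, .stay, Function.update g i γ, Function.update (fun _ => .stay) i d, none⟩

variable {T F : Type} {k : ℕ} (code : T → Op (Fin k) T) (val : F → T) (ρ : T → F)

/-- The actions of the simulating machine. -/
def trans : MicroState (Fin k) F → InputSymbol → (Fin k → Option (Option Bool)) →
    Set (TMAction k (Option (Option Bool)) (MicroState (Fin k) F))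
  | .boot, _, _ => ∅
  | .idle t, s, g =>
    match code (val t) with
    | .halt => ∅
    | .inc i t => {onTape (.up i (ρ t)) i (g i) .right g}
    | .dec i t t' => {onTape (.down i (ρ t) (ρ t')) i (g i) .right g}
    | .read f => {quiet (.idle (ρ (f s))) .stay none g}
    | .move d t => {quiet (.idle (ρ t)) d none g}
    | .out b t => {quiet (.idle (ρ t)) .stay (some b) g}
    | .choice t t' => {quiet (.idle (ρ t)) .stay none g, quiet (.idle (ρ t')) .stay none g}
  | .up i t, _, g =>
    match g i with
    | some (some true) => {onTape (.up i t) i (g i) .right g}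
    | _ => {onTape (.back i false t) i (some (some true)) .left g}
  | .down i t t', _, g =>
    match g i with
    | some (some false) => {onTape (.down i t t') i (g i) .right g}
    | some (some true) => {onTape (.back i true t) i (some (some false)) .left g}
    | _ => {onTape (.back i false t') i (g i) .left g}
  | .back i b t, _, g =>
    match g i with
    | none => {quiet (.idle t) .stay none g}
    | some _ => {onTape (.back i b t) i (some (some b)) .left g}

/-- The Turing machine that simulates a counter machine; first it marks the cells `0`. -/
abbrev machine [Finite F] (start : F) (acc : Set F) : TM where
  k := k
  Γ := Option (Option Bool)
  finite_Γ := inferInstance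
  blank := some none
  State := MicroState (Fin k) F
  finite_State := inferInstance
  start := .boot
  accepting := {s | ∃ t ∈ acc, s = .idle t}
  trans s y g :=
    match s with
    | .boot => {⟨.idle start, .stay, fun _ => none, fun _ => .stay, none⟩}
    | s => trans code val ρ s y g

variable [Finite F] (start : F) (acc : Set F)

/-- A configuration of the simulating machine. -/
def conf (s : MicroState (Fin k) F) (pos : ℕ) (out : List Bool)
    (τ : Fin k → ℕ → Option (Option Bool)) (h : Fin k → ℕ) :
    TMConfig (machine code val ρ start acc) := ⟨s, pos, τ, h, out⟩

theorem machine_deterministic (h : ∀ t, (code (val t)).IsDet) :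
    (machine code val ρ start acc).Deterministic := by
  intro s y g
  cases s with
  | boot => exact Set.subsingleton_singleton
  | idle t =>
    have := h t
    simp only [machine, trans]
    split <;> simp_all [Op.IsDet]
  | up i t => simp only [machine, trans]; split <;> simp
  | down i t t' => simp only [machine, trans]; split <;> simp
  | back i b t => simp only [machine, trans]; split <;> simp

variable {code val ρ start acc} {x : List Bool}

theorem act_onTape (s s' : MicroState (Fin k) F) (pos : ℕ) (hpos : pos ≤ x.length + 1)
    (out : List Bool)
    (τ : Fin k → ℕ → Option (Option Bool)) (i : Fin k) (h : ℕ) (γ : Option (Option Bool))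
    (d : HeadMove) :
    (machine code val ρ start acc).act x
      (conf code val ρ start acc s pos out τ (Function.update (fun _ => 0) i h))
      (onTape s' i γ d fun j => τ j (Function.update (fun _ => 0) i h j)) =
    conf code val ρ start acc s' pos out
      (Function.update τ i (Function.update (τ i) h γ))
      (Function.update (fun _ => 0) i (TM.moveHead d h)) := by
  simp only [TM.act, conf, onTape, TM.moveHead, TMConfig.mk.injEq, true_and]
  refine ⟨by omega, ?_, ?_, by simp⟩
  · funext j
    by_cases hj : j = i
    · subst hj; simp
    · simp [hj]
  · funext j
    by_cases hj : j = i
    · subst hj; simp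
    · simp [hj]

theorem act_quiet (s s' : MicroState (Fin k) F) (pos : ℕ)
    (out : List Bool) (d : HeadMove) (o : Option Bool)
    (τ : Fin k → ℕ → Option (Option Bool)) (h : Fin k → ℕ) :
    (machine code val ρ start acc).act x
      (conf code val ρ start acc s pos out τ h) (quiet s' d o fun j => τ j (h j)) =
    conf code val ρ start acc s' (min (TM.moveHead d pos) (x.length + 1)) (out ++ o.toList) τ h := by
  simp only [TM.act, conf, quiet, TM.moveHead, TMConfig.mk.injEq, true_and]
  exact ⟨by funext j; simp, trivial⟩

/-- The configurations within the space bound; accepting ones occur only if `P` holds. -/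
def Good (D : ℕ) (P : Prop) (c : TMConfig (machine code val ρ start acc)) : Prop :=
  (∀ i, c.head i ≤ D + 1) ∧ (c.state ∈ (machine code val ρ start acc).accepting → P)

theorem good_conf {s : MicroState (Fin k) F} {pos : ℕ} {out : List Bool}
    {τ : Fin k → ℕ → Option (Option Bool)} {i : Fin k} {h D : ℕ} {P : Prop}
    (hs : ∀ t, s ≠ .idle t) (hh : h ≤ D + 1) :
    Good D P (conf code val ρ start acc s pos out τ (Function.update (fun _ => 0) i h)) := by
  refine ⟨fun j => ?_, ?_⟩
  · by_cases hj : j = i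
    · subst hj; simpa [conf] using hh
    · simp [conf, hj]
  · rintro ⟨t, _, ht⟩
    exact absurd ht (hs t)

variable {D : ℕ} {P : Prop} {post : TMConfig (machine code val ρ start acc) → Prop}

/-- A step with a unique possible action. -/
theorem runs_of_action {c : TMConfig (machine code val ρ start acc)} (hg : Good D P c)
    {a : TMAction k (Option (Option Bool)) (MicroState (Fin k) F)}
    (ha : (machine code val ρ start acc).possible x c = {a})
    (h : Runs ((machine code val ρ start acc).Step x) (Good D P) post
      ((machine code val ρ start acc).act x c a)) :
    Runs ((machine code val ρ start acc).Step x) (Good D P) post c := by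
  refine .of_functional hg (fun d => ?_) h
  simp only [TM.Step, ha]
  constructor
  · rintro ⟨b, hb, rfl⟩
    rw [Set.mem_singleton_iff.1 hb]
  · rintro rfl
    exact ⟨a, rfl, rfl⟩

theorem update_update_self (τ : Fin k → ℕ → Option (Option Bool)) (i : Fin k) (h : ℕ) :
    Function.update τ i (Function.update (τ i) h (τ i h)) = τ := by
  simp

/-- The return sweep. Only the mark in cell `0` reads `none`, so the head stops there and nowhere
earlier. -/
theorem runs_back (i : Fin k) (b : Bool) (t : F) (pos : ℕ) (hpos : pos ≤ x.length + 1)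
    (out : List Bool) (h : ℕ) (hh : h ≤ D + 1) (τ : Fin k → ℕ → Option (Option Bool))
    (h0 : τ i 0 = none) (h1 : ∀ j, 1 ≤ j → j ≤ h → τ i j ≠ none)
    (H : Runs ((machine code val ρ start acc).Step x) (Good D P) post
      (conf code val ρ start acc (.idle t) pos out
        (Function.update τ i fun j => if 1 ≤ j ∧ j ≤ h then some (some b) else τ i j)
        fun _ => 0)) :
    Runs ((machine code val ρ start acc).Step x) (Good D P) post
      (conf code val ρ start acc (.back i b t) pos out τ (Function.update (fun _ => 0) i h)) := by
  induction h generalizing τ with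
  | zero =>
    refine runs_of_action (good_conf (by simp) hh)
      (a := quiet (.idle t) .stay none fun j => τ j (Function.update (fun _ => 0) i 0 j)) ?_ ?_
    · simp [TM.possible, machine, trans, conf, h0]
    · rw [act_quiet]
      convert H using 2
      · simp [TM.moveHead]; omega
      · simp
      · symm
        rw [Function.update_eq_self_iff]
        funext j
        rw [if_neg (by omega)]
      · simp
  | succ h ih =>
    refine runs_of_action (good_conf (by simp) hh)
      (a := onTape (.back i b t) i (some (some b)) .left
        fun j => τ j (Function.update (fun _ => 0) i (h + 1) j)) ?_ ?_
    · obtain ⟨y, hy⟩ := Option.ne_none_iff_exists'.1 (h1 (h + 1) (by omega) le_rfl)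
      simp [TM.possible, machine, trans, conf, hy]
    · rw [act_onTape _ _ _ hpos]
      refine ih (by omega) _ ?_ ?_ ?_
      · simpa using h0
      · intro j hj hj'
        simp only [Function.update_self]
        rw [Function.update_of_ne (by omega)]
        exact h1 j hj (by omega)
      · convert H using 2
        simp only [Function.update_self, Function.update_idem]
        congr 1
        funext j
        by_cases hj : j = h + 1
        · subst hj; simp
        · rw [Function.update_of_ne hj]
          exact if_congr (by omega) rfl rfl

/-- The end of the carry: the head has passed `j` ones and now sees a zero or a blank. Decrements
leave leading zeros behind, so the length of a list is not determined by its value; it is only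
bounded by the maximum of the old length and the length of the new value. -/
theorem runs_up_flip (i : Fin k) (t : F) (pos : ℕ) (hpos : pos ≤ x.length + 1)
    (out : List Bool) (l : List Bool) (j : ℕ) (hl : j + l.length ≤ D)
    (τ : Fin k → ℕ → Option (Option Bool))
    (hτ : τ i = bitsTape (List.replicate j true ++ l))
    (h0 : l[0]? ≠ some true)
    (H : ∀ l', bitsVal l' = bitsVal (List.replicate j true ++ l) + 1 →
      l'.length ≤ max (j + l.length) (Nat.log 2 (bitsVal l') + 1) →
      Runs ((machine code val ρ start acc).Step x) (Good D P) post
      (conf code val ρ start acc (.idle t) pos out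
        (Function.update τ i (bitsTape l')) fun _ => 0)) :
    Runs ((machine code val ρ start acc).Step x) (Good D P) post
      (conf code val ρ start acc (.up i t) pos out τ
        (Function.update (fun _ => 0) i (j + 1))) := by
  refine runs_of_action (good_conf (by simp) (by omega))
    (a := onTape (.back i false t) i (some (some true)) .left
      fun j' => τ j' (Function.update (fun _ => 0) i (j + 1) j')) ?_ ?_
  · simp only [TM.possible, machine, trans, conf, Function.update_self, hτ,
      bitsTape_replicate_append]
    split
    · simp_all
    · rfl
  · rw [act_onTape _ _ _ hpos]
    refine runs_back i false t pos hpos out j (by omega) _ ?_ ?_ ?_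
    · simp [hτ, bitsTape]
    · intro j' h1 h2
      simp only [Function.update_self]
      rw [Function.update_of_ne (by omega), hτ]
      exact bitsTape_ne_none _ h1
    · have hp : (1 : ℕ) ≤ 2 ^ j := Nat.one_le_two_pow
      convert H (List.replicate j false ++ true :: l.tail) ?_ ?_ using 2
      · simp only [Function.update_self, Function.update_idem]
        congr 1
        funext p
        rw [← bitsTape_flip true false true j l p]
        by_cases h1 : 1 ≤ p ∧ p ≤ j
        · simp [h1]
        · by_cases h2 : p = j + 1
          · subst h2; simp
          · simp [h1, h2, hτ]
      · rw [bitsVal_replicate_append, bitsVal_replicate_append]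
        rcases l with _ | ⟨_ | _, l⟩
        · simp [bitsVal]; omega
        · simp [bitsVal]; ring_nf; omega
        · simp at h0
      · rcases l with _ | ⟨a, l⟩
        -- A new digit appears only when all digits were ones; the new value is then exactly `2 ^
        -- j`, with `j + 1` digits.
        · refine le_max_of_le_right ?_
          simp [bitsVal_replicate_append, bitsVal, Nat.log_pow]
        · simp

theorem runs_up (i : Fin k) (t : F) (pos : ℕ) (hpos : pos ≤ x.length + 1)
    (out : List Bool) (l : List Bool) (j : ℕ) (hl : j + l.length ≤ D)
    (τ : Fin k → ℕ → Option (Option Bool))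
    (hτ : τ i = bitsTape (List.replicate j true ++ l))
    (H : ∀ l', bitsVal l' = bitsVal (List.replicate j true ++ l) + 1 →
      l'.length ≤ max (j + l.length) (Nat.log 2 (bitsVal l') + 1) →
      Runs ((machine code val ρ start acc).Step x) (Good D P) post
      (conf code val ρ start acc (.idle t) pos out
        (Function.update τ i (bitsTape l')) fun _ => 0)) :
    Runs ((machine code val ρ start acc).Step x) (Good D P) post
      (conf code val ρ start acc (.up i t) pos out τ
        (Function.update (fun _ => 0) i (j + 1))) := by
  induction l generalizing j with
  | nil => exact runs_up_flip i t pos hpos out _ j hl τ hτ (by simp) H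
  | cons a l ih =>
    cases a with
    | false => exact runs_up_flip i t pos hpos out _ j hl τ hτ (by simp) H
    | true =>
      refine runs_of_action (good_conf (by simp) (by omega))
        (a := onTape (.up i t) i (τ i (j + 1)) .right
          fun j' => τ j' (Function.update (fun _ => 0) i (j + 1) j')) ?_ ?_
      · simp [TM.possible, machine, trans, conf, hτ, bitsTape_replicate_append]
      · rw [act_onTape _ _ _ hpos, update_update_self]
        have e : List.replicate (j + 1) true ++ l = List.replicate j true ++ true :: l := by
          rw [List.replicate_succ', List.append_assoc]; rfl
        refine ih (j + 1) (by simp at hl; omega) (by rw [hτ, e]) ?_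
        intro l' h1 h2
        rw [e] at h1
        refine H l' h1 (h2.trans ?_)
        simp; omega

/-- The borrow passes zeros. Meeting a one, it turns there; meeting the blank, it has seen that the
value is zero, and the zero branch `t'` is taken with the tape unchanged. Lists are never shortened.
-/
theorem runs_down (i : Fin k) (t t' : F) (pos : ℕ) (hpos : pos ≤ x.length + 1)
    (out : List Bool) (l : List Bool) (j : ℕ) (hl : j + l.length ≤ D)
    (τ : Fin k → ℕ → Option (Option Bool))
    (hτ : τ i = bitsTape (List.replicate j false ++ l))
    (H : ∀ l', bitsVal l' = bitsVal (List.replicate j false ++ l) - 1 →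
      l'.length = j + l.length →
      Runs ((machine code val ρ start acc).Step x) (Good D P) post
      (conf code val ρ start acc
        (.idle (if bitsVal (List.replicate j false ++ l) = 0 then t' else t)) pos out
        (Function.update τ i (bitsTape l')) fun _ => 0)) :
    Runs ((machine code val ρ start acc).Step x) (Good D P) post
      (conf code val ρ start acc (.down i t t') pos out τ
        (Function.update (fun _ => 0) i (j + 1))) := by
  induction l generalizing j with
  | nil =>
    refine runs_of_action (good_conf (by simp) (by omega))
      (a := onTape (.back i false t') i (τ i (j + 1)) .left
        fun j' => τ j' (Function.update (fun _ => 0) i (j + 1) j')) ?_ ?_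
    · simp [TM.possible, machine, trans, conf, hτ, bitsTape_replicate_append,
        -List.append_nil]
    · rw [act_onTape _ _ _ hpos, update_update_self]
      refine runs_back i false t' pos hpos out j (by omega) _ ?_ ?_ ?_
      · simp [hτ, bitsTape]
      · intro j' h1 h2
        rw [hτ]
        exact bitsTape_ne_none _ h1
      · convert H (List.replicate j false) ?_ (by simp) using 2
        · rw [if_pos (by simp [bitsVal_replicate])]
        · congr 1
          funext p
          rw [hτ, bitsTape_keep]
          simp
        · simp [bitsVal_replicate]
  | cons a l ih =>
    cases a with
    | true =>
      have hp : (1 : ℕ) ≤ 2 ^ j := Nat.one_le_two_pow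
      refine runs_of_action (good_conf (by simp) (by omega))
        (a := onTape (.back i true t) i (some (some false)) .left
          fun j' => τ j' (Function.update (fun _ => 0) i (j + 1) j')) ?_ ?_
      · simp [TM.possible, machine, trans, conf, hτ, bitsTape_replicate_append]
      · rw [act_onTape _ _ _ hpos]
        refine runs_back i true t pos hpos out j (by omega) _ ?_ ?_ ?_
        · simp [hτ, bitsTape]
        · intro j' h1 h2
          simp only [Function.update_self]
          rw [Function.update_of_ne (by omega), hτ]
          exact bitsTape_ne_none _ h1
        · convert H (List.replicate j true ++ false :: l) ?_ (by simp) using 2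
          · rw [if_neg]
            simp [bitsVal_replicate_append, bitsVal]
          · simp only [Function.update_self, Function.update_idem]
            congr 1
            funext p
            rw [← List.tail_cons (a := true) (as := l), ← bitsTape_flip false true false j _ p]
            by_cases h1 : 1 ≤ p ∧ p ≤ j
            · simp [h1]
            · by_cases h2 : p = j + 1
              · subst h2; simp
              · simp [h1, h2, hτ]
          · simp [bitsVal_replicate_append, bitsVal]
            rw [mul_add, mul_one]
            omega
    | false =>
      refine runs_of_action (good_conf (by simp) (by omega))
        (a := onTape (.down i t t') i (τ i (j + 1)) .right
          fun j' => τ j' (Function.update (fun _ => 0) i (j + 1) j')) ?_ ?_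
      · simp [TM.possible, machine, trans, conf, hτ, bitsTape_replicate_append]
      · rw [act_onTape _ _ _ hpos, update_update_self]
        have e : List.replicate (j + 1) false ++ l = List.replicate j false ++ false :: l := by
          rw [List.replicate_succ', List.append_assoc]; rfl
        refine ih (j + 1) (by simp at hl; omega) (by rw [hτ, e]) ?_
        intro l' h1 h2
        rw [e] at h1
        rw [e]
        exact H l' h1 (by simp [h2]; omega)

end CounterTM

namespace Op

/-- Renaming of the counters. -/
def mapReg {ι κ T : Type*} (e : ι → κ) : Op ι T → Op κ T
  | halt => halt
  | inc i t => inc (e i) t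
  | dec i t t' => dec (e i) t t'
  | read f => read f
  | move d t => move d t
  | out b t => out b t
  | choice t t' => choice t t'

theorem IsDet.mapReg {ι κ T : Type*} (e : ι → κ) {o : Op ι T} (h : o.IsDet) :
    (o.mapReg e).IsDet := by
  cases o <;> simp_all [Op.mapReg, IsDet]

end Op

/-! ### Simulation of steps and runs of counter machines -/

namespace CounterTM

variable {ι T F : Type} [Finite F] {k : ℕ} {code : T → Op ι T} {val : F → T}
  {ρ : T → F} {e : ι ≃ Fin k} {start : F} {acc : Set F} {x : List Bool}

/-- Every position beyond the input reads as the right end marker, so clamping the input head is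
invisible to programs. -/
theorem readInput_min (x : List Bool) (p : ℕ) :
    TM.readInput x (min p (x.length + 1)) = TM.readInput x p := by
  rcases le_total p (x.length + 1) with h | h
  · rw [min_eq_left h]
  · rw [min_eq_right h]
    obtain ⟨q, rfl⟩ := Nat.exists_eq_add_of_le' (le_trans (Nat.le_add_left 1 _) h)
    simp [TM.readInput, List.getElem?_eq_none (show x.length ≤ q by omega)]

/-- The idle configuration that represents a configuration of the counter machine, where `ls`
are the contents of the counters. -/
def image (code : T → Op ι T) (val : F → T) (ρ : T → F) (e : ι ≃ Fin k) (start : F) (acc : Set F)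
    (t : T) (m : Mem ι) (ls : ι → List Bool) :
    TMConfig (machine (fun t => (code t).mapReg e) val ρ start acc) :=
  conf _ val ρ start acc (.idle (ρ t)) m.pos m.out (fun j => bitsTape (ls (e.symm j))) fun _ => 0

/-- The lists `ls` represent the counters of `m`, with at most `D` bits. -/
structure Represents (D : ℕ) (x : List Bool) (m : Mem ι) (ls : ι → List Bool) : Prop where
  val_eq : ∀ i, bitsVal (ls i) = m.reg i
  length_le : ∀ i, (ls i).length ≤ D
  pos_le : m.pos ≤ x.length + 1

theorem good_image {D : ℕ} {P : Prop} {t : T} {m : Mem ι} {ls : ι → List Bool}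
    (h : ρ t ∈ acc → P) :
    Good D P (image code val ρ e start acc t m ls) := by
  refine ⟨fun i => Nat.zero_le _, ?_⟩
  rintro ⟨f, hf, hft⟩
  simp only [image, conf, MicroState.idle.injEq] at hft
  exact h (hft ▸ hf)

/-- The first step marks the cells `0`; a marked blank tape represents the empty list, hence a
counter with value zero. -/
theorem initial_step :
    ∀ d, (machine (fun t => (code t).mapReg e) val ρ start acc).Step x
      (machine (fun t => (code t).mapReg e) val ρ start acc).initial d ↔
      d = conf _ val ρ start acc (.idle start) 0 [] (fun _ => bitsTape []) fun _ => 0 := by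
  intro d
  simp only [TM.Step, TM.possible, machine, TM.initial, Set.mem_singleton_iff, exists_eq_left]
  refine Eq.congr rfl ?_
  simp only [TM.act, conf, TM.moveHead, TMConfig.mk.injEq, true_and]
  refine ⟨by simp, ?_, by simp⟩
  funext j p
  cases p <;> simp [bitsTape]

variable [DecidableEq ι]

theorem update_tapes (ls : ι → List Bool) (i : ι) (l : List Bool) :
    Function.update (fun j => bitsTape (ls (e.symm j))) (e i) (bitsTape l) =
      fun j => bitsTape (Function.update ls i l (e.symm j)) := by
  funext j
  by_cases h : j = e i
  · subst h; simp
  · rw [Function.update_of_ne h, Function.update_of_ne]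
    rintro rfl
    simp at h

/-- The simulation of one step. -/
theorem runs_image_of_step {B D : ℕ} (hB : B < 2 ^ D) {P : Prop} {t : T} (ht : val (ρ t) = t)
    {m : Mem ι} {ls : ι → List Bool} (hP : ρ t ∈ acc → P) (hm : Represents D x m ls)
    {post : TMConfig (machine (fun t => (code t).mapReg e) val ρ start acc) → Prop}
    (hstep : ∃ c', CStep code x (t, m) c')
    (H : ∀ t' m' ls', CStep code x (t, m) (t', m') →
      (∀ i, m'.reg i ≤ B) ∧ (Represents D x m' ls' →
      Runs ((machine (fun t => (code t).mapReg e) val ρ start acc).Step x) (Good D P) post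
        (image code val ρ e start acc t' m' ls'))) :
    Runs ((machine (fun t => (code t).mapReg e) val ρ start acc).Step x) (Good D P) post
      (image code val ρ e start acc t m ls) := by
  have hg := good_image (code := code) (val := val) (e := e) (start := start) (D := D) (m := m)
    (ls := ls) hP
  have hpos := hm.pos_le
  cases ho : code t with
  | halt => simp [CStep, ho] at hstep
  | inc i t' =>
    refine runs_of_action hg
      (a := onTape (.up (e i) (ρ t')) (e i) (bitsTape (ls i) 0) .right
        fun j => bitsTape (ls (e.symm j)) 0) ?_ ?_
    · simp [TM.possible, machine, trans, image, conf, ht, ho, Op.mapReg]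
    · have := act_onTape (code := fun t => (code t).mapReg e) (val := val) (ρ := ρ)
        (start := start) (acc := acc) (.idle (ρ t)) (.up (e i) (ρ t')) m.pos hpos m.out
        (fun j => bitsTape (ls (e.symm j))) (e i) 0 (bitsTape (ls i) 0) .right
      simp only [Equiv.symm_apply_apply, Function.update_eq_self, TM.moveHead] at this
      rw [image, this, update_tapes, Function.update_eq_self]
      refine runs_up (e i) (ρ t') m.pos hpos m.out (ls i) 0 (by simpa using hm.length_le i) _
        (by simp) ?_
      intro l' h1 h2
      have h3 : CStep code x (t, m) (t', { m with reg := Function.update m.reg i (m.reg i + 1) }) := by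
        simp [CStep, ho]
      rw [update_tapes]
      obtain ⟨h4, h5⟩ := H _ _ (Function.update ls i l') h3
      simp only [List.replicate_zero, List.nil_append, hm.val_eq] at h1
      refine h5 ⟨fun j => ?_, fun j => ?_, hpos⟩
      · by_cases hj : j = i
        · subst hj; simpa using h1
        · simpa [hj] using hm.val_eq j
      · by_cases hj : j = i
        · subst hj
          have := h4 j
          simp only [Function.update_self] at this ⊢
          refine h2.trans (max_le ?_ ?_)
          · simpa using hm.length_le j
          · rw [h1]
            exact Nat.log_lt_of_lt_pow (by omega) (by omega)
        · simpa [hj] using hm.length_le j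
  | dec i t' t'' =>
    refine runs_of_action hg
      (a := onTape (.down (e i) (ρ t') (ρ t'')) (e i) (bitsTape (ls i) 0) .right
        fun j => bitsTape (ls (e.symm j)) 0) ?_ ?_
    · simp [TM.possible, machine, trans, image, conf, ht, ho, Op.mapReg]
    · have := act_onTape (code := fun t => (code t).mapReg e) (val := val) (ρ := ρ)
        (start := start) (acc := acc) (.idle (ρ t)) (.down (e i) (ρ t') (ρ t'')) m.pos hpos m.out
        (fun j => bitsTape (ls (e.symm j))) (e i) 0 (bitsTape (ls i) 0) .right
      simp only [Equiv.symm_apply_apply, Function.update_eq_self, TM.moveHead] at this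
      rw [image, this, update_tapes, Function.update_eq_self]
      refine runs_down (e i) (ρ t') (ρ t'') m.pos hpos m.out (ls i) 0
        (by simpa using hm.length_le i) _ (by simp) ?_
      intro l' h1 h2
      simp only [List.replicate_zero, List.nil_append, hm.val_eq] at h1 h2 ⊢
      rw [update_tapes]
      -- As `0 - 1 = 0`, both branches change the memory by the same truncated subtraction and
      -- differ only in the control state.
      have h3 : CStep code x (t, m) (if m.reg i = 0 then t'' else t',
          { m with reg := Function.update m.reg i (m.reg i - 1) }) := by
        simp only [CStep, ho]
        split_ifs with h
        · congr
          funext j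
          by_cases hj : j = i
          · subst hj; simp [h]
          · simp [hj]
        · rfl
      have h4 := (H _ _ (Function.update ls i l') h3).2 ⟨fun j => ?_, fun j => ?_, hpos⟩
      · convert h4 using 1
        simp only [image]
        congr 2
        split_ifs <;> rfl
      · by_cases hj : j = i
        · subst hj; simpa using h1
        · simpa [hj] using hm.val_eq j
      · by_cases hj : j = i
        · subst hj
          have := hm.length_le j
          simp only [Function.update_self]
          omega
        · simpa [hj] using hm.length_le j
  | read f =>
    refine runs_of_action hg
      (a := quiet (.idle (ρ (f (TM.readInput x m.pos)))) .stay none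
        fun j => bitsTape (ls (e.symm j)) 0) ?_ ?_
    · simp [TM.possible, machine, trans, image, conf, ht, ho, Op.mapReg]
    · rw [image, act_quiet]
      have h3 : CStep code x (t, m) (f (TM.readInput x m.pos), m) := by simp [CStep, ho]
      have := (H _ _ ls h3).2 hm
      simpa [image, TM.moveHead, hpos] using this
  | move d t' =>
    refine runs_of_action hg
      (a := quiet (.idle (ρ t')) d none fun j => bitsTape (ls (e.symm j)) 0) ?_ ?_
    · simp [TM.possible, machine, trans, image, conf, ht, ho, Op.mapReg]
    · rw [image, act_quiet]
      have h3 : CStep code x (t, m)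
        (t', { m with pos := min (TM.moveHead d m.pos) (x.length + 1) }) := by simp [CStep, ho]
      have := (H _ _ ls h3).2 ⟨hm.val_eq, hm.length_le, by simp⟩
      simpa [image] using this
  | out b t' =>
    refine runs_of_action hg
      (a := quiet (.idle (ρ t')) .stay (some b) fun j => bitsTape (ls (e.symm j)) 0) ?_ ?_
    · simp [TM.possible, machine, trans, image, conf, ht, ho, Op.mapReg]
    · rw [image, act_quiet]
      have h3 : CStep code x (t, m) (t', { m with out := m.out ++ [b] }) := by simp [CStep, ho]
      have := (H _ _ ls h3).2 ⟨hm.val_eq, hm.length_le, hpos⟩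
      simpa [image, TM.moveHead, hpos] using this
  | choice t' t'' =>
    have key : ∀ c', (machine (fun t => (code t).mapReg e) val ρ start acc).Step x
        (image code val ρ e start acc t m ls) c' ↔
        c' = image code val ρ e start acc t' m ls ∨ c' = image code val ρ e start acc t'' m ls := by
      intro c'
      have hact : ∀ t' : T, (machine (fun t => (code t).mapReg e) val ρ start acc).act x
          (image code val ρ e start acc t m ls)
          (quiet (.idle (ρ t')) .stay none fun j => bitsTape (ls (e.symm j)) 0) =
          image code val ρ e start acc t' m ls := by
        intro t'
        rw [image, act_quiet]
        simp [image, TM.moveHead, hpos]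
      rw [← hact t', ← hact t'']
      simp [TM.Step, TM.possible, machine, trans, image, conf, ht, ho, Op.mapReg]
    refine .step _ hg ⟨_, (key _).2 (.inl rfl)⟩ fun c' hc' => ?_
    rcases (key c').1 hc' with rfl | rfl
    · exact (H _ _ ls (by simp [CStep, ho])).2 hm
    · exact (H _ _ ls (by simp [CStep, ho])).2 hm


theorem mem_targets {c c' : T × Mem ι} (h : CStep code x c c') : c'.1 ∈ (code c.1).targets := by
  unfold CStep at h
  split at h <;> simp_all [Op.targets]
  · split_ifs <;> simp
  · rcases h with rfl | rfl <;> simp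

theorem cstep_unique {c c₁ c₂ : T × Mem ι} (hd : (code c.1).IsDet) (h₁ : CStep code x c c₁)
    (h₂ : CStep code x c c₂) : c₁ = c₂ := by
  unfold CStep at h₁ h₂
  split at h₁ <;> simp_all [Op.IsDet]

/-- The bounds that a counter machine has to observe: on the counters, and that accepting states
occur only if `P` holds. -/
def CGood (acc : Set T) (B : ℕ) (P : Prop) (c : T × Mem ι) : Prop :=
  (∀ i, c.2.reg i ≤ B) ∧ (c.1 ∈ acc → P)

variable {S : Set T} {accT : Set T}

/-- Induction on `Runs`, each step being replaced by its sweep. This controls all computations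
simultaneously: space, output, and the condition under which an accepting state occurs. Control
states are restricted to a closed set `S`, on which `ρ` into the finite type `F` is inverted by
`val`. -/
theorem runs_image {B D : ℕ} (hB : B < 2 ^ D) {P : Prop} (hS : ∀ t ∈ S, val (ρ t) = t)
    (hclosed : ∀ t ∈ S, (code t).targets ⊆ S) (hacc : ∀ t ∈ S, ρ t ∈ acc → t ∈ accT)
    {Q : Mem ι → Prop} {c : T × Mem ι}
    (h : Runs (CStep code x) (CGood accT B P) (fun c => code c.1 = .halt ∧ Q c.2) c)
    (hc : c.1 ∈ S) {ls : ι → List Bool} (hm : Represents D x c.2 ls) :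
    Runs ((machine (fun t => (code t).mapReg e) val ρ start acc).Step x) (Good D P)
      (fun c => (machine (fun t => (code t).mapReg e) val ρ start acc).possible x c = ∅ ∧
        ∃ m, Q m ∧ c.output = m.out)
      (image code val ρ e start acc c.1 c.2 ls) := by
  induction h generalizing ls with
  | done c hg hp =>
    refine .done _ (good_image fun h => hg.2 (hacc _ hc h)) ⟨?_, c.2, hp.2, rfl⟩
    simp [TM.possible, machine, trans, image, conf, hS _ hc, hp.1, Op.mapReg]
  | step c hg hex hall ih =>
    obtain ⟨t, m⟩ := c
    refine runs_image_of_step hB (hS _ hc) (fun h => hg.2 (hacc _ hc h)) hm hex ?_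
    intro t' m' ls' hstep
    refine ⟨?_, ih _ hstep (hclosed _ hc (mem_targets hstep))⟩
    cases hall _ hstep with
    | done _ hg _ => exact hg.1
    | step _ hg _ _ => exact hg.1

/-- The converse direction, for acceptance: `Runs` only yields some computation, whereas here a
prescribed one has to be followed step by step. -/
theorem exists_image {B D : ℕ} (hB : B < 2 ^ D) {P : Prop} (hS : ∀ t ∈ S, val (ρ t) = t)
    (hclosed : ∀ t ∈ S, (code t).targets ⊆ S) (hacc : ∀ t ∈ S, ρ t ∈ acc → t ∈ accT)
    {c c' : T × Mem ι} (hc : c.1 ∈ S)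
    (hg : ∀ c', Relation.ReflTransGen (CStep code x) c c' → CGood accT B P c')
    (h : Relation.ReflTransGen (CStep code x) c c')
    {ls : ι → List Bool} (hm : Represents D x c.2 ls) :
    c'.1 ∈ S ∧ ∃ ls', Represents D x c'.2 ls' ∧
      Relation.ReflTransGen ((machine (fun t => (code t).mapReg e) val ρ start acc).Step x)
        (image code val ρ e start acc c.1 c.2 ls) (image code val ρ e start acc c'.1 c'.2 ls') := by
  induction h with
  | refl => exact ⟨hc, ls, hm, .refl⟩
  | @tail b c' hb hstep ih =>
    obtain ⟨hbS, lb, hlb, hreach⟩ := ih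
    have hgb := hg _ hb
    refine ⟨hclosed _ hbS (mem_targets hstep), ?_⟩
    obtain ⟨t, m⟩ := b
    obtain ⟨t', m'⟩ := c'
    by_cases hdet : (code t).IsDet
    -- For an operation with a unique successor, the simulation of one step, taken with the image of
    -- that successor as postcondition, must lead there.
    · obtain ⟨d, hd, -, ls', hls', rfl⟩ := (runs_image_of_step (start := start) hB (hS _ hbS)
        (fun h => hgb.2 (hacc _ hbS h)) hlb ⟨_, hstep⟩
        (post := fun c => ∃ ls', Represents D x m' ls' ∧
          c = image code val ρ e start acc t' m' ls') (fun t₁ m₁ ls' h₁ => by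
            have heq := cstep_unique hdet h₁ hstep
            simp only [Prod.mk.injEq] at heq
            obtain ⟨rfl, rfl⟩ := heq
            have hg' := hg _ (hb.tail hstep)
            refine ⟨hg'.1, fun hr => .done _ (good_image fun h =>
              hg'.2 (hacc _ (hclosed _ hbS (mem_targets hstep)) h)) ⟨ls', hr, rfl⟩⟩)).exists_post
      exact ⟨ls', hls', hreach.trans hd⟩
    · cases ho : code t with
      | choice t₁ t₂ =>
        have hact : ∀ t' : T, (machine (fun t => (code t).mapReg e) val ρ start acc).act x
            (image code val ρ e start acc t m lb)
            (quiet (.idle (ρ t')) .stay none fun j => bitsTape (lb (e.symm j)) 0) =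
            image code val ρ e start acc t' m lb := by
          intro t'
          rw [image, act_quiet]
          have := hlb.pos_le
          simp_all [image, TM.moveHead]
        simp only [CStep, ho, Prod.mk.injEq] at hstep
        rcases hstep with ⟨rfl, rfl⟩ | ⟨rfl, rfl⟩
        all_goals
          refine ⟨lb, hlb, hreach.tail ⟨_, ?_, (hact t').symm⟩⟩
          simp [TM.possible, machine, trans, image, conf, hS _ hbS, ho, Op.mapReg]
      | _ => simp [ho, Op.IsDet] at hdet

variable (code) in
/-- A counter machine that uses finitely many states, as a Turing machine. -/
noncomputable abbrev ofCode (S : Set T) [Finite S] (t₀ : S) (accT : Set T) (e : ι ≃ Fin k) : TM :=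
  open Classical in
  machine (fun t => (code t).mapReg e) Subtype.val (fun t => if h : t ∈ S then ⟨t, h⟩ else t₀) t₀
    {t | t.1 ∈ accT}

theorem runs_ofCode [Finite S] (t₀ : S) {B D : ℕ} (hB : B < 2 ^ D) {P : Prop}
    (hclosed : ∀ t ∈ S, (code t).targets ⊆ S) {Q : Mem ι → Prop}
    (h : Runs (CStep code x) (CGood accT B P) (fun c => code c.1 = .halt ∧ Q c.2)
      (t₀, Mem.init ι)) :
    Runs ((ofCode code S t₀ accT e).Step x) (Good D P)
      (fun c => (ofCode code S t₀ accT e).possible x c = ∅ ∧ ∃ m, Q m ∧ c.output = m.out)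
      (ofCode code S t₀ accT e).initial := by
  classical
  refine .of_functional ⟨fun _ => Nat.zero_le _, ?_⟩ initial_step ?_
  · rintro ⟨t, _, ht⟩
    simp [TM.initial] at ht
  · have := runs_image (D := D) (P := P) (S := S) (val := Subtype.val) (e := e) (start := t₀)
      (ρ := fun t => if h : t ∈ S then ⟨t, h⟩ else t₀) (acc := {t | t.1 ∈ accT}) hB
      (fun t ht => by simp [ht]) hclosed (fun t ht h => by simpa [ht] using h) h t₀.2
      (ls := fun _ => []) ⟨fun _ => rfl, fun _ => Nat.zero_le _, Nat.zero_le _⟩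
    convert this using 1
    simp [image, Mem.init]

theorem accepts_ofCode [Finite S] (t₀ : S) {B D : ℕ} (hB : B < 2 ^ D) {P : Prop}
    (hclosed : ∀ t ∈ S, (code t).targets ⊆ S)
    (hg : ∀ c', Relation.ReflTransGen (CStep code x) ((t₀ : T), Mem.init ι) c' →
      CGood accT B P c')
    {c : T × Mem ι} (h : Relation.ReflTransGen (CStep code x) ((t₀ : T), Mem.init ι) c)
    (hc : c.1 ∈ accT) :
    (ofCode code S t₀ accT e).Accepts x := by
  classical
  obtain ⟨hcS, ls, -, hr⟩ := exists_image (D := D) (P := P) (S := S) (val := Subtype.val) (e := e)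
    (start := t₀) (ρ := fun t => if h : t ∈ S then ⟨t, h⟩ else t₀) (acc := {t | t.1 ∈ accT}) hB
      (fun t ht => by simp [ht]) hclosed (fun t ht h => by simpa [ht] using h) t₀.2 hg h
      (ls := fun _ => []) ⟨fun _ => rfl, fun _ => Nat.zero_le _, Nat.zero_le _⟩
  refine ⟨image code Subtype.val (fun t => if h : t ∈ S then ⟨t, h⟩ else t₀) e t₀
    {t | t.1 ∈ accT} c.1 c.2 ls, .head ((initial_step _).2 rfl) ?_, ⟨⟨c.1, hcS⟩, hc, ?_⟩⟩
  · convert hr using 1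
    simp [image, Mem.init]
  · simp [image, conf, hcS]

/-- Turns the polynomial bound on the counters into a logarithmic number of bits. -/
theorem pow_lt_two_pow_log (N K : ℕ) : (N + 2) ^ K < 2 ^ (K * (Nat.log 2 N + 2) + 1) := by
  have h : N + 2 ≤ 2 ^ (Nat.log 2 N + 2) := by
    have := Nat.lt_pow_succ_log_self (b := 2) one_lt_two N
    have h2 : 1 ≤ 2 ^ Nat.log 2 N := Nat.one_le_two_pow
    simp only [pow_succ] at *
    omega
  calc (N + 2) ^ K ≤ (2 ^ (Nat.log 2 N + 2)) ^ K := Nat.pow_le_pow_left h K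
    _ = 2 ^ (K * (Nat.log 2 N + 2)) := by rw [← pow_mul, mul_comm]
    _ < _ := Nat.pow_lt_pow_right one_lt_two (Nat.lt_succ_self _)

/-- Of the two extra units, one belongs to the number of bits and one to the head, which may stand
one cell beyond the last bit. -/
theorem logSpace_of_good {M : TM} {K : ℕ}
    (h : ∀ x c, M.Reachable x c → ∀ i, c.head i ≤ K * (Nat.log 2 x.length + 2) + 1 + 1) :
    M.LogSpace := by
  refine ⟨2 * K + 2, fun x c hc i => (h x c hc i).trans ?_⟩
  nlinarith [Nat.zero_le (Nat.log 2 x.length), Nat.zero_le (K * Nat.log 2 x.length)]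

theorem reachable_good [Finite S] (t₀ : S) {B D : ℕ} (hB : B < 2 ^ D) {P : Prop}
    (hclosed : ∀ t ∈ S, (code t).targets ⊆ S) {Q : Mem ι → Prop}
    (h : Runs (CStep code x) (CGood accT B P) (fun c => code c.1 = .halt ∧ Q c.2)
      (t₀, Mem.init ι))
    (c) (hc : (ofCode code S t₀ accT e).Reachable x c) : Good D P c := by
  refine (runs_ofCode t₀ hB hclosed h).good_of_reach ?_ hc
  rintro c ⟨hc, -⟩ c' ⟨a, ha, -⟩
  simp [hc] at ha

variable [Finite ι]

/-- A deterministic counter machine with polynomially bounded counters computes a function in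
logarithmic space. -/
theorem logSpaceComputable_of_code [Finite S] (t₀ : S) (K : ℕ)
    (hclosed : ∀ t ∈ S, (code t).targets ⊆ S) (hdet : ∀ t ∈ S, (code t).IsDet)
    (f : List Bool → List Bool)
    (h : ∀ x : List Bool, Runs (CStep code x) (CGood ∅ ((x.length + 2) ^ K) True)
      (fun c => code c.1 = .halt ∧ c.2.out = f x) ((t₀ : T), Mem.init ι)) :
    LogSpaceComputable f := by
  obtain ⟨k, ⟨e⟩⟩ := Finite.exists_equiv_fin ι
  refine ⟨ofCode code S t₀ ∅ e, machine_deterministic _ _ _ _ _ fun t => (hdet t.1 t.2).mapReg e,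
    logSpace_of_good (K := K) fun x c hc i => ?_, fun x => ?_⟩
  · exact (reachable_good t₀ (pow_lt_two_pow_log _ _) hclosed
      (Q := fun m => m.out = f x) (h x) c hc).1 i
  · obtain ⟨c, hc, -, hc', m, hm, hcm⟩ := (runs_ofCode (e := e) t₀ (pow_lt_two_pow_log _ _) hclosed
      (Q := fun m => m.out = f x) (h x)).exists_post
    exact ⟨c, hc, hc', hcm.trans hm⟩

/-- A nondeterministic counter machine with polynomially bounded counters accepts a language
in `NL`. -/
theorem mem_classNL_of_code [Finite S] (t₀ : S) (K : ℕ)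
    (hclosed : ∀ t ∈ S, (code t).targets ⊆ S) (L : Set (List Bool))
    (h : ∀ x : List Bool, Runs (CStep code x) (CGood accT ((x.length + 2) ^ K) (x ∈ L))
      (fun c => code c.1 = .halt) ((t₀ : T), Mem.init ι))
    (hL : ∀ x ∈ L, ∃ c, Relation.ReflTransGen (CStep code x) ((t₀ : T), Mem.init ι) c ∧
      c.1 ∈ accT) :
    L ∈ classNL := by
  obtain ⟨k, ⟨e⟩⟩ := Finite.exists_equiv_fin ι
  have h' : ∀ x : List Bool, Runs (CStep code x) (CGood accT ((x.length + 2) ^ K) (x ∈ L))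
      (fun c => code c.1 = .halt ∧ (fun _ => True) c.2) ((t₀ : T), Mem.init ι) := by simpa using h
  refine ⟨ofCode code S t₀ accT e,
    logSpace_of_good (K := K) fun x c hc i => ?_, fun x => ⟨fun hx => ?_, ?_⟩⟩
  · exact (reachable_good t₀ (pow_lt_two_pow_log _ _) hclosed (Q := fun _ => True) (h' x) c hc).1 i
  · obtain ⟨c, hc, hc'⟩ := hL x hx
    refine accepts_ofCode (P := x ∈ L) t₀ (pow_lt_two_pow_log x.length K) hclosed (fun c' h => ?_) hc hc'
    refine (h' x).good_of_reach ?_ h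
    rintro c ⟨hc, -⟩ c'
    simp [CStep, hc]
  · rintro ⟨c, hc, hacc⟩
    exact (reachable_good t₀ (pow_lt_two_pow_log _ _) hclosed (Q := fun _ => True) (h' x) c hc).2 hacc

end CounterTM

/-! ## Structured programs for counter machines -/

/-- Structured programs with counters `ι`. -/
inductive Prog (ι : Type) where
  | skip
  | accept
  | inc (i : ι)
  | out (b : Bool)
  | move (d : HeadMove)
  | seq (p q : Prog ι)
  | ifDec (i : ι) (p q : Prog ι)
  | whileDec (i : ι) (p : Prog ι)
  | ifIn (f : InputSymbol → Bool) (p q : Prog ι)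
  | whileIn (f : InputSymbol → Bool) (p : Prog ι)
  | guess (p q : Prog ι)

namespace Prog

infixr:60 " ;; " => Prog.seq

variable {ι : Type}

/-- Programs without guesses. -/
def Det : Prog ι → Prop
  | seq p q => p.Det ∧ q.Det
  | ifDec _ p q => p.Det ∧ q.Det
  | whileDec _ p => p.Det
  | ifIn _ p q => p.Det ∧ q.Det
  | whileIn _ p => p.Det
  | guess _ _ => False
  | _ => True

/-- The counter machine for structured programs; its control states are lists of programs that
remain to be executed. -/
def code : List (Prog ι) → Op ι (List (Prog ι))
  | [] => .halt
  | skip :: K => .read fun _ => K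
  | accept :: K => .read fun _ => K
  | inc i :: K => .inc i K
  | out b :: K => .out b K
  | move d :: K => .move d K
  | seq p q :: K => .read fun _ => p :: q :: K
  | ifDec i p q :: K => .dec i (p :: K) (q :: K)
  | whileDec i p :: K => .dec i (p :: whileDec i p :: K) K
  | ifIn f p q :: K => .read fun s => if f s then p :: K else q :: K
  | whileIn f p :: K => .read fun s => if f s then p :: whileIn f p :: K else K
  | guess p q :: K => .choice (p :: K) (q :: K)

/-- The control states that occur during the execution of a program. -/
def conts : Prog ι → List (Prog ι) → Set (List (Prog ι))
  | skip, K => {skip :: K}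
  | accept, K => {accept :: K}
  | inc i, K => {inc i :: K}
  | out b, K => {out b :: K}
  | move d, K => {move d :: K}
  | seq p q, K => {seq p q :: K} ∪ (conts p (q :: K) ∪ conts q K)
  | ifDec i p q, K => {ifDec i p q :: K} ∪ (conts p K ∪ conts q K)
  | whileDec i p, K => {whileDec i p :: K} ∪ conts p (whileDec i p :: K)
  | ifIn f p q, K => {ifIn f p q :: K} ∪ (conts p K ∪ conts q K)
  | whileIn f p, K => {whileIn f p :: K} ∪ conts p (whileIn f p :: K)
  | guess p q, K => {guess p q :: K} ∪ (conts p K ∪ conts q K)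

theorem conts_finite (p : Prog ι) (K : List (Prog ι)) : (conts p K).Finite := by
  induction p generalizing K <;> simp_all [conts]

theorem mem_conts (p : Prog ι) (K : List (Prog ι)) : p :: K ∈ conts p K := by
  cases p <;> simp [conts]

/-- Control states are lists of remaining programs, yet finitely many suffice: a loop pushes its
body on top of the loop itself, so unfolding it creates no new lists. The only exit is the
continuation `K`. -/
theorem targets_conts (p : Prog ι) (K : List (Prog ι)) :
    ∀ t ∈ conts p K, (code t).targets ⊆ conts p K ∪ {K} := by
  have lift : ∀ {X Y : Set (List (Prog ι))} {K' : List (Prog ι)},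
      (∀ t ∈ X, (code t).targets ⊆ X ∪ {K'}) → X ⊆ Y → K' ∈ Y → ∀ t ∈ X, (code t).targets ⊆ Y :=
    fun h hX hK t ht => (h t ht).trans (Set.union_subset hX (Set.singleton_subset_iff.2 hK))
  induction p generalizing K with
  | skip | accept => rintro t rfl _ ⟨_, rfl⟩; exact .inr rfl
  | inc | out | move => rintro t rfl; simp [code, Op.targets]
  | seq p q ihp ihq =>
    rintro t (rfl | ht | ht)
    · simp only [code, Op.targets]
      rintro _ ⟨_, rfl⟩
      exact .inl (.inr (.inl (mem_conts p _)))
    · refine lift (ihp _) (fun s hs => .inl (.inr (.inl hs))) ?_ t ht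
      exact .inl (.inr (.inr (mem_conts q K)))
    · exact lift (ihq _) (fun s hs => .inl (.inr (.inr hs))) (.inr rfl) t ht
  | ifDec i p q ihp ihq =>
    rintro t (rfl | ht | ht)
    · rintro _ (rfl | rfl)
      · exact .inl (.inr (.inl (mem_conts p _)))
      · exact .inl (.inr (.inr (mem_conts q _)))
    · exact lift (ihp _) (fun s hs => .inl (.inr (.inl hs))) (.inr rfl) t ht
    · exact lift (ihq _) (fun s hs => .inl (.inr (.inr hs))) (.inr rfl) t ht
  | whileDec i p ihp =>
    rintro t (rfl | ht)
    · rintro _ (rfl | rfl)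
      · exact .inl (.inr (mem_conts p _))
      · exact .inr rfl
    · exact lift (ihp _) (fun s hs => .inl (.inr hs)) (.inl (.inl rfl)) t ht
  | ifIn f p q ihp ihq =>
    rintro t (rfl | ht | ht)
    · rintro _ ⟨s, rfl⟩
      dsimp only
      split_ifs
      · exact .inl (.inr (.inl (mem_conts p _)))
      · exact .inl (.inr (.inr (mem_conts q _)))
    · exact lift (ihp _) (fun s hs => .inl (.inr (.inl hs))) (.inr rfl) t ht
    · exact lift (ihq _) (fun s hs => .inl (.inr (.inr hs))) (.inr rfl) t ht
  | whileIn f p ihp =>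
    rintro t (rfl | ht)
    · rintro _ ⟨s, rfl⟩
      dsimp only
      split_ifs
      · exact .inl (.inr (mem_conts p _))
      · exact .inr rfl
    · exact lift (ihp _) (fun s hs => .inl (.inr hs)) (.inl (.inl rfl)) t ht
  | guess p q ihp ihq =>
    rintro t (rfl | ht | ht)
    · rintro _ (rfl | rfl)
      · exact .inl (.inr (.inl (mem_conts p _)))
      · exact .inl (.inr (.inr (mem_conts q _)))
    · exact lift (ihp _) (fun s hs => .inl (.inr (.inl hs))) (.inr rfl) t ht
    · exact lift (ihq _) (fun s hs => .inl (.inr (.inr hs))) (.inr rfl) t ht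

theorem isDet_of_mem_conts {p : Prog ι} (hp : p.Det) (K : List (Prog ι)) :
    ∀ t ∈ conts p K, (code t).IsDet := by
  induction p generalizing K with
  | skip | accept | inc | out | move => rintro t rfl; trivial
  | seq p q ihp ihq | ifDec _ p q ihp ihq | ifIn _ p q ihp ihq =>
    rintro t (rfl | ht | ht)
    · trivial
    · exact ihp hp.1 _ t ht
    · exact ihq hp.2 _ t ht
  | whileDec _ p ihp | whileIn _ p ihp =>
    rintro t (rfl | ht)
    · trivial
    · exact ihp hp _ t ht
  | guess => exact hp.elim

/-- The control states of a program. -/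
def states (p : Prog ι) : Set (List (Prog ι)) := conts p [] ∪ {[]}

instance (p : Prog ι) : Finite p.states :=
  ((conts_finite p []).union (Set.finite_singleton _)).to_subtype

theorem targets_states (p : Prog ι) : ∀ t ∈ p.states, (code t).targets ⊆ p.states := by
  rintro t (ht | rfl)
  · exact targets_conts p [] t ht
  · simp [code, Op.targets]

/-- The control states in which a program accepts. -/
def acceptStates : Set (List (Prog ι)) := {t | ∃ K, t = accept :: K}

variable [DecidableEq ι]

/-- The runs of programs on the input `x`, with counters bounded by `B`, that may accept only if
`P` holds. -/
abbrev PRuns (x : List Bool) (B : ℕ) (P : Prop) :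
    (List (Prog ι) × Mem ι → Prop) → List (Prog ι) × Mem ι → Prop :=
  Runs (CStep code x) (CounterTM.CGood acceptStates B P)

/-- Weakest preconditions: started in the memory `m`, the program `p` terminates, with counters
bounded by `B`, in a memory that satisfies `Q`. -/
def Wp (x : List Bool) (B : ℕ) (P : Prop) (p : Prog ι) (m : Mem ι) (Q : Mem ι → Prop) : Prop :=
  (∀ i, m.reg i ≤ B) → ∀ K post,
    (∀ m', (∀ i, m'.reg i ≤ B) → Q m' → PRuns x B P post (K, m')) → PRuns x B P post (p :: K, m)

variable {x : List Bool} {B : ℕ} {P : Prop} {m : Mem ι} {Q : Mem ι → Prop} {p q : Prog ι}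

theorem logSpaceComputable [Finite ι] (p : Prog ι) (hp : p.Det) (K : ℕ) (f : List Bool → List Bool)
    (h : ∀ x : List Bool, Wp x ((x.length + 2) ^ K) True p (Mem.init ι) fun m => m.out = f x) :
    LogSpaceComputable f := by
  refine CounterTM.logSpaceComputable_of_code (S := p.states) ⟨[p], .inl (mem_conts p [])⟩ K
    (targets_states p) ?_ f fun x => ?_
  · rintro t (ht | rfl)
    · exact isDet_of_mem_conts hp [] t ht
    · trivial
  · have := h x (fun i => Nat.zero_le _) []
      (fun c => code c.1 = .halt ∧ c.2.out = f x) fun m' hm' hq =>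
        .done _ ⟨hm', by rintro ⟨K, hK⟩; simp at hK⟩ ⟨rfl, hq⟩
    -- For computing a function acceptance is irrelevant, and the accepting states may be forgotten.
    have mono : ∀ c, PRuns x ((x.length + 2) ^ K) True
        (fun c => code c.1 = .halt ∧ c.2.out = f x) c →
        Runs (CStep code x) (CounterTM.CGood ∅ ((x.length + 2) ^ K) True)
        (fun c : List (Prog ι) × Mem ι => code c.1 = .halt ∧ c.2.out = f x) c := by
      intro c hc
      induction hc with
      | done c hg hp => exact .done _ ⟨hg.1, fun _ => trivial⟩ hp
      | step c hg he _ ih => exact .step _ ⟨hg.1, fun _ => trivial⟩ he ih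
    exact mono _ this

theorem mem_classNL [Finite ι] (p : Prog ι) (K : ℕ) (L : Set (List Bool))
    (h : ∀ x : List Bool, Wp x ((x.length + 2) ^ K) (x ∈ L) p (Mem.init ι) fun _ => True)
    (hL : ∀ x ∈ L, ∃ K m, Relation.ReflTransGen (CStep code x) ([p], Mem.init ι) (accept :: K, m)) :
    L ∈ classNL := by
  refine CounterTM.mem_classNL_of_code (S := p.states) (accT := acceptStates)
    ⟨[p], .inl (mem_conts p [])⟩ K (targets_states p) L (fun x => ?_) fun x hx => ?_
  · exact h x (fun i => Nat.zero_le _) [] (fun c => code c.1 = .halt) fun m' hm' hq =>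
      .done _ ⟨hm', by rintro ⟨K, hK⟩; simp at hK⟩ rfl
  · obtain ⟨K, m, hr⟩ := hL x hx
    exact ⟨_, hr, K, rfl⟩

/-! ### Proof rules for weakest preconditions -/

namespace Wp

theorem mono {Q' : Mem ι → Prop} (h : Wp x B P p m Q) (hQ : ∀ m', Q m' → Q' m') :
    Wp x B P p m Q' :=
  fun hm K post H => h hm K post fun m' hm' hq => H m' hm' (hQ m' hq)

theorem bounded (h : (∀ i, m.reg i ≤ B) → Wp x B P p m Q) : Wp x B P p m Q :=
  fun hm => h hm hm

/-- The bound on the counters may be used in the postcondition. -/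
theorem mono_bounded {Q' : Mem ι → Prop} (h : Wp x B P p m Q)
    (hQ : ∀ m', (∀ i, m'.reg i ≤ B) → Q m' → Q' m') : Wp x B P p m Q' :=
  fun hm K post H => h hm K post fun m' hm' hq => H m' hm' (hQ m' hm' hq)

theorem of_step {K : List (Prog ι)} {post : List (Prog ι) × Mem ι → Prop}
    {c' : List (Prog ι) × Mem ι} (hm : ∀ i, m.reg i ≤ B) (hp : p = .accept → P)
    (hs : ∀ d, CStep code x (p :: K, m) d ↔ d = c') (h : PRuns x B P post c') :
    PRuns x B P post (p :: K, m) := by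
  refine .of_functional ⟨hm, ?_⟩ hs h
  rintro ⟨K', hK⟩
  simp only [List.cons.injEq] at hK
  exact hp hK.1

theorem skip (h : Q m) : Wp x B P skip m Q :=
  fun hm _ _ H => of_step hm (by simp) (by simp [CStep, code]) (H m hm h)

theorem accept (hP : P) (h : Q m) : Wp x B P accept m Q :=
  fun hm _ _ H => of_step hm (fun _ => hP) (by simp [CStep, code]) (H m hm h)

theorem inc {i : ι} (hB : m.reg i + 1 ≤ B)
    (h : Q { m with reg := Function.update m.reg i (m.reg i + 1) }) : Wp x B P (inc i) m Q := by
  refine fun hm _ _ H => of_step hm (by simp) (by simp [CStep, code]) (H _ (fun j => ?_) h)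
  by_cases hj : j = i
  · subst hj; simpa using hB
  · simpa [hj] using hm j

theorem out {b : Bool} (h : Q { m with out := m.out ++ [b] }) : Wp x B P (out b) m Q :=
  fun hm _ _ H => of_step hm (by simp) (by simp [CStep, code])
    (H { m with out := m.out ++ [b] } hm h)

theorem move {d : HeadMove}
    (h : Q { m with pos := min (TM.moveHead d m.pos) (x.length + 1) }) :
    Wp x B P (move d) m Q :=
  fun hm _ _ H => of_step hm (by simp) (by simp [CStep, code])
    (H { m with pos := min (TM.moveHead d m.pos) (x.length + 1) } hm h)

theorem seq (h : Wp x B P p m fun m' => Wp x B P q m' Q) : Wp x B P (p ;; q) m Q :=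
  fun hm K _ H => of_step (c' := (p :: q :: K, m)) hm (by simp) (by simp [CStep, code])
    (h hm _ _ fun _ hm' hq => hq hm' K _ H)

theorem dec_le {i : ι} (hm : ∀ i, m.reg i ≤ B) :
    ∀ j, Function.update m.reg i (m.reg i - 1) j ≤ B := by
  intro j
  by_cases hj : j = i
  · subst hj
    have := hm j
    simp only [Function.update_self]
    omega
  · simpa [hj] using hm j

theorem ifDec {i : ι} (h0 : m.reg i = 0 → Wp x B P q m Q)
    (h1 : m.reg i ≠ 0 →
      Wp x B P p { m with reg := Function.update m.reg i (m.reg i - 1) } Q) :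
    Wp x B P (ifDec i p q) m Q := by
  intro hm K post H
  by_cases hi : m.reg i = 0
  · exact of_step (c' := (q :: K, m)) hm (by simp) (by simp [CStep, code, hi])
      (h0 hi hm K post H)
  · exact of_step (c' := (p :: K, { m with reg := Function.update m.reg i (m.reg i - 1) })) hm
      (by simp) (by simp [CStep, code, hi]) (h1 hi (dec_le hm) K post H)

/-- The tested counter is itself the variant: the test lowers it by one, and the body must not undo
this. -/
theorem whileDec {i : ι} (I : Mem ι → Prop) (hI : I m) (h0 : ∀ m, I m → m.reg i = 0 → Q m)
    (h1 : ∀ m, I m → m.reg i ≠ 0 →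
      Wp x B P p { m with reg := Function.update m.reg i (m.reg i - 1) }
        fun m' => I m' ∧ m'.reg i < m.reg i) :
    Wp x B P (whileDec i p) m Q := by
  intro hm K post H
  obtain ⟨n, hn⟩ : ∃ n, n = m.reg i := ⟨_, rfl⟩
  induction n using Nat.strong_induction_on generalizing m with
  | _ n ih =>
    by_cases hi : m.reg i = 0
    · exact of_step (c' := (K, m)) hm (by simp) (by simp [CStep, code, hi]) (H m hm (h0 m hI hi))
    · refine of_step (c' := (p :: .whileDec i p :: K,
        { m with reg := Function.update m.reg i (m.reg i - 1) })) hm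
        (by simp) (by simp [CStep, code, hi]) (h1 m hI hi (dec_le hm) _ _ ?_)
      intro m' hm' hq
      exact ih (m'.reg i) (hn ▸ hq.2) hq.1 hm' rfl

theorem ifIn {f : InputSymbol → Bool}
    (h1 : f (TM.readInput x m.pos) = true → Wp x B P p m Q)
    (h0 : f (TM.readInput x m.pos) = false → Wp x B P q m Q) :
    Wp x B P (ifIn f p q) m Q := by
  intro hm K post H
  cases hf : f (TM.readInput x m.pos)
  · exact of_step (c' := (q :: K, m)) hm (by simp) (by simp [CStep, code, hf])
      (h0 hf hm K post H)
  · exact of_step (c' := (p :: K, m)) hm (by simp) (by simp [CStep, code, hf])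
      (h1 hf hm K post H)

theorem whileIn {f : InputSymbol → Bool} (I : Mem ι → Prop) (μ : Mem ι → ℕ) (hI : I m)
    (h0 : ∀ m, I m → f (TM.readInput x m.pos) = false → Q m)
    (h1 : ∀ m, I m → f (TM.readInput x m.pos) = true →
      Wp x B P p m fun m' => I m' ∧ μ m' < μ m) :
    Wp x B P (whileIn f p) m Q := by
  intro hm K post H
  obtain ⟨n, hn⟩ : ∃ n, n = μ m := ⟨_, rfl⟩
  induction n using Nat.strong_induction_on generalizing m with
  | _ n ih =>
    cases hf : f (TM.readInput x m.pos)
    · exact of_step (c' := (K, m)) hm (by simp) (by simp [CStep, code, hf]) (H m hm (h0 m hI hf))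
    · refine of_step (c' := (p :: .whileIn f p :: K, m)) hm
        (by simp) (by simp [CStep, code, hf]) (h1 m hI hf hm _ _ ?_)
      intro m' hm' hq
      exact ih (μ m') (hn ▸ hq.2) hq.1 hm' rfl

theorem guess (hp : Wp x B P p m Q) (hq : Wp x B P q m Q) : Wp x B P (guess p q) m Q := by
  intro hm K post H
  refine .step _ ⟨hm, ?_⟩ ⟨(p :: K, m), by simp [CStep, code]⟩ fun c' hc' => ?_
  · rintro ⟨K', hK⟩; simp at hK
  · simp only [CStep, code] at hc'
    rcases hc' with rfl | rfl
    · exact hp hm K post H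
    · exact hq hm K post H

/-- A program that certainly reaches `Q` has an execution that does so. -/
theorem exists_exec (h : Wp x B P p m Q) (hm : ∀ i, m.reg i ≤ B) (K : List (Prog ι)) (hP : P) :
    ∃ m', (∀ i, m'.reg i ≤ B) ∧ Q m' ∧
      Relation.ReflTransGen (CStep code x) (p :: K, m) (K, m') := by
  obtain ⟨⟨K', m'⟩, hr, hg, rfl, hq⟩ := (h hm K (fun c => c.1 = K ∧ Q c.2) fun m' hm' hq =>
    .done _ ⟨hm', fun _ => hP⟩ ⟨rfl, hq⟩).exists_post
  exact ⟨m', hg.1, hq, hr⟩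

end Wp

end Prog

/-! ### Arithmetic on counters -/

namespace Prog

variable {ι : Type}

/-- `r_i := 0` -/
def zero (i : ι) : Prog ι := .whileDec i .skip

/-- `r_d := r_d + r_s`, where `r_t = 0`. -/
def addVia (d s t : ι) : Prog ι := .whileDec s (.inc d ;; .inc t) ;; .whileDec t (.inc s)

/-- `r_d := r_d - r_s`, where `r_t = 0`. -/
def subVia (d s t : ι) : Prog ι :=
  .whileDec s (.ifDec d .skip .skip ;; .inc t) ;; .whileDec t (.inc s)

/-- `r_q, r_r := r_r / r_b, r_r % r_b`, where `r_t = r_c = r_e = 0` and `r_b` is positive. -/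
def divModVia (r q b t c e : ι) : Prog ι :=
  zero q ;; addVia c r t ;; zero r ;; addVia e b t ;; .ifDec e .skip .skip ;;
  .whileDec c (.ifDec e (.inc r) (addVia e r t ;; zero r ;; .inc q)) ;; zero e

/-- Move the input head to the left end marker. -/
def rewind : Prog ι :=
  .whileIn (fun s => match s with | .leftEnd => false | _ => true) (.move .left)

/-- `r_d := r_d + |x|` for the input `x`. -/
def addLength (d : ι) : Prog ι :=
  rewind ;; .move .right ;;
  .whileIn (fun s => match s with | .bit _ => true | _ => false) (.inc d ;; .move .right)

namespace Wp

variable [DecidableEq ι] {x : List Bool} {B : ℕ} {P : Prop} {m : Mem ι} {Q : Mem ι → Prop}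

theorem update_zero_of_eq {f : ι → ℕ} {i : ι} (h : f i = 0) : Function.update f i 0 = f := by
  rw [← h, Function.update_eq_self]

theorem zero {i : ι} (h : Q { m with reg := Function.update m.reg i 0 }) :
    Wp x B P (zero i) m Q := by
  refine whileDec (fun m' => ∃ c, m' = { m with reg := Function.update m.reg i c })
    ⟨m.reg i, by simp⟩ ?_ ?_
  · rintro _ ⟨c, rfl⟩ hc
    simp only [Function.update_self] at hc
    rwa [hc]
  · rintro _ ⟨c, rfl⟩ hc
    simp only [Function.update_self, ne_eq] at hc
    refine skip ⟨⟨c - 1, by simp⟩, ?_⟩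
    simp; omega

/-- The second half of `addVia` and `subVia`: reading a counter destroys it, so a copy is kept in
`t` and poured back. -/
theorem restore {s t : ι} (hst : s ≠ t)
    (h : Q { m with reg := Function.update (Function.update m.reg s (m.reg s + m.reg t)) t 0 })
    (hB : m.reg s + m.reg t ≤ B) :
    Wp x B P (.whileDec t (.inc s)) m Q := by
  refine whileDec (fun m' => ∃ j ≤ m.reg t, m' =
    ⟨Function.update (Function.update m.reg s (m.reg s + j)) t (m.reg t - j), m.pos, m.out⟩)
    ⟨0, by simp⟩ ?_ ?_
  · rintro _ ⟨j, hj, rfl⟩ hc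
    simp only [Function.update_self] at hc
    rwa [hc, show j = m.reg t by omega]
  · rintro _ ⟨j, hj, rfl⟩ hc
    simp only [Function.update_self, ne_eq] at hc
    refine inc (by simp [hst]; omega) ⟨⟨j + 1, by omega, ?_⟩, by simp [hst.symm]; omega⟩
    ext r
    · by_cases h1 : r = s
      · subst h1; simp [hst]; omega
      · by_cases h2 : r = t
        · subst h2; simp [h1]; omega
        · simp [h1, h2]
    · rfl
    · rfl

theorem addVia {d s t : ι} (hds : d ≠ s) (hdt : d ≠ t) (hst : s ≠ t) (ht : m.reg t = 0)
    (hB : m.reg d + m.reg s ≤ B)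
    (h : Q { m with reg := Function.update m.reg d (m.reg d + m.reg s) }) :
    Wp x B P (addVia d s t) m Q := by
  refine seq (whileDec (fun m' => ∃ j ≤ m.reg s, m' =
    ⟨Function.update (Function.update (Function.update m.reg s (m.reg s - j)) d (m.reg d + j)) t j, m.pos, m.out⟩)
    ⟨0, by simp [update_zero_of_eq ht]⟩ ?_ ?_)
  · rintro _ ⟨j, hj, rfl⟩ hc
    simp only [ne_eq, hst, not_false_eq_true, Function.update_of_ne, hds.symm,
      Function.update_self] at hc
    obtain rfl : j = m.reg s := by omega
    refine restore hst ?_ (by simp [hst, hds.symm]; omega)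
    convert h using 1
    ext r
    · by_cases h1 : r = t
      · subst h1; simp [hdt.symm, ht]
      · by_cases h2 : r = s
        · subst h2; simp [hst, hds.symm]
        · by_cases h3 : r = d
          · subst h3; simp [h1, h2]
          · simp [h1, h2, h3]
    · rfl
    · rfl
  · rintro _ ⟨j, hj, rfl⟩ hc
    simp only [ne_eq, hst, not_false_eq_true, Function.update_of_ne, hds.symm,
      Function.update_self] at hc
    refine seq (inc (by simp [hds, hdt]; omega) (bounded fun hb => inc ?_ ?_))
    · have := hb s
      simp [hds, hdt, hst, hst.symm, hds.symm, hdt.symm] at this ⊢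
      omega
    · refine ⟨⟨j + 1, by omega, ?_⟩, ?_⟩
      · ext r
        · by_cases h1 : r = t
          · subst h1; simp [hdt.symm, hst.symm]
          · by_cases h2 : r = s
            · subst h2; simp [hst, hds.symm]; omega
            · by_cases h3 : r = d
              · subst h3; simp [h1, h2]; omega
              · simp [h1, h2, h3]
        · rfl
        · rfl
      · simp [hst, hds.symm]; omega

theorem subVia {d s t : ι} (hds : d ≠ s) (hdt : d ≠ t) (hst : s ≠ t) (ht : m.reg t = 0)
    (h : Q { m with reg := Function.update m.reg d (m.reg d - m.reg s) }) :
    Wp x B P (subVia d s t) m Q := by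
  refine bounded fun hm => ?_
  refine seq (whileDec (fun m' => ∃ j ≤ m.reg s, m' =
    ⟨Function.update (Function.update (Function.update m.reg s (m.reg s - j)) d (m.reg d - j)) t j, m.pos, m.out⟩)
    ⟨0, by simp [update_zero_of_eq ht]⟩ ?_ ?_)
  · rintro _ ⟨j, hj, rfl⟩ hc
    simp only [ne_eq, hst, not_false_eq_true, Function.update_of_ne, hds.symm,
      Function.update_self] at hc
    obtain rfl : j = m.reg s := by omega
    refine restore hst ?_ (by have := hm s; simp [hst, hds.symm]; omega)
    convert h using 1
    ext r
    · by_cases h1 : r = t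
      · subst h1; simp [hdt.symm, ht]
      · by_cases h2 : r = s
        · subst h2; simp [hst, hds.symm]
        · by_cases h3 : r = d
          · subst h3; simp [h1, h2]
          · simp [h1, h2, h3]
    · rfl
    · rfl
  · rintro _ ⟨j, hj, rfl⟩ hc
    simp only [ne_eq, hst, not_false_eq_true, Function.update_of_ne, hds.symm,
      Function.update_self] at hc
    have hms := hm s
    have fin : ∀ m' : Mem ι, m' =
        ⟨Function.update (Function.update (Function.update m.reg s (m.reg s - (j + 1))) d (m.reg d - (j + 1))) t j, m.pos, m.out⟩ →
        Wp x B P (.inc t) m' fun m' => (∃ j ≤ m.reg s, m' =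
          ⟨Function.update (Function.update (Function.update m.reg s (m.reg s - j)) d (m.reg d - j)) t j, m.pos, m.out⟩) ∧
          m'.reg s < Function.update (Function.update (Function.update m.reg s (m.reg s - j)) d
            (m.reg d - j)) t j s := by
      rintro _ rfl
      refine inc (by simp; omega) ⟨⟨j + 1, by omega, by simp⟩, ?_⟩
      simp [hst, hds.symm]; omega
    refine seq (ifDec (fun h0 => skip (fin _ ?_)) (fun h0 => skip (fin _ ?_)))
    all_goals
      simp only [ne_eq, hdt, not_false_eq_true, Function.update_of_ne, hds,
        Function.update_self] at h0
      ext r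
      · by_cases h1 : r = t
        · subst h1; simp [hdt.symm, hst.symm]
        · by_cases h2 : r = s
          · subst h2; simp [hst, hds.symm]; omega
          · by_cases h3 : r = d
            · subst h3; simp [h1, h2]; omega
            · simp [h1, h2, h3]
      · rfl
      · rfl

/-- The dividend is moved to `c` and counted down. After `j` units, `q` and `r` hold the quotient
and remainder of `j`, and `e` holds the number of units that can still be taken before the remainder
wraps around. -/
theorem divModVia {r q b t c e : ι} (hnd : [r, q, b, t, c, e].Nodup)
    (ht : m.reg t = 0) (hc : m.reg c = 0) (he : m.reg e = 0) (hb : 0 < m.reg b)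
    (h : Q ⟨Function.update (Function.update m.reg q (m.reg r / m.reg b)) r
      (m.reg r % m.reg b), m.pos, m.out⟩) :
    Wp x B P (divModVia r q b t c e) m Q := by
  simp only [List.nodup_cons, List.mem_cons, List.not_mem_nil, or_false, not_or,
    not_false_eq_true, List.nodup_nil, and_true] at hnd
  obtain ⟨⟨rq, rb, rt, rc, re⟩, ⟨qb, qt, qc, qe⟩, ⟨bt, bc, be⟩, ⟨tc, te⟩, ce⟩ := hnd
  refine bounded fun hm => ?_
  refine seq (zero (seq (addVia (Ne.symm rc) (Ne.symm tc) rt (by simp [ht, Ne.symm qt]) ?_ ?_)))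
  · simpa [Ne.symm qc, rq, hc] using hm r
  refine seq (zero (seq (addVia (Ne.symm be) (Ne.symm te) bt ?_ ?_ ?_)))
  · simp [Ne.symm rt, Ne.symm qt, tc, ht]
  · simpa [Ne.symm qb, Ne.symm rb, bc, Ne.symm re, Ne.symm ce, Ne.symm qe, he] using hm b
  have hmb := hm b
  refine seq (ifDec (fun h0 => ?_) fun _ => skip ?_)
  · simp [Ne.symm qb, Ne.symm rb, bc, Ne.symm re, Ne.symm ce, Ne.symm qe, he] at h0
    omega
  refine seq (whileDec (fun m' => ∃ j i, j + i = m.reg r ∧ m' =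
    ⟨Function.update (Function.update (Function.update (Function.update m.reg q (j / m.reg b)) r
      (j % m.reg b)) c i) e (m.reg b - 1 - j % m.reg b), m.pos, m.out⟩) ⟨0, m.reg r, by simp, ?_⟩ ?_ ?_)
  · ext y
    · by_cases h1 : y = q
      · subst h1; simp [qe, qc, Ne.symm rq]
      · by_cases h2 : y = r
        · subst h2; simp [re, rc]
        · by_cases h3 : y = c
          · subst h3; simp [ce, Ne.symm rc, Ne.symm qc, rq, hc]
          · by_cases h4 : y = e
            · subst h4
              simp [Ne.symm re, Ne.symm qe, Ne.symm ce, bc, Ne.symm rb, Ne.symm qb, he]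
            · simp [h1, h2, h3, h4]
    · rfl
    · rfl
  · rintro _ ⟨j, i, hj, rfl⟩ h0
    simp only [ne_eq, ce, not_false_eq_true, Function.update_of_ne, Function.update_self] at h0
    obtain rfl : j = m.reg r := by omega
    refine zero ?_
    convert h using 1
    ext y
    · by_cases h3 : y = c
      · subst h3; simp [ce, Ne.symm rc, Ne.symm qc, hc, h0]
      · by_cases h4 : y = e
        · subst h4
          simp [Ne.symm re, Ne.symm qe, he]
        · simp [h3, h4]
    · rfl
    · rfl
  · rintro _ ⟨j, i, hj, rfl⟩ h0
    simp only [ne_eq, ce, not_false_eq_true, Function.update_of_ne, Function.update_self] at h0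
    have hmr := hm r
    have hlt := Nat.mod_lt j hb
    have hmod := Nat.div_add_mod j (m.reg b)
    refine ifDec (fun h1 => ?_) (fun h1 => ?_)
    · simp only [ne_eq, Ne.symm ce, not_false_eq_true, Function.update_of_ne,
        Function.update_self] at h1
      -- `e = 0` means that the remainder has its maximal value; adding that remainder to `e`
      -- restores the initial value of `e`.
      have h2 : j % m.reg b = m.reg b - 1 := by omega
      have h3 : (j + 1) / m.reg b = j / m.reg b + 1 ∧ (j + 1) % m.reg b = 0 := by
        rw [Nat.div_mod_unique hb]
        constructor
        · rw [mul_add, mul_one]; omega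
        · exact hb
      refine seq (addVia (Ne.symm re) (Ne.symm te) rt (by simp [Ne.symm rt, Ne.symm qt, tc, te, ht]) ?_
        (seq (zero (inc ?_ ⟨⟨j + 1, i - 1, by omega, ?_⟩, ?_⟩))))
      · simp [Ne.symm ce, re, rc, h2]; omega
      · simp [qe, qc, Ne.symm rq]
        have := Nat.div_le_self j (m.reg b)
        omega
      · ext y
        · by_cases h5 : y = q
          · subst h5; simp [qe, qc, Ne.symm rq, h3]
          · by_cases h6 : y = r
            · subst h6; simp [rq, re, rc, h3]
            · by_cases h7 : y = c
              · subst h7; simp [Ne.symm rc, Ne.symm qc, ce]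
              · by_cases h8 : y = e
                · subst h8
                  simp [Ne.symm re, Ne.symm qe, Ne.symm ce, re, rc, h2, h3]
                · simp [h5, h6, h7, h8]
        · rfl
        · rfl
      · simp [Ne.symm rc, Ne.symm qc, ce]; omega
    · simp only [ne_eq, Ne.symm ce, not_false_eq_true, Function.update_of_ne,
        Function.update_self] at h1
      have h3 : (j + 1) / m.reg b = j / m.reg b ∧ (j + 1) % m.reg b = j % m.reg b + 1 := by
        rw [Nat.div_mod_unique hb]
        constructor
        · omega
        · omega
      refine inc ?_ ⟨⟨j + 1, i - 1, by omega, ?_⟩, ?_⟩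
      · simp [re, rc]; omega
      · ext y
        · by_cases h5 : y = q
          · subst h5; simp [qe, qc, Ne.symm rq, h3]
          · by_cases h6 : y = r
            · subst h6; simp [re, rc, h3]
            · by_cases h7 : y = c
              · subst h7; simp [Ne.symm rc, ce]
              · by_cases h8 : y = e
                · subst h8
                  simp [Ne.symm re, Ne.symm ce, h3]; omega
                · simp [h5, h6, h7, h8]
        · rfl
        · rfl
      · simp [Ne.symm rc, ce]; omega

theorem rewind (h : Q { m with pos := 0 }) : Wp x B P rewind m Q := by
  refine whileIn (fun m' => ∃ c, m' = { m with pos := c }) (fun m' => m'.pos) ⟨m.pos, rfl⟩ ?_ ?_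
  · rintro _ ⟨c, rfl⟩ hc
    cases c with
    | zero => exact h
    | succ c =>
      simp only [TM.readInput] at hc
      cases hx : x[c]? <;> simp [hx] at hc
  · rintro _ ⟨c, rfl⟩ hc
    cases c with
    | zero => simp [TM.readInput] at hc
    | succ c => exact move ⟨⟨_, rfl⟩, by simp [TM.moveHead]⟩

theorem addLength {d : ι} (hB : m.reg d + x.length ≤ B)
    (h : ∀ p, Q { m with reg := Function.update m.reg d (m.reg d + x.length), pos := p }) :
    Wp x B P (addLength d) m Q := by
  refine seq (rewind (seq (move ?_)))
  refine whileIn (fun m' => ∃ c ≤ x.length, m' = { m with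
    reg := Function.update m.reg d (m.reg d + c), pos := c + 1 }) (fun m' => x.length + 1 - m'.pos)
    ⟨0, by simp [TM.moveHead]⟩ ?_ ?_
  · rintro _ ⟨c, hcx, rfl⟩ hc
    simp only [TM.readInput] at hc
    rcases hcx.lt_or_eq with hlt | rfl
    · simp [List.getElem?_eq_getElem hlt] at hc
    · exact h _
  · rintro _ ⟨c, hcx, rfl⟩ hc
    simp only [TM.readInput] at hc
    rcases hcx.lt_or_eq with hlt | rfl
    · refine seq (inc (by simp; omega) (move ⟨⟨c + 1, hlt, ?_⟩, ?_⟩))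
      · ext r
        · by_cases hr : r = d
          · subst hr; simp [add_assoc]
          · simp [hr]
        · simp [TM.moveHead]; omega
        · rfl
      · simp [TM.moveHead]; omega
    · simp at hc

end Wp

end Prog

/-! ## Programs with hidden scratch counters -/

/-- Programs with the visible counters `ι` and three scratch counters, which are zero between
commands. -/
abbrev Cmd (ι : Type) : Type := Prog (ι ⊕ Fin 3)

namespace Cmd

open Prog

variable {ι : Type}

/-- `r_d := r_d + 1` -/
def incr (d : ι) : Cmd ι := .inc (.inl d)

/-- `r_d := r_d + c` -/
def addConst (d : ι) : ℕ → Cmd ι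
  | 0 => .skip
  | c + 1 => incr d ;; addConst d c

/-- `r_d := c` -/
def const (d : ι) (c : ℕ) : Cmd ι := zero (.inl d) ;; addConst d c

/-- `r_d := r_d + r_s` -/
def add (d s : ι) : Cmd ι := addVia (.inl d) (.inl s) (.inr 0)

/-- `r_d := r_s` -/
def mov (d s : ι) : Cmd ι := zero (.inl d) ;; add d s

/-- `r_d := r_d - r_s` -/
def sub (d s : ι) : Cmd ι := subVia (.inl d) (.inl s) (.inr 0)

/-- `r_d := r_d + r_a * r_b` -/
def mulAdd (d a b : ι) : Cmd ι :=
  addVia (.inr 1) (.inl a) (.inr 0) ;; .whileDec (.inr 1) (add d b)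

/-- `r_q, r_r := r_r / r_b, r_r % r_b` -/
def divMod (r q b : ι) : Cmd ι := divModVia (.inl r) (.inl q) (.inl b) (.inr 0) (.inr 1) (.inr 2)

/-- Is `r_a < r_b`? -/
def ifLt (a b : ι) (p q : Cmd ι) : Cmd ι :=
  addVia (.inr 1) (.inl b) (.inr 0) ;; subVia (.inr 1) (.inl a) (.inr 0) ;;
  .ifDec (.inr 1) (zero (.inr 1) ;; p) q

/-- Is `r_i` positive? -/
def ifPos (i : ι) (p q : Cmd ι) : Cmd ι := .ifDec (.inl i) (incr i ;; p) q

/-- Execute `p` as often as `r_s` tells, counting down in `r_t`. -/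
def repeatFor (t s : ι) (p : Cmd ι) : Cmd ι := mov t s ;; .whileDec (.inl t) p

/-- Has the input symbol at position `r_a` the property `f`? -/
def ifSym (a : ι) (f : InputSymbol → Bool) (p q : Cmd ι) : Cmd ι :=
  rewind ;; addVia (.inr 1) (.inl a) (.inr 0) ;; .whileDec (.inr 1) (.move .right) ;; .ifIn f p q

section Det

variable {p q : Cmd ι}

theorem det_addConst (d : ι) (c : ℕ) : (addConst d c).Det := by
  induction c with
  | zero => trivial
  | succ c ih => exact ⟨trivial, ih⟩

theorem det_const (d : ι) (c : ℕ) : (const d c).Det := ⟨trivial, det_addConst d c⟩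

theorem det_add (d s : ι) : (add d s).Det := by simp [add, addVia, Det]

theorem det_mov (d s : ι) : (mov d s).Det := ⟨trivial, det_add d s⟩

theorem det_sub (d s : ι) : (sub d s).Det := by simp [sub, subVia, Det]

theorem det_mulAdd (d a b : ι) : (mulAdd d a b).Det := by simp [mulAdd, add, addVia, Det]

theorem det_divMod (r q b : ι) : (divMod r q b).Det := by
  simp [divMod, divModVia, zero, addVia, Det]

theorem det_ifLt (a b : ι) (hp : p.Det) (hq : q.Det) : (ifLt a b p q).Det := by
  simp [ifLt, zero, addVia, subVia, Det, hp, hq]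

theorem det_ifPos (i : ι) (hp : p.Det) (hq : q.Det) : (ifPos i p q).Det := by
  simp [ifPos, incr, Det, hp, hq]

theorem det_repeatFor (t s : ι) (hp : p.Det) : (repeatFor t s p).Det := by
  simp [repeatFor, det_mov, Det, hp]

theorem det_ifSym (a : ι) (f : InputSymbol → Bool) (hp : p.Det) (hq : q.Det) :
    (ifSym a f p q).Det := by
  simp [ifSym, rewind, addVia, Det, hp, hq]

theorem det_addLength (d : ι) : (addLength d).Det := by simp [addLength, rewind, Det]

end Det

/-- All counters, where the scratch counters are zero. -/
def full (v : ι → ℕ) : ι ⊕ Fin 3 → ℕ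
  | .inl i => v i
  | .inr _ => 0

@[simp]
theorem full_inl (v : ι → ℕ) (i : ι) : full v (.inl i) = v i := rfl

@[simp]
theorem full_inr (v : ι → ℕ) (j : Fin 3) : full v (.inr j) = 0 := rfl

variable [DecidableEq ι]

@[simp]
theorem update_full_inr (v : ι → ℕ) (j : Fin 3) : Function.update (full v) (.inr j) 0 = full v :=
  Wp.update_zero_of_eq rfl

@[simp]
theorem update_full (v : ι → ℕ) (i : ι) (c : ℕ) :
    Function.update (full v) (.inl i) c = full (Function.update v i c) := by
  funext r
  rcases r with r | r
  · by_cases h : r = i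
    · subst h; simp
    · simp [h]
  · simp

/-- The memory with given visible counters. -/
def lift (v : ι → ℕ) (pos : ℕ) (o : List Bool) : Mem (ι ⊕ Fin 3) := ⟨full v, pos, o⟩

/-- Started with the visible counters `v` and the output `o`, the program terminates, with counters
bounded by `B`, in a situation that satisfies `Q`. -/
def Hp (x : List Bool) (B : ℕ) (P : Prop) (p : Cmd ι) (v : ι → ℕ) (o : List Bool)
    (Q : (ι → ℕ) → List Bool → Prop) : Prop :=
  ∀ pos, Wp x B P p (lift v pos o) fun m => ∃ v' pos' o', m = lift v' pos' o' ∧ Q v' o'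

variable {x : List Bool} {B : ℕ} {P : Prop} {v : ι → ℕ} {o : List Bool}
  {Q : (ι → ℕ) → List Bool → Prop} {p q : Cmd ι}

/-! ### Proof rules for commands with hidden scratch counters -/

namespace Hp

theorem mono {Q' : (ι → ℕ) → List Bool → Prop} (h : Hp x B P p v o Q)
    (hQ : ∀ v' o', Q v' o' → Q' v' o') : Hp x B P p v o Q' :=
  fun pos => (h pos).mono fun _ ⟨v', pos', o', hm, hq⟩ => ⟨v', pos', o', hm, hQ _ _ hq⟩

theorem bounded (h : (∀ i, v i ≤ B) → Hp x B P p v o Q) : Hp x B P p v o Q :=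
  fun pos => Wp.bounded fun hm => h (fun i => hm (.inl i)) pos

theorem mono_bounded {Q' : (ι → ℕ) → List Bool → Prop} (h : Hp x B P p v o Q)
    (hQ : ∀ v' o', (∀ i, v' i ≤ B) → Q v' o' → Q' v' o') : Hp x B P p v o Q' :=
  fun pos => (h pos).mono_bounded fun _ hm ⟨v', pos', o', e, hq⟩ =>
    ⟨v', pos', o', e, hQ _ _ (fun i => by subst e; exact hm (.inl i)) hq⟩

theorem skip (h : Q v o) : Hp x B P .skip v o Q :=
  fun pos => Wp.skip ⟨v, pos, o, rfl, h⟩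

theorem accept (hP : P) (h : Q v o) : Hp x B P .accept v o Q :=
  fun pos => Wp.accept hP ⟨v, pos, o, rfl, h⟩

theorem out {b : Bool} (h : Q v (o ++ [b])) : Hp x B P (.out b) v o Q :=
  fun pos => Wp.out ⟨v, pos, _, rfl, h⟩

theorem seq (h : Hp x B P p v o fun v' o' => Hp x B P q v' o' Q) : Hp x B P (p ;; q) v o Q := by
  refine fun pos => Wp.seq ((h pos).mono ?_)
  rintro _ ⟨v', pos', o', rfl, hq⟩
  exact hq pos'

theorem guess (hp : Hp x B P p v o Q) (hq : Hp x B P q v o Q) : Hp x B P (.guess p q) v o Q :=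
  fun pos => Wp.guess (hp pos) (hq pos)

theorem incr {d : ι} (hB : v d + 1 ≤ B) (h : Q (Function.update v d (v d + 1)) o) :
    Hp x B P (incr d) v o Q :=
  fun pos => Wp.inc hB ⟨_, pos, o, by simp [lift], h⟩

theorem clr {d : ι} (h : Q (Function.update v d 0) o) : Hp x B P (zero (.inl d)) v o Q :=
  fun pos => Wp.zero ⟨_, pos, o, by simp [lift], h⟩

theorem addConst {d : ι} {c : ℕ} (hB : v d + c ≤ B) (h : Q (Function.update v d (v d + c)) o) :
    Hp x B P (addConst d c) v o Q := by
  induction c generalizing v with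
  | zero => exact skip (by simpa using h)
  | succ c ih =>
    refine seq (incr (by omega) (ih (by simp; omega) ?_))
    simpa [add_assoc, add_comm 1] using h

theorem const {d : ι} {c : ℕ} (hB : c ≤ B) (h : Q (Function.update v d c) o) :
    Hp x B P (const d c) v o Q :=
  seq (clr (addConst (by simpa using hB) (by simpa using h)))

theorem add {d s : ι} (hds : d ≠ s) (hB : v d + v s ≤ B)
    (h : Q (Function.update v d (v d + v s)) o) : Hp x B P (add d s) v o Q :=
  fun pos => Wp.addVia (by simpa) (by simp) (by simp) rfl hB ⟨_, pos, o, by simp [lift], h⟩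

theorem mov {d s : ι} (hds : d ≠ s) (h : Q (Function.update v d (v s)) o) :
    Hp x B P (mov d s) v o Q :=
  bounded fun hb => seq (clr (add hds (by simpa [hds.symm] using hb s)
    (by simpa [hds.symm] using h)))

theorem sub {d s : ι} (hds : d ≠ s) (h : Q (Function.update v d (v d - v s)) o) :
    Hp x B P (sub d s) v o Q :=
  fun pos => Wp.subVia (by simpa) (by simp) (by simp) rfl ⟨_, pos, o, by simp [lift], h⟩

theorem mulAdd {d a b : ι} (hda : d ≠ a) (hdb : d ≠ b) (hB : v d + v a * v b ≤ B)
    (h : Q (Function.update v d (v d + v a * v b)) o) : Hp x B P (mulAdd d a b) v o Q := by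
  refine bounded fun hb pos => Wp.seq (Wp.addVia (by simp) (by simp) (by simp) rfl
    (by simpa [lift] using hb a) ?_)
  refine Wp.whileDec (fun m => ∃ j ≤ v a, m = ⟨Function.update
    (full (Function.update v d (v d + j * v b))) (.inr 1) (v a - j), pos, o⟩)
    ⟨0, by simp, by simp [lift]⟩ ?_ ?_
  · rintro _ ⟨j, hj, rfl⟩ h0
    simp only [Function.update_self] at h0
    obtain rfl : j = v a := by omega
    refine ⟨_, pos, o, ?_, h⟩
    simp [lift]
  · rintro _ ⟨j, hj, rfl⟩ h0
    simp only [Function.update_self, ne_eq] at h0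
    have hle : (j + 1) * v b ≤ v a * v b := Nat.mul_le_mul_right _ (by omega)
    rw [add_mul, one_mul] at hle
    refine Wp.addVia (by simpa) (by simp) (by simp) (by simp) ?_ ⟨⟨j + 1, by omega, ?_⟩, ?_⟩
    · simp [hdb.symm]; omega
    · ext r
      · rcases r with r | r
        · by_cases hr : r = d
          · subst hr; simp [hdb.symm]; ring
          · simp [hr]
        · by_cases hr : r = 1
          · subst hr; simp; omega
          · simp [hr]
      · rfl
      · rfl
    · simp; omega

theorem divMod {r q b : ι} (hrq : r ≠ q) (hrb : r ≠ b) (hqb : q ≠ b) (hb : 0 < v b)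
    (h : Q (Function.update (Function.update v q (v r / v b)) r (v r % v b)) o) :
    Hp x B P (divMod r q b) v o Q :=
  fun pos => Wp.divModVia (by simp [hrq, hrb, hqb]) rfl rfl rfl hb
    ⟨_, pos, o, by simp [lift], h⟩

theorem ifLt {a b : ι} (h1 : v a < v b → Hp x B P p v o Q) (h0 : v b ≤ v a → Hp x B P q v o Q) :
    Hp x B P (ifLt a b p q) v o Q := by
  refine bounded fun hb pos => Wp.seq (Wp.addVia (by simp) (by simp) (by simp) rfl
    (by simpa [lift] using hb b) (Wp.seq (Wp.subVia (by simp) (by simp) (by simp)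
      (by simp [lift]) ?_)))
  have key : ∀ c, (⟨Function.update (Function.update (Function.update (lift v pos o).reg (.inr 1)
      (v b)) (.inr 1) (v b - v a)) (.inr 1) c, pos, o⟩ : Mem (ι ⊕ Fin 3)) =
      ⟨Function.update (lift v pos o).reg (.inr 1) c, pos, o⟩ := by simp
  simp only [lift, full_inr, full_inl, zero_add, Function.update_self, ne_eq, reduceCtorEq,
    not_false_eq_true, Function.update_of_ne, Function.update_idem]
  refine Wp.ifDec (fun h => ?_) (fun h => Wp.seq (Wp.zero ?_))
  · simp only [Function.update_self] at h
    rw [h, Wp.update_zero_of_eq (by rfl)]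
    exact h0 (by omega) pos
  · simp only [Function.update_self, ne_eq] at h
    rw [Function.update_idem, Function.update_idem, Wp.update_zero_of_eq (by rfl)]
    exact h1 (by omega) pos

theorem ifPos {i : ι} (h1 : v i ≠ 0 → Hp x B P p v o Q) (h0 : v i = 0 → Hp x B P q v o Q) :
    Hp x B P (ifPos i p q) v o Q := by
  refine bounded fun hb pos => Wp.ifDec (fun h => h0 h pos) fun h => Wp.seq (Wp.inc ?_ ?_)
  · have := hb i
    simp only [lift, full_inl, ne_eq, Function.update_self] at h ⊢
    omega
  · convert h1 h pos using 2
    · simp only [lift, full_inl, Function.update_self, Function.update_idem] at h ⊢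
      rw [Nat.sub_add_cancel (by omega)]
      simp

theorem whileDec {t : ι} (I : (ι → ℕ) → List Bool → Prop) (hI : I v o)
    (h0 : ∀ v o, I v o → v t = 0 → Q v o)
    (h1 : ∀ v o, I v o → v t ≠ 0 → Hp x B P p (Function.update v t (v t - 1)) o
      fun v' o' => I v' o' ∧ v' t < v t) :
    Hp x B P (.whileDec (.inl t) p) v o Q := by
  intro pos
  refine Wp.whileDec (fun m => ∃ v' pos' o', m = lift v' pos' o' ∧ I v' o') ⟨v, pos, o, rfl, hI⟩
    ?_ ?_
  · rintro _ ⟨v', pos', o', rfl, h⟩ hz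
    exact ⟨v', pos', o', rfl, h0 _ _ h hz⟩
  · rintro _ ⟨v', pos', o', rfl, h⟩ hz
    have := h1 v' o' h hz pos'
    simp only [lift, full_inl, update_full] at this ⊢
    refine this.mono ?_
    rintro _ ⟨v'', pos'', o'', rfl, h, hlt⟩
    exact ⟨⟨_, _, _, rfl, h⟩, hlt⟩

theorem repeatFor {t s : ι} (hts : t ≠ s) (I : ℕ → (ι → ℕ) → List Bool → Prop)
    (hI : I 0 (Function.update v t (v s)) o)
    (h1 : ∀ j < v s, ∀ v' o', I j v' o' → v' t = v s - j →
      Hp x B P p (Function.update v' t (v s - (j + 1))) o'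
        fun v'' o'' => v'' t = v s - (j + 1) ∧ I (j + 1) v'' o'')
    (h0 : ∀ v' o', I (v s) v' o' → v' t = 0 → Q v' o') :
    Hp x B P (repeatFor t s p) v o Q := by
  refine seq (mov hts (whileDec (fun v' o' => ∃ j ≤ v s, v' t = v s - j ∧ I j v' o')
    ⟨0, by simp, by simp, hI⟩ ?_ ?_))
  · rintro v' o' ⟨j, hj, ht, h⟩ hz
    obtain rfl : j = v s := by omega
    exact h0 v' o' h hz
  · rintro v' o' ⟨j, hj, ht, h⟩ hz
    have := h1 j (by omega) v' o' h ht
    rw [show v' t - 1 = v s - (j + 1) by omega]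
    refine this.mono fun v'' o'' ⟨h2, h3⟩ => ⟨⟨j + 1, by omega, h2, h3⟩, by omega⟩

/-- No bound on the position is needed: the head is clamped at the right end marker, which reads
like all positions further right. -/
theorem ifSym {a : ι} {f : InputSymbol → Bool}
    (h1 : f (TM.readInput x (v a)) = true → Hp x B P p v o Q)
    (h0 : f (TM.readInput x (v a)) = false → Hp x B P q v o Q) :
    Hp x B P (ifSym a f p q) v o Q := by
  refine bounded fun hb pos => Wp.seq (Wp.rewind (Wp.seq (Wp.addVia (by simp) (by simp) (by simp)
    rfl (by simpa [lift] using hb a) (Wp.seq ?_))))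
  refine Wp.whileDec (fun m => ∃ j ≤ v a, m = ⟨Function.update
    (full v) (.inr 1) (v a - j), min j (x.length + 1), o⟩)
    ⟨0, by simp, by simp [lift]⟩ ?_ ?_
  · rintro _ ⟨j, hj, rfl⟩ hz
    simp only [Function.update_self] at hz
    obtain rfl : j = v a := by omega
    refine Wp.ifIn (fun h => ?_) fun h => ?_
    · have := h1 (by rwa [CounterTM.readInput_min] at h) (min (v a) (x.length + 1))
      simpa [lift] using this
    · have := h0 (by rwa [CounterTM.readInput_min] at h) (min (v a) (x.length + 1))
      simpa [lift] using this
  · rintro _ ⟨j, hj, rfl⟩ hz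
    simp only [Function.update_self, ne_eq] at hz
    refine Wp.move ⟨⟨j + 1, by omega, ?_⟩, ?_⟩
    · simp only [Function.update_self, Function.update_idem, TM.moveHead, Mem.mk.injEq, and_true]
      exact ⟨by congr 1, by omega⟩
    · simp; omega

theorem addLength {d : ι} (hB : v d + x.length ≤ B)
    (h : Q (Function.update v d (v d + x.length)) o) : Hp x B P (addLength (.inl d)) v o Q :=
  fun _ => Wp.addLength hB fun p => ⟨_, p, o, by simp [lift], h⟩

end Hp

end Cmd

/-! ## Printing automata in logarithmic space -/

namespace Cmd

open Prog

/-- The counters of a program that prints an automaton: the number of states, the number of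
letters except the reset letter, the state to which the reset letter leads, a state, a letter,
and a result; the others are auxiliary. -/
inductive PrintReg where
  | states
  | letters
  | start
  | state
  | letter
  | result
  | outer
  | inner
  | count
  | rest
  deriving DecidableEq

instance : Finite PrintReg :=
  Set.finite_univ_iff.1 ((Set.toFinite {.states, .letters, .start, .state, .letter, .result,
    .outer, .inner, .count, .rest}).subset fun r _ => by cases r <;> simp)

/-- The row of a transition table for the value `v`. -/
def rowBits (n v : ℕ) : List Bool :=
  if v < n then List.replicate v false ++ true :: List.replicate (n - (v + 1)) false else []

/-- The bits of an automaton with the transition function `δ` and one more letter that leads to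
`s`; values of `δ` outside of the set of states stand for loops. -/
def automatonBits (n k s : ℕ) (δ : ℕ → ℕ → ℕ) (χ : ℕ → Bool) : List Bool :=
  List.replicate n true ++ [false] ++ List.replicate (k + 1) true ++ [false] ++
  ((List.range n).flatMap fun u =>
    ((List.range k).flatMap fun a => rowBits n (if δ u a < n then δ u a else u)) ++ rowBits n s) ++
  (List.range n).map χ

variable {ι : Type}

/-- Write the bit `b` as often as `r_s` tells. -/
def writeTimes (t s : ι) (b : Bool) : Cmd ι := repeatFor t s (.out b)

theorem det_writeTimes (t s : ι) (b : Bool) : (writeTimes t s b).Det :=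
  det_repeatFor t s trivial

open PrintReg

/-- Print the row for the value in the counter `result`. -/
def printRow : Cmd (PrintReg ⊕ ι) :=
  ifLt (.inl result) (.inl states)
    (writeTimes (.inl count) (.inl result) false ;; .out true ;; incr (.inl result) ;;
      mov (.inl rest) (.inl states) ;; sub (.inl rest) (.inl result) ;;
      writeTimes (.inl count) (.inl rest) false) .skip

theorem det_printRow : (printRow (ι := ι)).Det :=
  det_ifLt _ _ ⟨det_writeTimes _ _ _, trivial, trivial, det_mov _ _, det_sub _ _,
    det_writeTimes _ _ _⟩ trivial

/-- Print the part of the transition table for the state in the counter `state`. -/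
def printRows (step : Cmd (PrintReg ⊕ ι)) : Cmd (PrintReg ⊕ ι) :=
  zero (.inl (.inl letter)) ;;
  repeatFor (.inl inner) (.inl letters)
    (step ;; ifLt (.inl result) (.inl states) .skip (mov (.inl result) (.inl state)) ;;
      printRow ;; incr (.inl letter)) ;;
  mov (.inl result) (.inl start) ;; printRow

theorem det_printRows {step : Cmd (PrintReg ⊕ ι)} (h : step.Det) : (printRows step).Det :=
  ⟨trivial, det_repeatFor _ _ ⟨h, det_ifLt _ _ trivial (det_mov _ _), det_printRow, trivial⟩,
    det_mov _ _, det_printRow⟩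

/-- Print an automaton and a set of states; `init` computes its size, `step` a value of the
transition function and `mem` the membership of a state. -/
def printAutomaton (init step mem : Cmd (PrintReg ⊕ ι)) : Cmd (PrintReg ⊕ ι) :=
  init ;;
  writeTimes (.inl count) (.inl states) true ;; .out false ;;
  writeTimes (.inl count) (.inl letters) true ;; .out true ;; .out false ;;
  zero (.inl (.inl state)) ;;
  repeatFor (.inl outer) (.inl states) (printRows step ;; incr (.inl state)) ;;
  zero (.inl (.inl state)) ;;
  repeatFor (.inl outer) (.inl states)
    (mem ;; ifPos (.inl result) (.out true) (.out false) ;; incr (.inl state))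

theorem det_printAutomaton {init step mem : Cmd (PrintReg ⊕ ι)} (hi : init.Det) (hs : step.Det)
    (hm : mem.Det) : (printAutomaton init step mem).Det :=
  ⟨hi, det_writeTimes _ _ _, trivial, det_writeTimes _ _ _, trivial, trivial, trivial,
    det_repeatFor _ _ ⟨det_printRows hs, trivial⟩, trivial,
    det_repeatFor _ _ ⟨hm, det_ifPos _ trivial trivial, trivial⟩⟩

variable [DecidableEq ι] {x : List Bool} {B : ℕ} {P : Prop}

theorem Hp.writeTimes {v : ι → ℕ} {o : List Bool} {Q : (ι → ℕ) → List Bool → Prop} {t s : ι}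
    {b : Bool} (hts : t ≠ s)
    (h : Q (Function.update v t 0) (o ++ List.replicate (v s) b)) :
    Hp x B P (writeTimes t s b) v o Q := by
  refine Hp.repeatFor hts (fun j v' o' => v' = Function.update v t (v s - j) ∧
    o' = o ++ List.replicate j b) ⟨by simp, by simp⟩ ?_ ?_
  · rintro j hj _ _ ⟨rfl, rfl⟩ -
    refine Hp.out ⟨by simp, by simp, ?_⟩
    rw [List.replicate_succ', List.append_assoc]
  · rintro _ _ ⟨rfl, rfl⟩ -
    simpa using h

/-- The counters other than `r` are the same. -/
def SameExcept (rs : List PrintReg) (v v' : PrintReg ⊕ ι → ℕ) : Prop :=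
  (∀ r ∉ rs, v' (.inl r) = v (.inl r)) ∧ ∀ i, v' (.inr i) = v (.inr i)

theorem Hp.printRow {v : PrintReg ⊕ ι → ℕ} {o : List Bool}
    {Q : (PrintReg ⊕ ι → ℕ) → List Bool → Prop}
    (h : ∀ v', SameExcept [count, rest, result] v v' →
      Q v' (o ++ rowBits (v (.inl states)) (v (.inl result)))) :
    Hp x B P printRow v o Q := by
  refine Hp.bounded fun hb => Hp.ifLt (fun hlt => ?_) (fun hle => Hp.skip ?_)
  · refine Hp.seq (Hp.writeTimes (by simp) (Hp.seq (Hp.out (Hp.seq (Hp.incr ?_ (Hp.seq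
      (Hp.mov (by simp) (Hp.seq (Hp.sub (by simp) (Hp.writeTimes (by simp) ?_))))))))))
    · have := hb (.inl states)
      simp; omega
    · convert h _ ?_ using 1
      · simp [rowBits, hlt]
      · refine ⟨fun r hr => ?_, fun i => ?_⟩
        · simp only [List.mem_cons, List.not_mem_nil, or_false, not_or] at hr
          simp [hr]
        · simp
  · have := h v ⟨fun _ _ => rfl, fun _ => rfl⟩
    rwa [rowBits, if_neg (by omega), List.append_nil] at this

/-- The specification of the subprogram that computes the transition function. -/
def StepSpec (x : List Bool) (B : ℕ) (P : Prop) (n k : ℕ) (J : (ι → ℕ) → Prop)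
    (δ : ℕ → ℕ → ℕ) (p : Cmd (PrintReg ⊕ ι)) : Prop :=
  ∀ v o, v (.inl states) = n → J (fun i => v (.inr i)) → v (.inl state) < n →
    v (.inl letter) < k → Hp x B P p v o fun v' o' => o' = o ∧
      v' (.inl result) = δ (v (.inl state)) (v (.inl letter)) ∧
      (∀ r, r ≠ result → v' (.inl r) = v (.inl r)) ∧ J fun i => v' (.inr i)

/-- The specification of the subprogram that computes membership. -/
def MemSpec (x : List Bool) (B : ℕ) (P : Prop) (n : ℕ) (J : (ι → ℕ) → Prop)
    (χ : ℕ → Bool) (p : Cmd (PrintReg ⊕ ι)) : Prop :=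
  ∀ v o, v (.inl states) = n → J (fun i => v (.inr i)) → v (.inl state) < n →
    Hp x B P p v o fun v' o' => o' = o ∧
      (v' (.inl result) ≠ 0 ↔ χ (v (.inl state)) = true) ∧
      (∀ r, r ≠ result → v' (.inl r) = v (.inl r)) ∧ J fun i => v' (.inr i)

variable {n k s : ℕ} {J : (ι → ℕ) → Prop} {δ : ℕ → ℕ → ℕ} {χ : ℕ → Bool}
  {init step mem : Cmd (PrintReg ⊕ ι)}

theorem Hp.printRows (hstep : StepSpec x B P n k J δ step) {v : PrintReg ⊕ ι → ℕ} {o : List Bool}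
    {u : ℕ} (hn : v (.inl states) = n) (hk : v (.inl letters) = k) (hs : v (.inl start) = s)
    (hu : v (.inl state) = u) (hun : u < n) (hJ : J fun i => v (.inr i)) :
    Hp x B P (printRows step) v o fun v' o' =>
      o' = o ++ (((List.range k).flatMap fun a => rowBits n (if δ u a < n then δ u a else u)) ++
        rowBits n s) ∧
      v' (.inl outer) = v (.inl outer) ∧ v' (.inl states) = n ∧ v' (.inl letters) = k ∧
      v' (.inl start) = s ∧ v' (.inl state) = u ∧ J fun i => v' (.inr i) := by
  refine Hp.bounded fun hb => Hp.seq (Hp.clr (Hp.seq (Hp.repeatFor (by simp) (fun j v' o' =>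
    o' = o ++ ((List.range j).flatMap fun a => rowBits n (if δ u a < n then δ u a else u)) ∧
    v' (.inl letter) = j ∧
    v' (.inl outer) = v (.inl outer) ∧ v' (.inl states) = n ∧ v' (.inl letters) = k ∧
      v' (.inl start) = s ∧ v' (.inl state) = u ∧ J fun i => v' (.inr i)) ?_ ?_ ?_)))
  · simp [*]
  · rintro j hj v' o' ⟨rfl, ha, ho, hn', hk', hs', hu', hJ'⟩ ht
    have hkB := hb (.inl letters)
    simp only [ne_eq, Sum.inl.injEq, reduceCtorEq, not_false_eq_true, Function.update_of_ne, hk]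
      at hj ht hkB ⊢
    refine Hp.seq ((hstep _ _ (by simpa) (by simpa) (by simpa [hu']) (by simpa [ha])).mono ?_)
    rintro v₁ o₁ ⟨rfl, hres, hsame, hJ₁⟩
    -- Whether the value of `step` is kept or replaced by a loop, the same commands follow; they are
    -- treated once, for any memory with the correct value in `result`.
    have key : ∀ v₂ : PrintReg ⊕ ι → ℕ, v₂ (.inl result) = (if δ u j < n then δ u j else u) →
        (∀ r, r ≠ result → v₂ (.inl r) = v₁ (.inl r)) → (∀ i, v₂ (.inr i) = v₁ (.inr i)) →
        Hp x B P (Cmd.printRow ;; Cmd.incr (.inl letter)) v₂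
          (o ++ ((List.range j).flatMap fun a => rowBits n (if δ u a < n then δ u a else u)))
          fun v'' o'' => v'' (.inl inner) = k - (j + 1) ∧
          (o'' = o ++ ((List.range (j + 1)).flatMap fun a =>
            rowBits n (if δ u a < n then δ u a else u)) ∧
          v'' (.inl letter) = j + 1 ∧
          v'' (.inl outer) = v (.inl outer) ∧ v'' (.inl states) = n ∧ v'' (.inl letters) = k ∧
          v'' (.inl start) = s ∧ v'' (.inl state) = u ∧ J fun i => v'' (.inr i)) := by
      intro v₂ h₂ hsame₂ hinr₂
      refine Hp.seq (Hp.printRow fun v₃ h₃ => Hp.incr ?_ ?_)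
      · rw [h₃.1 _ (by simp), hsame₂ _ (by simp), hsame _ (by simp)]
        simp [ha]; omega
      · have h3 : (fun i => v₃ (.inr i)) = fun i => v₁ (.inr i) :=
          funext fun i => (h₃.2 i).trans (hinr₂ i)
        simp [h₃.1, hsame₂, hsame, ha, ho, hn', hk', hs', hu', h3, hJ₁, List.range_succ, h₂]
    refine Hp.seq (Hp.ifLt (fun hlt => Hp.skip (key _ ?_ (fun _ _ => rfl) fun _ => rfl))
      (fun hle => Hp.mov (by simp) (key _ ?_ (fun r hr => ?_) fun i => ?_)))
    · rw [hres, hsame _ (by simp)] at hlt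
      simp only [ne_eq, Sum.inl.injEq, reduceCtorEq, not_false_eq_true, Function.update_of_ne, hu',
        ha, hn'] at hlt hres
      rw [if_pos hlt, hres]
    · rw [hres, hsame _ (by simp)] at hle
      simp only [ne_eq, Sum.inl.injEq, reduceCtorEq, not_false_eq_true, Function.update_of_ne, hu',
        ha, hn'] at hle hres
      rw [if_neg (by omega), Function.update_self, hsame _ (by simp)]
      simp [hu']
    · simp [hr]
    · simp
  · rintro v' o' ⟨rfl, ha, ho, hn', hk', hs', hu', hJ'⟩ ht
    refine Hp.seq (Hp.mov (by simp) (Hp.printRow fun v₃ h₃ => ?_))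
    have h3 : (fun i => v₃ (.inr i)) = fun i => v' (.inr i) := by
      funext i; simpa using h₃.2 i
    simp [h₃.1, ho, hn', hk', hs', hu', h3, hJ', hk]

theorem Hp.printAutomaton
    (hinit : Hp x B P init (fun _ => 0) [] fun v o => o = [] ∧ v (.inl states) = n ∧
      v (.inl letters) = k ∧ v (.inl start) = s ∧ J fun i => v (.inr i))
    (hstep : StepSpec x B P n k J δ step) (hmem : MemSpec x B P n J χ mem) :
    Hp x B P (printAutomaton init step mem) (fun _ => 0) []
      fun _ o => o = automatonBits n k s δ χ := by
  refine Hp.seq (hinit.mono_bounded ?_)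
  rintro v o hb ⟨rfl, hn, hk, hs, hJ⟩
  refine Hp.seq (Hp.writeTimes (by simp) (Hp.seq (Hp.out (Hp.seq (Hp.writeTimes (by simp)
    (Hp.seq (Hp.out (Hp.seq (Hp.out (Hp.seq (Hp.clr ?_)))))))))))
  have hnB := hb (.inl states)
  rw [hn] at hnB
  simp only [ne_eq, Sum.inl.injEq, reduceCtorEq, not_false_eq_true, Function.update_of_ne,
    List.nil_append, hn, hk]
  -- The additional `true` counts the reset letter, which comes after the `k` others.
  obtain ⟨o₀, ho₀⟩ : ∃ o₀, o₀ = List.replicate n true ++ [false] ++ List.replicate k true ++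
    [true] ++ [false] := ⟨_, rfl⟩
  rw [← ho₀]
  refine Hp.seq (Hp.repeatFor (by simp) (fun j v' o' =>
    o' = o₀ ++ ((List.range j).flatMap fun u =>
      ((List.range k).flatMap fun a => rowBits n (if δ u a < n then δ u a else u)) ++
        rowBits n s) ∧
    v' (.inl states) = n ∧ v' (.inl letters) = k ∧
      v' (.inl start) = s ∧ v' (.inl state) = j ∧ J fun i => v' (.inr i)) ?_ ?_ ?_)
  · simp [*]
  · rintro j hj v' o' ⟨rfl, hn', hk', hs', hu', hJ'⟩ ht
    simp only [ne_eq, Sum.inl.injEq, reduceCtorEq, not_false_eq_true, Function.update_of_ne, hn]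
      at hj ht ⊢
    refine Hp.seq ((Hp.printRows hstep (by simpa) (by simpa) (by simpa) (by simpa) hj
      (by simpa)).mono ?_)
    rintro v₁ o₁ ⟨rfl, ho₁, hn₁, hk₁, hs₁, hu₁, hJ₁⟩
    refine Hp.incr (by omega) ?_
    simp [List.range_succ, *]
  · rintro v' o' ⟨rfl, hn', hk', hs', hu', hJ'⟩ ht
    simp only [ne_eq, Sum.inl.injEq, reduceCtorEq, not_false_eq_true, Function.update_of_ne, hn]
    refine Hp.seq (Hp.clr ?_)
    obtain ⟨o₁, ho₁⟩ : ∃ o₁, o₁ = o₀ ++ ((List.range n).flatMap fun u =>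
      ((List.range k).flatMap fun a => rowBits n (if δ u a < n then δ u a else u)) ++
        rowBits n s) := ⟨_, rfl⟩
    rw [← ho₁]
    refine Hp.repeatFor (by simp) (fun j v' o' => o' = o₁ ++ (List.range j).map χ ∧
      v' (.inl states) = n ∧ v' (.inl state) = j ∧ J fun i => v' (.inr i)) ?_ ?_ ?_
    · simp [*]
    · rintro j hj v' o' ⟨rfl, hn', hu', hJ'⟩ ht
      simp only [ne_eq, Sum.inl.injEq, reduceCtorEq, not_false_eq_true, Function.update_of_ne]
        at hj ht ⊢
      refine Hp.seq ((hmem _ _ (by simpa) (by simpa) (by simp [hu']; omega)).mono ?_)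
      rintro v₁ o₁ ⟨rfl, hres, hsame, hJ₁⟩
      simp only [ne_eq, Sum.inl.injEq, reduceCtorEq, not_false_eq_true, Function.update_of_ne, hu']
        at hres
      refine Hp.seq (Hp.ifPos (fun h => Hp.out (Hp.incr ?_ ?_)) fun h => Hp.out (Hp.incr ?_ ?_))
      · rw [hsame _ (by simp)]
        simp [hu']; omega
      · simp [List.range_succ, *]
        rw [← hres]
        simpa using h
      · rw [hsame _ (by simp)]
        simp [hu']; omega
      · have : χ j = false := by
          rw [← Bool.not_eq_true, ← hres]
          simpa using h
        simp [List.range_succ, *]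
    · rintro v' o' ⟨rfl, -⟩ -
      simp [automatonBits, ho₁, ho₀, hn', List.replicate_succ']

theorem logSpaceComputable_automatonBits [Finite ι] (init step mem : Cmd (PrintReg ⊕ ι))
    (hinit_det : init.Det) (hstep_det : step.Det) (hmem_det : mem.Det) (D : ℕ)
    (n k s : List Bool → ℕ) (δ : List Bool → ℕ → ℕ → ℕ) (χ : List Bool → ℕ → Bool)
    (J : List Bool → (ι → ℕ) → Prop)
    (hinit : ∀ x : List Bool, Hp x ((x.length + 2) ^ D) True init (fun _ => 0) [] fun v o =>
      o = [] ∧ v (.inl states) = n x ∧ v (.inl letters) = k x ∧ v (.inl start) = s x ∧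
        J x fun i => v (.inr i))
    (hstep : ∀ x : List Bool, StepSpec x ((x.length + 2) ^ D) True (n x) (k x) (J x) (δ x) step)
    (hmem : ∀ x : List Bool, MemSpec x ((x.length + 2) ^ D) True (n x) (J x) (χ x) mem) :
    LogSpaceComputable fun x => automatonBits (n x) (k x) (s x) (δ x) (χ x) := by
  refine logSpaceComputable (printAutomaton init step mem)
    (det_printAutomaton hinit_det hstep_det hmem_det) D _ fun x => ?_
  have h0 : Mem.init ((PrintReg ⊕ ι) ⊕ Fin 3) = lift (fun _ => 0) 0 [] := by
    ext r
    · rcases r with r | r <;> rfl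
    · rfl
    · rfl
  rw [h0]
  refine (Hp.printAutomaton (hinit x) (hstep x) (hmem x) 0).mono ?_
  rintro _ ⟨v', pos', o', rfl, h⟩
  exact h

end Cmd

/-! ## Automata with a reset letter -/

namespace Cmd

/-- The automaton printed by `automatonBits`. -/
def resetAutomaton (n k s : ℕ) (hs : s < n) (δ : ℕ → ℕ → ℕ) :
    Semiautomaton (Fin n) (Fin (k + 1)) where
  step u a := if a.1 < k then if h : δ u a < n then ⟨δ u a, h⟩ else u else ⟨s, hs⟩

/-- The set of states printed by `automatonBits`. -/
def stateSet (n : ℕ) (χ : ℕ → Bool) : Finset (Fin n) := Finset.univ.filter fun u => χ u = true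

/-- The transitions of the automaton other than loops and the reset letter. -/
def Trans (n k : ℕ) (δ : ℕ → ℕ → ℕ) (u v : ℕ) : Prop := v < n ∧ ∃ a < k, δ u a = v

variable {n k s : ℕ} {δ : ℕ → ℕ → ℕ} {χ : ℕ → Bool}

theorem rowBits_eq {v : ℕ} (hv : v < n) :
    rowBits n v = (List.finRange n).map fun p : Fin n => decide (v = p.1) := by
  rw [rowBits, if_pos hv]
  refine List.ext_getElem (by simp; omega) fun i h1 h2 => ?_
  simp only [List.getElem_map, List.getElem_finRange, Fin.cast_mk]
  rcases lt_trichotomy i v with h | rfl | h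
  · rw [List.getElem_append_left (by simpa using h)]
    simp; omega
  · simp
  · rw [List.getElem_append_right (by simp; omega)]
    obtain ⟨j, rfl⟩ := Nat.exists_eq_add_of_lt h
    simp [show v + j + 1 - v = j + 1 by omega]
    omega

theorem flatMap_range_eq {β : Type*} (n : ℕ) (f : ℕ → List β) :
    (List.range n).flatMap f = (List.finRange n).flatMap fun i : Fin n => f i := by
  rw [← List.map_coe_finRange_eq_range, List.flatMap_map]

theorem instanceBits_resetAutomaton (hs : s < n) :
    instanceBits (resetAutomaton n k s hs δ) (stateSet n χ) = automatonBits n k s δ χ := by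
  unfold instanceBits automatonBits
  congr 1
  · congr 1
    rw [flatMap_range_eq]
    refine List.flatMap_congr fun u _ => ?_
    rw [List.finRange_succ_last, List.flatMap_append, List.flatMap_map, flatMap_range_eq]
    congr 1
    · refine List.flatMap_congr fun a _ => ?_
      rw [rowBits_eq (by split_ifs <;> simp_all)]
      refine List.map_congr_left fun p _ => ?_
      rw [decide_eq_decide, Fin.ext_iff]
      simp only [resetAutomaton, Fin.val_castSucc, Fin.is_lt, if_true]
      split_ifs <;> simp
    · simp [rowBits_eq hs, resetAutomaton, Fin.ext_iff]
  · rw [← List.map_coe_finRange_eq_range, List.map_map]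
    refine List.map_congr_left fun p _ => ?_
    simp [stateSet]

theorem resetAutomaton_run_last (hs : s < n) (u : Fin n) (w : List (Fin (k + 1))) :
    (resetAutomaton n k s hs δ).run u (Fin.last k :: w) =
      (resetAutomaton n k s hs δ).run ⟨s, hs⟩ w := by
  simp [Semiautomaton.run, resetAutomaton]

theorem resetAutomaton_synchronizing (hs : s < n) : (resetAutomaton n k s hs δ).Synchronizing := by
  refine ⟨[Fin.last k], ?_⟩
  simp only [Semiautomaton.IsReset, resetAutomaton_run_last]
  have : Nonempty (Fin n) := ⟨⟨s, hs⟩⟩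
  rw [Set.range_const, Set.ncard_singleton]

/-- Ordinary letters follow transitions or loops and the reset letter returns to `s`, so no word
leaves the set of vertices reachable from `s`. -/
theorem reach_run (hs : s < n) (u : Fin n) (w : List (Fin (k + 1)))
    (hu : Relation.ReflTransGen (Trans n k δ) s u) :
    Relation.ReflTransGen (Trans n k δ) s ((resetAutomaton n k s hs δ).run u w) := by
  induction w generalizing u with
  | nil => exact hu
  | cons a w ih =>
    refine ih _ ?_
    simp only [resetAutomaton]
    split_ifs with h1 h2
    · exact hu.tail ⟨h2, a, h1, rfl⟩
    · exact hu
    · exact .refl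

theorem exists_run (hs : s < n) {v : ℕ} (hv : Relation.ReflTransGen (Trans n k δ) s v) :
    ∃ w, ((resetAutomaton n k s hs δ).run ⟨s, hs⟩ w).1 = v := by
  induction hv with
  | refl => exact ⟨[], rfl⟩
  | tail _ hstep ih =>
    obtain ⟨w, hw⟩ := ih
    obtain ⟨hc, a, ha, hδ⟩ := hstep
    refine ⟨w ++ [⟨a, by omega⟩], ?_⟩
    simp only [Semiautomaton.run, List.foldl_append, List.foldl_cons, List.foldl_nil] at hw ⊢
    simp [resetAutomaton, ha] at hw ⊢
    rw [hw, hδ, dif_pos hc]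

/-- If some word sends all states into the set, it sends `s` there, and its target is reachable in
the graph. Conversely, the reset letter followed by a word along a path from `s` sends all states to
the end of the path. -/
theorem totallyExtensible_resetAutomaton (hs : s < n) :
    (resetAutomaton n k s hs δ).TotallyExtensible (stateSet n χ : Set (Fin n)) ↔
      ∃ v, Relation.ReflTransGen (Trans n k δ) s v ∧ χ v = true := by
  constructor
  · rintro ⟨w, hw⟩
    have : (⟨s, hs⟩ : Fin n) ∈ (Set.univ : Set (Fin n)) := trivial
    rw [← hw] at this
    exact ⟨_, reach_run hs ⟨s, hs⟩ w .refl, by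
      simpa [Semiautomaton.preimage, stateSet] using this⟩
  · rintro ⟨v, hv, hχ⟩
    obtain ⟨w, hw⟩ := exists_run hs hv
    refine ⟨Fin.last k :: w, Set.eq_univ_of_forall fun q => ?_⟩
    simp only [Semiautomaton.preimage, Set.mem_ofPred_eq, resetAutomaton_run_last]
    simp [stateSet, hw, hχ]

theorem automatonBits_mem_yes (hs : s < n)
    (h : ∃ v, Relation.ReflTransGen (Trans n k δ) s v ∧ χ v = true) :
    automatonBits n k s δ χ ∈ totallyExtensibleSync.yes :=
  ⟨n, k + 1, _, _, resetAutomaton_synchronizing hs, (totallyExtensible_resetAutomaton hs).2 h,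
    (instanceBits_resetAutomaton hs).symm⟩

theorem automatonBits_mem_no (hs : s < n)
    (h : ¬ ∃ v, Relation.ReflTransGen (Trans n k δ) s v ∧ χ v = true) :
    automatonBits n k s δ χ ∈ totallyExtensibleSync.no :=
  ⟨n, k + 1, _, _, resetAutomaton_synchronizing hs, fun h' =>
    h ((totallyExtensible_resetAutomaton hs).1 h'), (instanceBits_resetAutomaton hs).symm⟩

end Cmd

/-! ## Sink components -/

namespace Semiautomaton

variable {Q α : Type*} (A : Semiautomaton Q α)

theorem run_append (q : Q) (w w' : List α) : A.run q (w ++ w') = A.run (A.run q w) w' := by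
  simp [run]

variable {A}

theorem Reaches.refl (q : Q) : A.Reaches q q := ⟨[], rfl⟩

theorem Reaches.trans {p q r : Q} (h : A.Reaches p q) (h' : A.Reaches q r) : A.Reaches p r := by
  obtain ⟨w, rfl⟩ := h
  obtain ⟨w', rfl⟩ := h'
  exact ⟨w ++ w', A.run_append p w w'⟩

theorem Reaches.mem {C : Set Q} (hC : ∀ p ∈ C, ∀ a, A.step p a ∈ C) {p q : Q} (hp : p ∈ C)
    (h : A.Reaches p q) : q ∈ C := by
  obtain ⟨w, rfl⟩ := h
  induction w generalizing p with
  | nil => exact hp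
  | cons a w ih => exact ih (hC p hp a)

theorem Synchronizing.exists_run_eq (h : A.Synchronizing) :
    ∃ (w : List α) (c : Q), ∀ q, A.run q w = c := by
  obtain ⟨w, hw⟩ := h
  obtain ⟨c, hc⟩ := Set.ncard_eq_one.1 hw
  exact ⟨w, c, fun q => by
    have : A.run q w ∈ Set.range fun q => A.run q w := ⟨q, rfl⟩
    rwa [hc] at this⟩

/-- A set of states is totally extensible if and only if it is reachable from all states. -/
theorem Synchronizing.totallyExtensible_iff (h : A.Synchronizing) (S : Set Q) :
    A.TotallyExtensible S ↔ ∀ q, ∃ p ∈ S, A.Reaches q p := by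
  obtain ⟨w, c, hw⟩ := h.exists_run_eq
  constructor
  · rintro ⟨w', hw'⟩ q
    have : q ∈ A.preimage S w' := hw' ▸ trivial
    exact ⟨_, this, w', rfl⟩
  · intro h
    obtain ⟨p, hp, w', rfl⟩ := h c
    -- The reset word gathers all states in `c`, and `w'` leads from there into `S`.
    refine ⟨w ++ w', Set.eq_univ_of_forall fun q => ?_⟩
    simpa [preimage, run_append, hw] using hp

/-- The component consists of the states reachable from `c`, the common target of a reset word; they
all lead back to `c`. A second sink component can be left by no word, so it contains `c` and hence
is the same class. -/
theorem Synchronizing.exists_sinkComponent (h : A.Synchronizing) :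
    ∃ C : Set Q, A.IsSinkComponent C ∧ (∀ C' : Set Q, A.IsSinkComponent C' → C' = C) ∧
      (∀ p : Q, ∀ q ∈ C, A.Reaches p q) ∧
      ∀ S : Set Q, A.TotallyExtensible S ↔ (S ∩ C).Nonempty := by
  obtain ⟨w, c, hw⟩ := h.exists_run_eq
  have hc : ∀ p, A.Reaches p c := fun p => ⟨w, hw p⟩
  have hsink : A.IsSinkComponent {q | A.Reaches c q} := by
    refine ⟨⟨⟨c, .refl c⟩, fun p hp q => ⟨fun hq => ⟨(hc p).trans hq, (hc q).trans hp⟩,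
      fun hq => hp.trans hq.1⟩⟩, fun p hp a => hp.trans ⟨[a], rfl⟩⟩
  refine ⟨{q | A.Reaches c q}, hsink, ?_, fun p q hq => (hc p).trans hq, fun S => ?_⟩
  · rintro C' ⟨⟨⟨p, hp⟩, hC'⟩, hstep⟩
    have hcC : c ∈ C' := (hc p).mem hstep hp
    ext q
    exact ⟨fun hq => ((hC' c hcC q).1 hq).1, fun hq => hq.mem hstep hcC⟩
  · rw [h.totallyExtensible_iff]
    constructor
    · intro h
      obtain ⟨p, hp, hcp⟩ := h c
      exact ⟨p, hp, hcp⟩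
    · rintro ⟨p, hp, hcp⟩ q
      exact ⟨p, hp, (hc q).trans hcp⟩

end Semiautomaton

/-! ## Reading instances -/

namespace Cmd

open Prog PrintReg

/-- Is it the bit `1`? -/
def isOne : InputSymbol → Bool
  | .bit b => b
  | _ => false

/-- The bits of `x`. -/
def bitAt (x : List Bool) (i : ℕ) : Bool := x.getD i false

/-- Cell `0` carries the left end marker, so the bit with index `i` stands in cell `i + 1`. This is
why cursors are incremented once after an index has been computed. -/
theorem isOne_readInput (x : List Bool) (i : ℕ) :
    isOne (TM.readInput x (i + 1)) = bitAt x i := by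
  simp only [TM.readInput, bitAt, List.getD]
  cases x[i]? <;> rfl

/-- The number of ones in `x` from the position `i` on, up to the first zero. -/
def ones (x : List Bool) (i : ℕ) : ℕ := ((x.drop i).takeWhile id).length

theorem ones_le (x : List Bool) (i : ℕ) : ones x i ≤ x.length - i := by
  rw [← List.length_drop]
  exact (List.takeWhile_prefix _).length_le

theorem bitAt_of_lt_ones {x : List Bool} {i j : ℕ} (h : j < ones x i) :
    bitAt x (i + j) = true := by
  have : ∀ (l : List Bool) (j : ℕ), j < (l.takeWhile id).length → l.getD j false = true := by
    intro l
    induction l with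
    | nil => simp
    | cons b l ih =>
      intro j hj
      cases b
      · simp at hj
      · cases j with
        | zero => rfl
        | succ j => exact ih j (by simpa using hj)
  simpa [bitAt, List.getD] using this _ j h

theorem bitAt_ones (x : List Bool) (i : ℕ) : bitAt x (i + ones x i) = false := by
  have : ∀ l : List Bool, l.getD (l.takeWhile id).length false = false := by
    intro l
    induction l with
    | nil => rfl
    | cons b l ih => cases b <;> simp_all
  have := this (x.drop i)
  simpa [bitAt, List.getD, ones] using this

theorem ones_append (l l' : List Bool) (n : ℕ) :
    ones (l ++ List.replicate n true ++ false :: l') l.length = n := by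
  simp [ones, List.takeWhile_append_of_pos]

/-- Row-major addressing in a concatenation of blocks of equal length; it serves for the tables of
graphs and of automata. -/
theorem getElem?_flatMap_finRange {β : Type*} {n m : ℕ} (f : Fin n → List β)
    (hf : ∀ i, (f i).length = m) (u : Fin n) {v : ℕ} (hv : v < m) :
    ((List.finRange n).flatMap f)[u.1 * m + v]? = (f u)[v]? := by
  induction n with
  | zero => exact u.elim0
  | succ n ih =>
    rw [List.finRange_succ, List.flatMap_cons]
    refine Fin.cases ?_ (fun u => ?_) u
    · simp only [Fin.val_zero, zero_mul, zero_add]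
      rw [List.getElem?_append_left (by rw [hf]; exact hv)]
    · rw [List.getElem?_append_right (by rw [hf, Fin.val_succ, add_mul]; omega), List.flatMap_map,
        hf, Fin.val_succ, show (u.1 + 1) * m + v - m = u.1 * m + v by rw [add_mul]; omega]
      exact ih (fun i => f i.succ) (fun i => hf _) u

theorem length_flatMap_finRange {β : Type*} {n m : ℕ} (f : Fin n → List β)
    (hf : ∀ i, (f i).length = m) : ((List.finRange n).flatMap f).length = n * m := by
  simp [List.length_flatMap, hf]

variable {ι : Type}

/-- Move `r_p` to the first position without a one; `r_l` is an upper bound on the number of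
steps. -/
def scanOnes (t l p : ι) : Cmd ι := repeatFor t l (ifSym p isOne (incr p) .skip)

theorem det_scanOnes (t l p : ι) : (scanOnes t l p).Det :=
  det_repeatFor _ _ (det_ifSym _ _ trivial trivial)

variable [DecidableEq ι] {x : List Bool} {B : ℕ} {P : Prop}

/-- The number of rounds is only an upper bound; a cursor that has met a zero stays there, hence the
minimum in the invariant. It ends in the cell of that zero. -/
theorem Hp.scanOnes {v : ι → ℕ} {o : List Bool} {Q : (ι → ℕ) → List Bool → Prop} {t l p : ι}
    (htl : t ≠ l) (htp : t ≠ p) (hlp : l ≠ p) {i : ℕ} (hp : v p = i + 1) (hl : ones x i ≤ v l)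
    (hB : i + ones x i + 1 ≤ B)
    (h : Q (Function.update (Function.update v t 0) p (i + ones x i + 1)) o) :
    Hp x B P (scanOnes t l p) v o Q := by
  refine Hp.repeatFor htl (fun j v' o' => v' = Function.update (Function.update v t (v l - j)) p
    (i + min j (ones x i) + 1) ∧ o' = o) ⟨?_, rfl⟩ ?_ ?_
  · funext r
    by_cases h1 : r = p
    · subst h1; simp [htp.symm, hp]
    · simp [h1]
  · rintro j hj _ _ ⟨rfl, rfl⟩ ht
    have hval : Function.update (Function.update (Function.update v t (v l - j)) p
        (i + min j (ones x i) + 1)) t (v l - (j + 1)) p = i + min j (ones x i) + 1 := by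
      simp [htp.symm]
    have hlast : ∀ c, Function.update (Function.update (Function.update (Function.update v t
        (v l - j)) p (i + min j (ones x i) + 1)) t (v l - (j + 1))) p c =
        Function.update (Function.update v t (v l - (j + 1))) p c := by
      intro c
      funext r
      by_cases h1 : r = p
      · subst h1; simp
      · by_cases h2 : r = t
        · subst h2; simp [h1]
        · simp [h1, h2]
    refine Hp.ifSym (fun hf => Hp.incr ?_ ⟨?_, ?_, rfl⟩) (fun hf => Hp.skip ⟨?_, ?_, rfl⟩)
    all_goals rw [hval, isOne_readInput] at hf
    · rw [hval]
      have : min j (ones x i) ≠ ones x i := by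
        intro h
        rw [h, bitAt_ones] at hf
        exact absurd hf (by simp)
      omega
    · simp [htp]
    · rw [hval, hlast]
      have : min j (ones x i) ≠ ones x i := by
        intro h
        rw [h, bitAt_ones] at hf
        exact absurd hf (by simp)
      congr 1
      omega
    · simp
    · have : ¬ min j (ones x i) < ones x i := by
        intro h
        rw [bitAt_of_lt_ones h] at hf
        exact absurd hf (by simp)
      rw [← hlast, show i + min (j + 1) (ones x i) + 1 = i + min j (ones x i) + 1 by omega,
        eq_comm]
      refine (congrArg _ hval.symm).trans (Function.update_eq_self _ _)
  · rintro _ _ ⟨rfl, rfl⟩ ht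
    rw [min_eq_right hl]
    simpa using h

end Cmd

/-! ## Reachability in graphs -/

namespace Cmd

open Prog PrintReg

/-- The counters for reading a graph: the length of the input, auxiliary counters, and the
positions before the adjacency matrix and after it. -/
inductive GraphReg where
  | len
  | time
  | cursor
  | vertex
  | matrix
  | vectors
  deriving DecidableEq

instance : Finite GraphReg :=
  Set.finite_univ_iff.1 ((Set.toFinite {.len, .time, .cursor, .vertex, .matrix,
    .vectors}).subset fun r _ => by cases r <;> simp)

open GraphReg

/-- Read the size of a graph and its first marked vertex. -/
def graphInit : Cmd (PrintReg ⊕ GraphReg) :=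
  addLength (.inl (.inr len)) ;; incr (.inr matrix) ;;
  scanOnes (.inr time) (.inr len) (.inr matrix) ;;
  add (.inl states) (.inr matrix) ;; incr (.inl count) ;; sub (.inl states) (.inl count) ;;
  add (.inl letters) (.inl states) ;;
  add (.inr vectors) (.inr matrix) ;; mulAdd (.inr vectors) (.inl letters) (.inl states) ;;
  add (.inr cursor) (.inr vectors) ;; incr (.inr cursor) ;;
  repeatFor (.inr time) (.inl states)
    (ifSym (.inr cursor) isOne (mov (.inl start) (.inr vertex)) .skip ;;
      incr (.inr vertex) ;; incr (.inr cursor))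

/-- Follow the edge to the vertex in the counter `letter`. -/
def graphStep : Cmd (PrintReg ⊕ GraphReg) :=
  mov (.inr cursor) (.inr matrix) ;; mulAdd (.inr cursor) (.inl state) (.inl states) ;;
  add (.inr cursor) (.inl letter) ;; incr (.inr cursor) ;;
  ifSym (.inr cursor) isOne (mov (.inl result) (.inl letter)) (mov (.inl result) (.inl states))

/-- Is the vertex in the counter `state` the second marked vertex? -/
def graphMem : Cmd (PrintReg ⊕ GraphReg) :=
  mov (.inr cursor) (.inr vectors) ;; add (.inr cursor) (.inl states) ;;
  add (.inr cursor) (.inl state) ;; incr (.inr cursor) ;;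
  ifSym (.inr cursor) isOne (const (.inl result) 1) (const (.inl result) 0)

/-- The last number less than `n` with a given property, or `0`. -/
def lastBelow (χ : ℕ → Bool) : ℕ → ℕ
  | 0 => 0
  | n + 1 => if χ n then n else lastBelow χ n

theorem lastBelow_eq {χ : ℕ → Bool} {n s : ℕ} (hs : s < n) (h : ∀ i < n, χ i = true ↔ i = s) :
    lastBelow χ n = s := by
  induction n with
  | zero => omega
  | succ n ih =>
    simp only [lastBelow]
    split_ifs with hn
    · exact (h n (by omega)).1 hn
    · refine ih ?_ fun i hi => h i (by omega)
      by_contra hlt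
      exact hn ((h n (by omega)).2 (by omega))

/-- This holds for arbitrary bit strings, as the reduction has to halt on all of them: bits beyond
the input count as `false`, and the number of leading ones is at most the length of the input, so
all addresses stay quadratic. -/
theorem Hp.graphInit {x : List Bool} {P : Prop} :
    Hp x ((x.length + 2) ^ 2) P graphInit (fun _ => 0) [] fun v o =>
      o = [] ∧ v (.inl states) = ones x 0 ∧ v (.inl letters) = ones x 0 ∧
      v (.inl start) = lastBelow (fun u => bitAt x (ones x 0 + 1 + ones x 0 * ones x 0 + u))
        (ones x 0) ∧
      v (.inr matrix) = ones x 0 + 1 ∧ v (.inr vectors) = ones x 0 + 1 + ones x 0 * ones x 0 := by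
  have hn := ones_le x 0
  generalize hn' : ones x 0 = n at *
  have hB : n * n ≤ x.length * x.length := Nat.mul_le_mul (by omega) (by omega)
  have hB' : (x.length + 2) ^ 2 = x.length * x.length + 4 * x.length + 4 := by ring
  rw [hB']
  refine Hp.seq (Hp.addLength (by simp; omega) ?_)
  refine Hp.seq (Hp.incr (by simp) ?_)
  -- The cell number of the first zero equals the index of the first bit of the matrix, so `matrix`
  -- needs no further correction.
  refine Hp.seq (Hp.scanOnes (i := 0) (by simp) (by simp) (by simp) (by simp)
    (by simp; omega) (by omega) ?_)
  refine Hp.seq (Hp.add (by simp) (by simp; omega) ?_)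
  refine Hp.seq (Hp.incr (by simp) ?_)
  refine Hp.seq (Hp.sub (by simp) ?_)
  refine Hp.seq (Hp.add (by simp) (by simp; omega) ?_)
  refine Hp.seq (Hp.add (by simp) (by simp; omega) ?_)
  refine Hp.seq (Hp.mulAdd (by simp) (by simp) (by simp [hn']; omega) ?_)
  refine Hp.seq (Hp.add (by simp) (by simp [hn']; omega) ?_)
  refine Hp.seq (Hp.incr (by simp [hn']; omega) ?_)
  refine Hp.repeatFor (by simp) (fun j v o => o = [] ∧
    v (.inl states) = n ∧ v (.inl letters) = n ∧ v (.inr vertex) = j ∧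
    v (.inr cursor) = n + 1 + n * n + j + 1 ∧
    v (.inl start) = lastBelow (fun u => bitAt x (n + 1 + n * n + u)) j ∧
    v (.inr matrix) = n + 1 ∧ v (.inr vectors) = n + 1 + n * n) ?_ ?_ ?_
  · simp [lastBelow, hn']
  · rintro j hj v o ⟨rfl, h1, h2, h3, h4, h5, h6, h7⟩ ht
    simp [hn'] at hj ht ⊢
    refine Hp.seq (Hp.ifSym (fun hf => Hp.mov (by simp) ?_) fun hf => Hp.skip ?_)
    all_goals
      simp only [ne_eq, Sum.inr.injEq, reduceCtorEq, not_false_eq_true, Function.update_of_ne, h4,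
        isOne_readInput] at hf
      refine Hp.seq (Hp.incr (by simp; omega) (Hp.incr (by simp; omega) ?_))
      simp [*, lastBelow]
      omega
  · rintro v o ⟨rfl, h1, h2, h3, h4, h5, h6, h7⟩ ht
    simp [hn'] at h5
    exact ⟨rfl, h1, h2, h5, h6, h7⟩

/-- Letters are named after vertices: letter `a` follows the edge to `a`. Without this edge the
result is `n`, which is not a state, so that a loop is printed. -/
theorem graphStep_spec (x : List Bool) (P : Prop) :
    StepSpec x ((x.length + 2) ^ 2) P (ones x 0) (ones x 0)
      (fun v => v matrix = ones x 0 + 1 ∧ v vectors = ones x 0 + 1 + ones x 0 * ones x 0)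
      (fun u a => if bitAt x (ones x 0 + 1 + u * ones x 0 + a) then a else ones x 0) graphStep := by
  rintro v o h1 ⟨h2, h3⟩ h4 h5
  have hn := ones_le x 0
  generalize ones x 0 = n at *
  have hB : n * n ≤ x.length * x.length := Nat.mul_le_mul (by omega) (by omega)
  have hB2 : v (.inl state) * n ≤ n * n := Nat.mul_le_mul (by omega) (by omega)
  have hB' : (x.length + 2) ^ 2 = x.length * x.length + 4 * x.length + 4 := by ring
  rw [hB']
  refine Hp.seq (Hp.mov (by simp) (Hp.seq (Hp.mulAdd (by simp) (by simp) ?_ (Hp.seq (Hp.add (by simp)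
    ?_ (Hp.seq (Hp.incr ?_ (Hp.ifSym (fun hf => Hp.mov (by simp) ?_)
    fun hf => Hp.mov (by simp) ?_))))))))
  · simp [*]; omega
  · simp [*]; omega
  · simp [*]; omega
  all_goals
    simp only [Function.update_self, isOne_readInput, ne_eq, reduceCtorEq,
      not_false_eq_true, Function.update_of_ne, h1, h2] at hf
    simp [*]
    intro r hr
    simp [hr]

theorem graphMem_spec (x : List Bool) (P : Prop) :
    MemSpec x ((x.length + 2) ^ 2) P (ones x 0)
      (fun v => v matrix = ones x 0 + 1 ∧ v vectors = ones x 0 + 1 + ones x 0 * ones x 0)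
      (fun u => bitAt x (ones x 0 + 1 + ones x 0 * ones x 0 + ones x 0 + u)) graphMem := by
  rintro v o h1 ⟨h2, h3⟩ h4
  have hn := ones_le x 0
  generalize ones x 0 = n at *
  have hB : n * n ≤ x.length * x.length := Nat.mul_le_mul (by omega) (by omega)
  have hB' : (x.length + 2) ^ 2 = x.length * x.length + 4 * x.length + 4 := by ring
  rw [hB']
  refine Hp.seq (Hp.mov (by simp) (Hp.seq (Hp.add (by simp) ?_ (Hp.seq (Hp.add (by simp)
    ?_ (Hp.seq (Hp.incr ?_ (Hp.ifSym (fun hf => Hp.const (by omega) ?_)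
    fun hf => Hp.const (by omega) ?_))))))))
  · simp [*]; omega
  · simp [*]; omega
  · simp [*]; omega
  all_goals
    simp only [Function.update_self, isOne_readInput, ne_eq, reduceCtorEq,
      not_false_eq_true, Function.update_of_ne, h1, h3] at hf
    simp [*]
    intro r hr
    simp [hr]

theorem ones_graphBits {n : ℕ} (E : Fin n → Fin n → Bool) (s t : Fin n) :
    ones (graphBits E s t) 0 = n := by
  have := ones_append [] (((List.finRange n).flatMap fun u => (List.finRange n).map fun v => E u v) ++
    ((List.finRange n).map fun v => decide (v = s)) ++
    (List.finRange n).map fun v => decide (v = t)) n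
  simpa [graphBits] using this

theorem bitAt_graphBits_edge {n : ℕ} (E : Fin n → Fin n → Bool) (s t u v : Fin n) :
    bitAt (graphBits E s t) (n + 1 + u * n + v) = E u v := by
  have hlen := length_flatMap_finRange (n := n) (m := n)
    (fun u => (List.finRange n).map fun v => E u v) (by simp)
  have hlt : u.1 * n + v.1 < n * n := by
    have := Nat.mul_le_mul_right n (show u.1 + 1 ≤ n from u.2)
    rw [add_mul] at this
    omega
  have h := getElem?_flatMap_finRange (fun u => (List.finRange n).map fun v => E u v)
    (by simp) u v.2
  simp only [bitAt, graphBits, List.getD]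
  rw [List.getElem?_append_left (by simp [hlen] ; omega), List.getElem?_append_left (by simp [hlen]; omega),
    List.getElem?_append_right (by simp; omega)]
  simp only [List.length_append, List.length_replicate, List.length_singleton]
  rw [show n + 1 + u.1 * n + v - (n + 1) = u * n + v by omega, h]
  simp

theorem bitAt_graphBits_s {n : ℕ} (E : Fin n → Fin n → Bool) (s t v : Fin n) :
    bitAt (graphBits E s t) (n + 1 + n * n + v) = decide (v = s) := by
  have hlen := length_flatMap_finRange (n := n) (m := n)
    (fun u => (List.finRange n).map fun v => E u v) (by simp)
  simp only [bitAt, graphBits, List.getD]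
  have := v.2
  rw [List.getElem?_append_left (by simp [hlen]; omega),
    List.getElem?_append_right (by simp [hlen]; omega)]
  simp only [List.length_append, List.length_replicate, List.length_singleton, hlen]
  rw [show n + 1 + n * n + v.1 - (n + 1 + n * n) = v by omega]
  simp

theorem bitAt_graphBits_t {n : ℕ} (E : Fin n → Fin n → Bool) (s t v : Fin n) :
    bitAt (graphBits E s t) (n + 1 + n * n + n + v) = decide (v = t) := by
  have hlen := length_flatMap_finRange (n := n) (m := n)
    (fun u => (List.finRange n).map fun v => E u v) (by simp)
  simp only [bitAt, graphBits, List.getD]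
  rw [List.getElem?_append_right (by simp [hlen]; omega)]
  simp only [List.length_append, List.length_replicate, List.length_singleton, hlen,
    List.length_map, List.length_finRange]
  rw [show n + 1 + n * n + n + v.1 - (n + 1 + n * n + n) = v by omega]
  simp

/-- The reduction from reachability in graphs. -/
noncomputable def graphReduction (x : List Bool) : List Bool :=
  automatonBits (ones x 0) (ones x 0)
    (lastBelow (fun u => bitAt x (ones x 0 + 1 + ones x 0 * ones x 0 + u)) (ones x 0))
    (fun u a => if bitAt x (ones x 0 + 1 + u * ones x 0 + a) then a else ones x 0)
    fun u => bitAt x (ones x 0 + 1 + ones x 0 * ones x 0 + ones x 0 + u)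

theorem logSpaceComputable_graphReduction : LogSpaceComputable graphReduction := by
  refine logSpaceComputable_automatonBits graphInit graphStep graphMem ?_ ?_ ?_ 2 _ _ _ _ _
    (fun x v => v matrix = ones x 0 + 1 ∧ v vectors = ones x 0 + 1 + ones x 0 * ones x 0)
    (fun x => Hp.graphInit) (fun x => graphStep_spec x True) (fun x => graphMem_spec x True)
  · exact ⟨det_addLength _, trivial, det_scanOnes _ _ _, det_add _ _, trivial, det_sub _ _,
      det_add _ _, det_add _ _, det_mulAdd _ _ _, det_add _ _, trivial,
      det_repeatFor _ _ ⟨det_ifSym _ _ (det_mov _ _) trivial, trivial, trivial⟩⟩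
  · exact ⟨det_mov _ _, det_mulAdd _ _ _, det_add _ _, trivial,
      det_ifSym _ _ (det_mov _ _) (det_mov _ _)⟩
  · exact ⟨det_mov _ _, det_add _ _, det_add _ _, trivial,
      det_ifSym _ _ (det_const _ _) (det_const _ _)⟩

/-- On encodings of graphs, transitions other than loops and resets are precisely the edges. -/
theorem reach_graphBits_iff {n : ℕ} (E : Fin n → Fin n → Bool) (s t : Fin n) :
    (∃ v, Relation.ReflTransGen (Trans n n fun u a =>
      if bitAt (graphBits E s t) (n + 1 + u * n + a) then a else n) s v ∧
      bitAt (graphBits E s t) (n + 1 + n * n + n + v) = true) ↔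
    Relation.ReflTransGen (fun u v => E u v = true) s t := by
  have hstep : ∀ u : Fin n, ∀ v, Trans n n (fun u a =>
      if bitAt (graphBits E s t) (n + 1 + u * n + a) then a else n) u v ↔
      ∃ h : v < n, E u ⟨v, h⟩ = true := by
    intro u v
    constructor
    · rintro ⟨hv, a, ha, hav⟩
      dsimp only at hav
      split_ifs at hav with h
      · subst hav
        exact ⟨hv, (bitAt_graphBits_edge E s t u ⟨a, hv⟩).symm.trans h⟩
      · omega
    · rintro ⟨hv, h⟩
      refine ⟨hv, v, hv, ?_⟩
      dsimp only
      rw [show n + 1 + u.1 * n + v = n + 1 + u.1 * n + (⟨v, hv⟩ : Fin n).1 from rfl,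
        bitAt_graphBits_edge, h, if_pos rfl]
  constructor
  · rintro ⟨v, hv, hb⟩
    have key : ∃ h : v < n, Relation.ReflTransGen (fun u v => E u v = true) s ⟨v, h⟩ := by
      clear hb
      induction hv with
      | refl => exact ⟨s.2, .refl⟩
      | tail _ h ih =>
        obtain ⟨hu, ih⟩ := ih
        obtain ⟨hv, h⟩ := (hstep ⟨_, hu⟩ _).1 h
        exact ⟨hv, ih.tail h⟩
    obtain ⟨h, hr⟩ := key
    rw [bitAt_graphBits_t E s t ⟨v, h⟩, decide_eq_true_iff] at hb
    rwa [hb] at hr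
  · intro h
    refine ⟨t, ?_, by simp [bitAt_graphBits_t]⟩
    exact Relation.ReflTransGen.lift (fun u : Fin n => u.1) (fun u v h => (hstep u v).2 ⟨v.2, h⟩) _ _ h

theorem stConnectivity_logSpaceReduces :
    stConnectivity.LogSpaceReduces totallyExtensibleSync := by
  have hstart : ∀ {n : ℕ} (E : Fin n → Fin n → Bool) (s t : Fin n),
      lastBelow (fun u => bitAt (graphBits E s t) (n + 1 + n * n + u)) n = s := by
    intro n E s t
    refine lastBelow_eq s.2 fun i hi => ?_
    rw [bitAt_graphBits_s E s t ⟨i, hi⟩]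
    simp [Fin.ext_iff]
  refine ⟨graphReduction, logSpaceComputable_graphReduction, ?_, ?_⟩
  · rintro _ ⟨n, E, s, t, hst, rfl⟩
    rw [graphReduction, ones_graphBits, hstart]
    exact automatonBits_mem_yes s.2 ((reach_graphBits_iff E s t).2 hst)
  · rintro _ ⟨n, E, s, t, hst, rfl⟩
    rw [graphReduction, ones_graphBits, hstart]
    exact automatonBits_mem_no s.2 fun h => hst ((reach_graphBits_iff E s t).1 h)

end Cmd

/-! ## Configurations of Turing machines as numbers -/

namespace ConfigCode

/-- The digits to the left of the head, after a leading one. -/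
def leftCode (g : ℕ) (t : ℕ → ℕ) : ℕ → ℕ
  | 0 => 1
  | h + 1 => t h + g * leftCode g t h

/-- The digits from the position `h` on. -/
def rightCode (g : ℕ) (t : ℕ → ℕ) (h : ℕ) : ℕ → ℕ
  | 0 => 0
  | m + 1 => t h + g * rightCode g t (h + 1) m

/-- The codes of a tape after the digit `w` has been written and the head has been moved; `l` is
the code of the part to the left of the head and `r` that of the part to the right of it. -/
def pushTape (g w : ℕ) (mv : HeadMove) (l r : ℕ) : ℕ × ℕ :=
  match mv with
  | .stay => (l, w + g * r)
  | .right => (w + g * l, r)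
  | .left => if l / g = 0 then (l, w + g * r) else (l / g, l % g + g * (w + g * r))

variable {g : ℕ} {t : ℕ → ℕ}

/-- The leading one makes the left end detectable: the quotient of the left code by `g` vanishes
exactly when the head is in cell `0`. Blanks have the digit `0`, so without the leading one this
would be ambiguous. -/
theorem leftCode_pos (hg : 0 < g) (h : ℕ) : 0 < leftCode g t h := by
  induction h with
  | zero => exact one_pos
  | succ h ih => exact Nat.add_pos_right _ (Nat.mul_pos hg ih)

theorem leftCode_lt (hg : 2 ≤ g) (ht : ∀ j, t j < g) (h : ℕ) : leftCode g t h < g ^ (h + 1) := by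
  induction h with
  | zero => simp [leftCode]; omega
  | succ h ih =>
    calc t h + g * leftCode g t h < g + g * leftCode g t h := by have := ht h; omega
      _ = g * (leftCode g t h + 1) := by ring
      _ ≤ g * g ^ (h + 1) := Nat.mul_le_mul_left _ ih
      _ = g ^ (h + 1 + 1) := by ring

theorem rightCode_lt (ht : ∀ j, t j < g) (h m : ℕ) : rightCode g t h m < g ^ m := by
  induction m generalizing h with
  | zero => simp [rightCode]
  | succ m ih =>
    calc t h + g * rightCode g t (h + 1) m < g + g * rightCode g t (h + 1) m := by
          have := ht h; omega
      _ = g * (rightCode g t (h + 1) m + 1) := by ring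
      _ ≤ g * g ^ m := Nat.mul_le_mul_left _ (ih _)
      _ = g ^ (m + 1) := by ring

theorem leftCode_congr {t' : ℕ → ℕ} {h : ℕ} (H : ∀ j < h, t j = t' j) :
    leftCode g t h = leftCode g t' h := by
  induction h with
  | zero => rfl
  | succ h ih => rw [leftCode, leftCode, H h (by omega), ih fun j hj => H j (by omega)]

theorem rightCode_congr {t' : ℕ → ℕ} {h m : ℕ} (H : ∀ j ≥ h, t j = t' j) :
    rightCode g t h m = rightCode g t' h m := by
  induction m generalizing h with
  | zero => rfl
  | succ m ih => rw [rightCode, rightCode, H h le_rfl, ih fun j hj => H j (by omega)]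

theorem rightCode_mod {L h : ℕ} (hL : h ≤ L) (ht : t h < g) :
    rightCode g t h (L + 1 - h) % g = t h := by
  rw [show L + 1 - h = (L - h) + 1 by omega, rightCode, Nat.add_mul_mod_self_left,
    Nat.mod_eq_of_lt ht]

theorem rightCode_div {L h : ℕ} (hL : h ≤ L) (ht : t h < g) :
    rightCode g t h (L + 1 - h) / g = rightCode g t (h + 1) (L - h) := by
  rw [show L + 1 - h = (L - h) + 1 by omega, rightCode,
    Nat.add_mul_div_left _ _ (by omega), Nat.div_eq_of_lt ht, zero_add]

/-- The tape is a pair of stacks and a move of the head transfers one digit between them. The right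
code covers the cells up to `L`, which is correct as long as the head stays in this window before
and after the move. -/
theorem pushTape_eq (hg : 2 ≤ g) (ht : ∀ j, t j < g) {L h w : ℕ} (mv : HeadMove)
    (hL : h ≤ L) (hL' : TM.moveHead mv h ≤ L) :
    pushTape g w mv (leftCode g t h) (rightCode g t (h + 1) (L - h)) =
      (leftCode g (Function.update t h w) (TM.moveHead mv h),
        rightCode g (Function.update t h w) (TM.moveHead mv h) (L + 1 - TM.moveHead mv h)) := by
  have h1 : ∀ j < h, t j = Function.update t h w j := fun j hj => by
    rw [Function.update_of_ne (by omega)]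
  have h2 : ∀ j ≥ h + 1, t j = Function.update t h w j := fun j hj => by
    rw [Function.update_of_ne (by omega)]
  cases mv with
  | stay =>
    simp only [pushTape, TM.moveHead]
    rw [leftCode_congr h1, show L + 1 - h = (L - h) + 1 by omega, rightCode,
      Function.update_self, rightCode_congr h2]
  | right =>
    simp only [pushTape, TM.moveHead]
    rw [leftCode, Function.update_self, leftCode_congr h1, rightCode_congr h2,
      Nat.add_sub_add_right]
  | left =>
    simp only [pushTape, TM.moveHead]
    rcases h with _ | h
    · rw [if_pos (by rw [leftCode]; exact Nat.div_eq_of_lt hg), rightCode_congr h2]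
      simp [leftCode, rightCode]
    · have hdiv : leftCode g t (h + 1) / g = leftCode g t h := by
        rw [leftCode, Nat.add_mul_div_left _ _ (by omega), Nat.div_eq_of_lt (ht h), zero_add]
      have hmod : leftCode g t (h + 1) % g = t h := by
        rw [leftCode, Nat.add_mul_mod_self_left, Nat.mod_eq_of_lt (ht h)]
      rw [hdiv, if_neg (leftCode_pos (by omega) h).ne', hmod, Nat.add_sub_cancel,
        leftCode_congr fun j hj => h1 j (by omega),
        show L + 1 - h = (L - (h + 1)) + 1 + 1 by omega, rightCode, rightCode,
        Function.update_self, rightCode_congr h2, ← h1 h (by omega)]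

/-- The coordinates of the code of a configuration: the state, the position of the input head,
and two codes for every tape. -/
inductive CReg (k : ℕ) where
  | st
  | ip
  | left (i : Fin k)
  | right (i : Fin k)
  deriving DecidableEq

/-- All coordinates. -/
def cregs (k : ℕ) : List (CReg k) :=
  [.st, .ip] ++ (List.finRange k).map .left ++ (List.finRange k).map .right

theorem cregs_nodup (k : ℕ) : (cregs k).Nodup := by
  simp only [cregs, List.nodup_append, List.nodup_cons]
  refine ⟨⟨by simp, (List.nodup_finRange k).map fun _ _ h => by injection h, by simp⟩,
    (List.nodup_finRange k).map fun _ _ h => by injection h, by simp⟩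

theorem mem_cregs {k : ℕ} (r : CReg k) : r ∈ cregs k := by
  cases r <;> simp [cregs]

instance (k : ℕ) : Finite (CReg k) :=
  Set.finite_univ_iff.1 ((cregs k).toFinset.finite_toSet.subset fun r _ => by
    simpa using mem_cregs r)

/-! ### Several coordinates in one number -/

section Pack

variable {R : Type*} (B : ℕ)

/-- The number with the given digits. -/
def pack (c : R → ℕ) : List R → ℕ
  | [] => 0
  | r :: rs => c r + B * pack c rs

/-- The digits of a number. -/
def unpack [DecidableEq R] : List R → (R → ℕ) → ℕ → R → ℕ
  | [], c, _ => c
  | r :: rs, c, u => unpack rs (Function.update c r (u % B)) (u / B)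

variable {B}

theorem unpack_of_notMem [DecidableEq R] {rs : List R} {r : R} (hr : r ∉ rs) (c : R → ℕ) (u : ℕ) :
    unpack B rs c u r = c r := by
  induction rs generalizing c u with
  | nil => rfl
  | cons r' rs ih =>
    simp only [List.mem_cons, not_or] at hr
    rw [unpack, ih hr.2, Function.update_of_ne hr.1]

theorem unpack_lt [DecidableEq R] (hB : 0 < B) {rs : List R} (hrs : rs.Nodup) {r : R} (hr : r ∈ rs) (c : R → ℕ)
    (u : ℕ) : unpack B rs c u r < B := by
  induction rs generalizing c u with
  | nil => simp at hr
  | cons r' rs ih =>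
    rw [List.nodup_cons] at hrs
    rw [unpack]
    rcases List.mem_cons.1 hr with rfl | hr
    · rw [unpack_of_notMem hrs.1, Function.update_self]
      exact Nat.mod_lt _ hB
    · exact ih hrs.2 hr _ _

theorem unpack_pack [DecidableEq R] {c : R → ℕ} {rs : List R} (hrs : rs.Nodup) (hc : ∀ r ∈ rs, c r < B) {r : R}
    (hr : r ∈ rs) (c₀ : R → ℕ) : unpack B rs c₀ (pack B c rs) r = c r := by
  induction rs generalizing c₀ with
  | nil => simp at hr
  | cons r' rs ih =>
    rw [List.nodup_cons] at hrs
    have hr' := hc r' (by simp)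
    rw [unpack, pack, Nat.add_mul_mod_self_left, Nat.mod_eq_of_lt hr',
      Nat.add_mul_div_left _ _ (by omega), Nat.div_eq_of_lt hr', zero_add]
    rcases List.mem_cons.1 hr with rfl | hr
    · rw [unpack_of_notMem hrs.1, Function.update_self]
    · exact ih hrs.2 (fun r hr => hc r (by simp [hr])) hr _

theorem pack_lt {c : R → ℕ} {rs : List R} (hc : ∀ r ∈ rs, c r < B) :
    pack B c rs < B ^ rs.length := by
  induction rs with
  | nil => simp [pack]
  | cons r rs ih =>
    have h1 := hc r (by simp)
    have h2 := ih fun r hr => hc r (by simp [hr])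
    calc c r + B * pack B c rs < B * (pack B c rs + 1) := by rw [mul_add]; omega
      _ ≤ B * B ^ rs.length := Nat.mul_le_mul_left _ h2
      _ = B ^ (rs.length + 1) := by ring

/-- A crude bound for coordinates that are not digits: a transition may be tried on a number that
codes no reachable configuration, and the resulting coordinates may exceed the base. -/
theorem pack_le {c : R → ℕ} {rs : List R} {e : ℕ} (hB : 2 ≤ B) (hc : ∀ r, c r ≤ B ^ e) :
    pack B c rs ≤ B ^ (2 * rs.length + e) := by
  induction rs with
  | nil => simp [pack]
  | cons r rs ih =>
    have h1 : B ^ e ≤ B ^ (2 * rs.length + e + 1) := Nat.pow_le_pow_right (by omega) (by omega)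
    calc c r + B * pack B c rs ≤ B ^ (2 * rs.length + e + 1) + B * B ^ (2 * rs.length + e) :=
          add_le_add ((hc r).trans h1) (Nat.mul_le_mul_left _ ih)
      _ = 2 * B ^ (2 * rs.length + e + 1) := by ring
      _ ≤ B * B ^ (2 * rs.length + e + 1) := Nat.mul_le_mul_right _ hB
      _ = B ^ (2 * (rs.length + 1) + e) := by ring

theorem unpack_congr [DecidableEq R] {rs : List R} {r : R} (hr : r ∈ rs) (c c' : R → ℕ) (u : ℕ) :
    unpack B rs c u r = unpack B rs c' u r := by
  induction rs generalizing c c' u with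
  | nil => simp at hr
  | cons r' rs ih =>
    rw [unpack, unpack]
    by_cases h : r ∈ rs
    · exact ih h _ _ _
    · obtain rfl : r = r' := by simpa [h] using hr
      simp [unpack_of_notMem h]

end Pack

/-! ### Transitions -/

instance : Finite InputSymbol := by
  refine Finite.of_injective (β := Option (Option Bool)) (fun s => match s with
    | .leftEnd => none | .rightEnd => some none | .bit b => some (some b)) fun a b h => ?_
  cases a <;> cases b <;> simp_all

instance : Finite HeadMove := by
  refine Finite.of_injective (β := Option Bool) (fun s => match s with
    | .left => none | .stay => some true | .right => some false) fun a b h => ?_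
  cases a <;> cases b <;> simp_all

instance {k : ℕ} {Γ S : Type} [Finite Γ] [Finite S] : Finite (TMAction k Γ S) := by
  refine Finite.of_injective (β := S × HeadMove × (Fin k → Γ) × (Fin k → HeadMove) × Option Bool)
    (fun a => (a.next, a.inMove, a.write, a.workMove, a.out)) fun a b h => ?_
  cases a; cases b; simp_all

/-- A situation in which an action is possible, and the action. -/
structure Transition (M : TM) where
  state : M.State
  sym : InputSymbol
  read : Fin M.k → M.Γ
  action : TMAction M.k M.Γ M.State
  mem : action ∈ M.trans state sym read

instance (M : TM) : Finite (Transition M) := by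
  have := M.finite_Γ
  have := M.finite_State
  refine Finite.of_injective (β := M.State × InputSymbol × (Fin M.k → M.Γ) ×
    TMAction M.k M.Γ M.State) (fun a => (a.state, a.sym, a.read, a.action)) fun a b h => ?_
  cases a; cases b; simp_all

/-- The list of all transitions. -/
noncomputable def transitions (M : TM) : List (Transition M) :=
  (Set.finite_univ (α := Transition M)).toFinset.toList

theorem mem_transitions {M : TM} (τ : Transition M) : τ ∈ transitions M := by
  simp [transitions]

/-- Numbers for the states of a machine. -/
noncomputable def stateIndex (M : TM) (q : M.State) : ℕ :=
  have := M.finite_State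
  (Finite.equivFin M.State q).1

theorem stateIndex_injective (M : TM) : Function.Injective (stateIndex M) := by
  have := M.finite_State
  intro a b h
  exact (Finite.equivFin M.State).injective (Fin.ext h)

theorem stateIndex_lt (M : TM) (q : M.State) : stateIndex M q < Nat.card M.State := by
  have := M.finite_State
  exact (Finite.equivFin M.State q).2

open Classical in
/-- Numbers for the symbols of a machine; the blank has the number `0`. -/
noncomputable def symIndex (M : TM) (γ : M.Γ) : ℕ :=
  have := M.finite_Γ
  if γ = M.blank then 0 else (Finite.equivFin M.Γ γ).1 + 1

/-- The base in which tapes are encoded. -/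
noncomputable def radixOf (M : TM) : ℕ := Nat.card M.Γ + 1

theorem two_le_radixOf (M : TM) : 2 ≤ radixOf M := by
  have := M.finite_Γ
  have : Nonempty M.Γ := ⟨M.blank⟩
  have : 0 < Nat.card M.Γ := Nat.card_pos
  simp only [radixOf]
  omega

/-- Thanks to this, blank cells contribute nothing, and the initial right code is zero for every
length of the window. -/
theorem symIndex_blank (M : TM) : symIndex M M.blank = 0 := by simp [symIndex]

theorem symIndex_lt (M : TM) (γ : M.Γ) : symIndex M γ < radixOf M := by
  have := M.finite_Γ
  simp only [symIndex, radixOf]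
  split_ifs
  · omega
  · exact Nat.succ_lt_succ (Finite.equivFin M.Γ γ).2

theorem symIndex_injective (M : TM) : Function.Injective (symIndex M) := by
  have := M.finite_Γ
  intro a b h
  simp only [symIndex] at h
  split_ifs at h with h1 h2 h2
  · rw [h1, h2]
  · exact (Finite.equivFin M.Γ).injective (Fin.ext (by omega))

variable {M : TM}

/-- The code of a configuration whose heads are at positions up to `L`. -/
noncomputable def encode (L : ℕ) (c : TMConfig M) : CReg M.k → ℕ
  | .st => stateIndex M c.state
  | .ip => c.inPos
  | .left i => leftCode (radixOf M) (fun j => symIndex M (c.tape i j)) (c.head i)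
  | .right i => rightCode (radixOf M) (fun j => symIndex M (c.tape i j)) (c.head i)
    (L + 1 - c.head i)

/-- One tape in a step. -/
noncomputable def stepTape (τ : Transition M) (i : Fin M.k) (c : CReg M.k → ℕ) : CReg M.k → ℕ :=
  let p := pushTape (radixOf M) (symIndex M (τ.action.write i)) (τ.action.workMove i)
    (c (.left i)) (c (.right i) / radixOf M)
  Function.update (Function.update c (.left i) p.1) (.right i) p.2

/-- Some tapes in a step, provided that the symbols that are read are correct. -/
noncomputable def stepTapes (τ : Transition M) :
    List (Fin M.k) → (CReg M.k → ℕ) → Option (CReg M.k → ℕ)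
  | [], c => some c
  | i :: is, c => if c (.right i) % radixOf M = symIndex M (τ.read i) then
      stepTapes τ is (stepTape τ i c) else none

open Classical in
/-- A step on codes. -/
noncomputable def stepCode (x : List Bool) (τ : Transition M) (c : CReg M.k → ℕ) :
    Option (CReg M.k → ℕ) :=
  if c .st = stateIndex M τ.state then
    if TM.readInput x (c .ip) = τ.sym then
      (stepTapes τ (List.finRange M.k) c).map fun c' =>
        Function.update (Function.update c' .st (stateIndex M τ.action.next)) .ip
          (min (TM.moveHead τ.action.inMove (c .ip)) (x.length + 1))
    else none
  else none

theorem stepTape_right (τ : Transition M) {i j : Fin M.k} (hij : i ≠ j) (c : CReg M.k → ℕ) :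
    stepTape τ i c (.right j) = c (.right j) := by
  simp [stepTape, hij.symm]

/-- The tapes are tested and changed one after the other. As each change touches only the two
coordinates of its own tape, this amounts to testing and changing all of them simultaneously. -/
theorem stepTapes_eq_some (τ : Transition M) {is : List (Fin M.k)} (his : is.Nodup)
    {c c' : CReg M.k → ℕ} :
    stepTapes τ is c = some c' ↔
      (∀ i ∈ is, c (.right i) % radixOf M = symIndex M (τ.read i)) ∧
      c' = fun r => match r with
        | .left i => if i ∈ is then stepTape τ i c (.left i) else c (.left i)
        | .right i => if i ∈ is then stepTape τ i c (.right i) else c (.right i)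
        | r => c r := by
  induction is generalizing c with
  | nil =>
    simp only [stepTapes, Option.some.injEq, List.not_mem_nil, false_imp_iff, implies_true,
      if_false, true_and, eq_comm (a := c)]
    refine Eq.congr rfl ?_
    funext r
    cases r <;> rfl
  | cons i is ih =>
    rw [List.nodup_cons] at his
    have hne : ∀ j ∈ is, i ≠ j := fun j hj h => his.1 (h ▸ hj)
    simp only [stepTapes, List.mem_cons, forall_eq_or_imp]
    split_ifs with h
    · rw [ih his.2]
      simp only [h, true_and]
      refine and_congr (forall₂_congr fun j hj => ?_) (Eq.congr rfl ?_)
      · rw [stepTape_right τ (hne j hj)]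
      · funext r
        cases r with
        | st => simp [stepTape]
        | ip => simp [stepTape]
        | left j =>
          by_cases hj : j ∈ is
          · simp [hj, stepTape, Ne.symm (hne j hj)]
          · by_cases hji : j = i
            · subst hji; simp [hj]
            · simp [hj, hji, stepTape]
        | right j =>
          by_cases hj : j ∈ is
          · simp [hj, stepTape, Ne.symm (hne j hj)]
          · by_cases hji : j = i
            · subst hji; simp [hj]
            · simp [hj, hji, stepTape]
    · simp [h]

theorem stepTape_encode {L : ℕ} {x : List Bool} {c : TMConfig M} (τ : Transition M) (i : Fin M.k)
    (hL : c.head i ≤ L) (hL' : (M.act x c τ.action).head i ≤ L) :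
    stepTape τ i (encode L c) (.left i) = encode L (M.act x c τ.action) (.left i) ∧
    stepTape τ i (encode L c) (.right i) = encode L (M.act x c τ.action) (.right i) := by
  have hdiv := rightCode_div (g := radixOf M) (t := fun j => symIndex M (c.tape i j)) hL
    (symIndex_lt M _)
  have hpush := pushTape_eq (two_le_radixOf M) (t := fun j => symIndex M (c.tape i j))
    (fun j => symIndex_lt M _) (w := symIndex M (τ.action.write i)) (τ.action.workMove i) hL hL'
  have hupd : (fun j => symIndex M ((M.act x c τ.action).tape i j)) =
      Function.update (fun j => symIndex M (c.tape i j)) (c.head i)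
        (symIndex M (τ.action.write i)) := by
    funext j
    by_cases hj : j = c.head i
    · subst hj; simp [TM.act]
    · simp [TM.act, hj]
  simp only [stepTape, encode, hdiv, hpush, hupd]
  constructor
  · simp [TM.act]
  · simp [TM.act]

/-- The step on codes is correct. -/
theorem stepCode_encode {L : ℕ} {x : List Bool} {c : TMConfig M} (τ : Transition M)
    (hL : ∀ i, c.head i ≤ L) (hL' : τ.action ∈ M.possible x c →
      ∀ i, (M.act x c τ.action).head i ≤ L) {d : CReg M.k → ℕ} :
    stepCode x τ (encode L c) = some d ↔
      c.state = τ.state ∧ TM.readInput x c.inPos = τ.sym ∧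
        (∀ i, c.tape i (c.head i) = τ.read i) ∧ d = encode L (M.act x c τ.action) := by
  simp only [stepCode]
  have h1 : encode L c .st = stateIndex M τ.state ↔ c.state = τ.state :=
    (stateIndex_injective M).eq_iff
  have h2 : ∀ i, encode L c (.right i) % radixOf M = symIndex M (c.tape i (c.head i)) :=
    fun i => rightCode_mod (t := fun j => symIndex M (c.tape i j)) (hL i) (symIndex_lt M _)
  split_ifs with hs hi
  all_goals rw [h1] at hs
  · simp only [Option.map_eq_some_iff, stepTapes_eq_some τ (List.nodup_finRange _),
      List.mem_finRange, true_imp_iff, h2, (symIndex_injective M).eq_iff, if_true]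
    have hi' : TM.readInput x c.inPos = τ.sym := hi
    simp only [hs, hi', true_and]
    constructor
    · rintro ⟨_, ⟨hr, rfl⟩, rfl⟩
      -- Only for a possible action are the heads known to stay in the window after the step.
      have hposs : τ.action ∈ M.possible x c := by
        simp only [TM.possible, hs, hi', hr]
        exact τ.mem
      refine ⟨hr, ?_⟩
      funext r
      cases r with
      | st => simp [encode, TM.act]
      | ip => simp [encode, TM.act]
      | left i => simpa using (stepTape_encode τ i (hL i) (hL' hposs i)).1
      | right i => simpa using (stepTape_encode τ i (hL i) (hL' hposs i)).2
    · rintro ⟨hr, rfl⟩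
      have hposs : τ.action ∈ M.possible x c := by
        simp only [TM.possible, hs, hi', hr]
        exact τ.mem
      refine ⟨_, ⟨hr, rfl⟩, ?_⟩
      funext r
      cases r with
      | st => simp [encode, TM.act]
      | ip => simp [encode, TM.act]
      | left i => simpa using (stepTape_encode τ i (hL i) (hL' hposs i)).1
      | right i => simpa using (stepTape_encode τ i (hL i) (hL' hposs i)).2
  · have : ¬ TM.readInput x c.inPos = τ.sym := hi
    simp [this]
  · simp [hs]

end ConfigCode

/-! ## Programs that work on codes of configurations -/

namespace Cmd

open Prog PrintReg ConfigCode

/-- Auxiliary counters: the length of the input plus one, the bases of the encodings of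
configurations and of tapes, and scratch. -/
inductive CodeAux where
  | len
  | base
  | radix
  | quot
  | low
  | high
  | tmp
  deriving DecidableEq

instance : Finite CodeAux :=
  Set.finite_univ_iff.1 ((Set.toFinite {.len, .base, .radix, .quot, .low, .high, .tmp}).subset
    fun r _ => by cases r <;> simp)

open CodeAux

/-- The counters of the programs that work on codes of configurations. -/
abbrev CodeReg (k : ℕ) : Type := PrintReg ⊕ (CReg k ⊕ CodeAux)

section Generic

variable {ι : Type}

/-- `r_d := r_b ^ n` -/
def powTo (d b t : ι) : ℕ → Cmd ι
  | 0 => const d 1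
  | n + 1 => powTo d b t n ;; mov t d ;; zero (.inl d) ;; mulAdd d b t

theorem det_powTo (d b t : ι) (n : ℕ) : (powTo d b t n).Det := by
  induction n with
  | zero => exact det_const _ _
  | succ n ih => exact ⟨ih, det_mov _ _, trivial, det_mulAdd _ _ _⟩

/-- Execute the program with the number `r_s`, which is destroyed. -/
def select (s : ι) (d : Cmd ι) : List (Cmd ι) → Cmd ι
  | [] => d
  | p :: ps => .ifDec (.inl s) (select s d ps) p

theorem det_select (s : ι) {d : Cmd ι} (hd : d.Det) {ps : List (Cmd ι)} (hps : ∀ p ∈ ps, p.Det) :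
    (select s d ps).Det := by
  induction ps with
  | nil => exact hd
  | cons p ps ih => exact ⟨ih fun p hp => hps p (by simp [hp]), hps p (by simp)⟩

/-- Is `r_a = c`? -/
def ifEqConst (t a : ι) (c : ℕ) (p q : Cmd ι) : Cmd ι :=
  const t c ;; ifLt a t q (ifLt t a q p)

theorem det_ifEqConst (t a : ι) (c : ℕ) {p q : Cmd ι} (hp : p.Det) (hq : q.Det) :
    (ifEqConst t a c p q).Det :=
  ⟨det_const _ _, det_ifLt _ _ hq (det_ifLt _ _ hq hp)⟩

variable [DecidableEq ι] {x : List Bool} {B : ℕ} {P : Prop} {v : ι → ℕ} {o : List Bool}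
  {Q : (ι → ℕ) → List Bool → Prop}

theorem Hp.ifDec {i : ι} {p q : Cmd ι} (h1 : v i ≠ 0 → Hp x B P p (Function.update v i (v i - 1)) o Q)
    (h0 : v i = 0 → Hp x B P q v o Q) : Hp x B P (.ifDec (.inl i) p q) v o Q := by
  refine fun pos => Wp.ifDec (fun h => h0 h pos) fun h => ?_
  have := h1 h pos
  simpa only [lift, full_inl, update_full] using this

theorem Hp.powTo {d b t : ι} (hdb : d ≠ b) (hdt : d ≠ t) (hbt : b ≠ t) {n : ℕ} (hb : 0 < v b)
    (hB : v b ^ n ≤ B) (h : ∀ c, Q (Function.update (Function.update v t c) d (v b ^ n)) o) :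
    Hp x B P (powTo d b t n) v o Q := by
  induction n generalizing Q with
  | zero =>
    refine Hp.const (by simpa using hB) ?_
    have := h (v t)
    simpa using this
  | succ n ih =>
    refine Hp.seq (ih ((Nat.pow_le_pow_right hb (by omega)).trans hB) fun c => ?_)
    refine Hp.seq (Hp.mov hdt.symm (Hp.seq (Hp.clr (Hp.mulAdd hdb hdt ?_ ?_))))
    · simp [hdb.symm, hdt.symm, hbt]
      rwa [← pow_succ']
    · convert h (v b ^ n) using 1
      funext r
      by_cases h1 : r = d
      · subst h1; simp [hdb.symm, hdt.symm, hbt, pow_succ']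
      · by_cases h2 : r = t
        · subst h2; simp [h1]
        · simp [h1, h2]

theorem Hp.select {s : ι} {d : Cmd ι} {ps : List (Cmd ι)}
    (hd : ps.length ≤ v s → Hp x B P d (Function.update v s (v s - ps.length)) o Q)
    (h : ∀ p, ps[v s]? = some p → Hp x B P p (Function.update v s 0) o Q) :
    Hp x B P (select s d ps) v o Q := by
  induction ps generalizing v with
  | nil => simpa [Cmd.select] using hd (by simp)
  | cons p ps ih =>
    refine Hp.ifDec (fun hs => ih (fun hl => ?_) fun p' hp' => ?_) fun hs => ?_
    · simp only [Function.update_self] at hl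
      have := hd (by simp; omega)
      simpa [Nat.sub_sub, add_comm 1] using this
    · simp only [Function.update_self] at hp'
      have := h p' (by
        rw [show v s = (v s - 1) + 1 by omega]
        simpa using hp')
      simpa using this
    · have := h p (by simp [hs])
      rwa [← hs, Function.update_eq_self] at this

theorem Hp.ifEqConst {t a : ι} (hta : t ≠ a) {c : ℕ} {p q : Cmd ι} (hc : c ≤ B)
    (hp : v a = c → Hp x B P p (Function.update v t c) o Q)
    (hq : v a ≠ c → Hp x B P q (Function.update v t c) o Q) :
    Hp x B P (ifEqConst t a c p q) v o Q := by
  refine Hp.seq (Hp.const hc (Hp.ifLt (fun h => hq ?_) fun h => Hp.ifLt (fun h' => hq ?_)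
    fun h' => hp ?_))
  all_goals simp [hta.symm] at *; omega

end Generic

variable {k : ℕ}

/-- Write the given numbers to coordinates. -/
def setCoords (c : CReg k → ℕ) : List (CReg k) → Cmd (CodeReg k)
  | [] => .skip
  | r :: rs => setCoords c rs ;; const (.inr (.inl r)) (c r)

/-- Compute the coordinates of the number in the counter `quot`. -/
def unpackCoords : List (CReg k) → Cmd (CodeReg k)
  | [] => .skip
  | r :: rs => mov (.inr (.inl r)) (.inr (.inr quot)) ;;
    divMod (.inr (.inl r)) (.inr (.inr quot)) (.inr (.inr base)) ;; unpackCoords rs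

/-- Compute the number with the given coordinates. -/
def packCoords : List (CReg k) → Cmd (CodeReg k)
  | [] => zero (.inl (.inl result))
  | r :: rs => packCoords rs ;; mov (.inr (.inr tmp)) (.inl result) ;;
    mov (.inl result) (.inr (.inl r)) ;;
    mulAdd (.inl result) (.inr (.inr base)) (.inr (.inr tmp))

/-- Given the digit to be written and the number `quot`, execute one step for the tape `i`. -/
def pushCoords (i : Fin k) (w : ℕ) : HeadMove → Cmd (CodeReg k)
  | .stay => const (.inr (.inl (.right i))) w ;;
    mulAdd (.inr (.inl (.right i))) (.inr (.inr radix)) (.inr (.inr quot))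
  | .right => mov (.inr (.inl (.right i))) (.inr (.inr quot)) ;;
    mov (.inr (.inr tmp)) (.inr (.inl (.left i))) ;; const (.inr (.inl (.left i))) w ;;
    mulAdd (.inr (.inl (.left i))) (.inr (.inr radix)) (.inr (.inr tmp))
  | .left => const (.inr (.inl (.right i))) w ;;
    mulAdd (.inr (.inl (.right i))) (.inr (.inr radix)) (.inr (.inr quot)) ;;
    mov (.inr (.inr low)) (.inr (.inl (.left i))) ;;
    divMod (.inr (.inr low)) (.inr (.inr high)) (.inr (.inr radix)) ;;
    ifPos (.inr (.inr high)) (mov (.inr (.inl (.left i))) (.inr (.inr high)) ;;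
      mov (.inr (.inr quot)) (.inr (.inl (.right i))) ;;
      mov (.inr (.inl (.right i))) (.inr (.inr low)) ;;
      mulAdd (.inr (.inl (.right i))) (.inr (.inr radix)) (.inr (.inr quot))) .skip

/-- Move the input head. -/
def moveInput (mv : HeadMove) : Cmd (CodeReg k) :=
  (match mv with
    | .stay => .skip
    | .right => incr (.inr (.inl .ip))
    | .left => .ifDec (.inl (.inr (.inl .ip))) .skip .skip) ;;
  ifLt (.inr (.inr len)) (.inr (.inl .ip)) (mov (.inr (.inl .ip)) (.inr (.inr len))) .skip

theorem det_setCoords (c : CReg k → ℕ) (rs : List (CReg k)) : (setCoords c rs).Det := by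
  induction rs with
  | nil => trivial
  | cons r rs ih => exact ⟨ih, det_const _ _⟩

theorem det_unpackCoords (rs : List (CReg k)) : (unpackCoords rs).Det := by
  induction rs with
  | nil => trivial
  | cons r rs ih => exact ⟨det_mov _ _, det_divMod _ _ _, ih⟩

theorem det_packCoords (rs : List (CReg k)) : (packCoords rs).Det := by
  induction rs with
  | nil => trivial
  | cons r rs ih => exact ⟨ih, det_mov _ _, det_mov _ _, det_mulAdd _ _ _⟩

theorem det_pushCoords (i : Fin k) (w : ℕ) (mv : HeadMove) : (pushCoords i w mv).Det := by
  cases mv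
  · exact ⟨det_const _ _, det_mulAdd _ _ _, det_mov _ _, det_divMod _ _ _,
      det_ifPos _ ⟨det_mov _ _, det_mov _ _, det_mov _ _, det_mulAdd _ _ _⟩ trivial⟩
  · exact ⟨det_const _ _, det_mulAdd _ _ _⟩
  · exact ⟨det_mov _ _, det_mov _ _, det_const _ _, det_mulAdd _ _ _⟩

theorem det_moveInput (mv : HeadMove) : (moveInput (k := k) mv).Det := by
  refine ⟨?_, det_ifLt _ _ (det_mov _ _) trivial⟩
  cases mv
  · exact ⟨trivial, trivial⟩
  · trivial
  · trivial

/-- The counters that the programs must not change are the same. -/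
structure SameFrame (v v' : CodeReg k → ℕ) : Prop where
  print : ∀ r, r ≠ result → v' (.inl r) = v (.inl r)
  len : v' (.inr (.inr len)) = v (.inr (.inr len))
  base : v' (.inr (.inr base)) = v (.inr (.inr base))
  radix : v' (.inr (.inr radix)) = v (.inr (.inr radix))

theorem SameFrame.refl (v : CodeReg k → ℕ) : SameFrame v v := ⟨fun _ _ => rfl, rfl, rfl, rfl⟩

theorem SameFrame.trans {v v' v'' : CodeReg k → ℕ} (h : SameFrame v v') (h' : SameFrame v' v'') :
    SameFrame v v'' :=
  ⟨fun r hr => (h'.print r hr).trans (h.print r hr), h'.len.trans h.len, h'.base.trans h.base,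
    h'.radix.trans h.radix⟩

variable {x : List Bool} {W : ℕ} {P : Prop} {v : CodeReg k → ℕ} {o : List Bool}
  {Q : (CodeReg k → ℕ) → List Bool → Prop}

theorem Hp.setCoords {c : CReg k → ℕ} {rs : List (CReg k)} (hc : ∀ r, c r ≤ W)
    (h : ∀ v', (∀ r ∈ rs, v' (.inr (.inl r)) = c r) → (∀ r, v' (.inl r) = v (.inl r)) →
      (∀ r, v' (.inr (.inr r)) = v (.inr (.inr r))) → Q v' o) :
    Hp x W P (setCoords c rs) v o Q := by
  induction rs generalizing Q with
  | nil => exact Hp.skip (h v (by simp) (fun _ => rfl) fun _ => rfl)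
  | cons r rs ih =>
    refine Hp.seq (ih fun v' h1 h2 h3 => Hp.const (hc r) (h _ ?_ ?_ ?_))
    · intro r' hr'
      by_cases hrr : r' = r
      · subst hrr; simp
      · simp [hrr]
        exact h1 _ (by simpa [hrr] using hr')
    · simp [h2]
    · simp [h3]

theorem Hp.unpackCoords {B : ℕ} (hB : 0 < B) {rs : List (CReg k)} (hbase : v (.inr (.inr base)) = B)
    (h : ∀ v', (∀ r, v' (.inr (.inl r)) =
      unpack B rs (fun r => v (.inr (.inl r))) (v (.inr (.inr quot))) r) →
      SameFrame v v' → Q v' o) :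
    Hp x W P (unpackCoords rs) v o Q := by
  induction rs generalizing v with
  | nil => exact Hp.skip (h v (fun _ => rfl) (.refl v))
  | cons r rs ih =>
    refine Hp.seq (Hp.mov (by simp) (Hp.seq (Hp.divMod (by simp) (by simp) (by simp)
      (by simpa [hbase]) (ih (by simpa) fun v' h1 h2 => h v' (fun r' => ?_) ?_))))
    · rw [h1, unpack]
      congr 1
      · funext r''
        by_cases hr : r'' = r
        · subst hr; simp [hbase]
        · simp [hr]
      · simp [hbase]
    · refine SameFrame.trans ⟨?_, ?_, ?_, ?_⟩ h2 <;> simp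

theorem Hp.packCoords {B : ℕ} (hB : 0 < B) {rs : List (CReg k)} (hbase : v (.inr (.inr base)) = B)
    (hW : pack B (fun r => v (.inr (.inl r))) rs ≤ W)
    (h : ∀ v', v' (.inl result) = pack B (fun r => v (.inr (.inl r))) rs →
      (∀ r, v' (.inr (.inl r)) = v (.inr (.inl r))) → SameFrame v v' → Q v' o) :
    Hp x W P (packCoords rs) v o Q := by
  induction rs generalizing Q with
  | nil =>
    refine Hp.clr (h _ (by simp [pack]) (by simp) ⟨?_, ?_, ?_, ?_⟩)
    · intro r hr; simp [hr]
    all_goals simp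
  | cons r rs ih =>
    rw [pack] at hW
    have hle := Nat.le_mul_of_pos_left (pack B (fun r => v (.inr (.inl r))) rs) hB
    refine Hp.seq (ih (by omega) fun v' h1 h2 h3 => ?_)
    refine Hp.seq (Hp.mov (by simp) (Hp.seq (Hp.mov (by simp) (Hp.mulAdd (by simp) (by simp) ?_
      (h _ ?_ ?_ (h3.trans ⟨?_, ?_, ?_, ?_⟩))))))
    · simpa [h3.base, h1, h2, hbase] using hW
    · simp [h3.base, h1, h2, hbase, pack]
    · simp [h2]
    · intro r hr; simp [hr]
    all_goals simp

theorem Hp.moveInput {mv : HeadMove} (hW : v (.inr (.inl .ip)) + 1 ≤ W)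
    (h : Q (Function.update v (.inr (.inl .ip))
      (min (TM.moveHead mv (v (.inr (.inl .ip)))) (v (.inr (.inr len))))) o) :
    Hp x W P (moveInput mv) v o Q := by
  have key : Hp x W P (Cmd.ifLt (.inr (.inr len)) (.inr (.inl .ip))
      (Cmd.mov (.inr (.inl .ip)) (.inr (.inr len))) .skip)
      (Function.update v (.inr (.inl .ip)) (TM.moveHead mv (v (.inr (.inl .ip))))) o Q := by
    refine Hp.ifLt (fun hl => Hp.mov (by simp) ?_) fun hl => Hp.skip ?_
    · simp at hl ⊢
      rwa [min_eq_right (by omega)] at h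
    · simp at hl
      rwa [min_eq_left (by omega)] at h
  cases mv with
  | stay => exact Hp.seq (Hp.skip (by simpa [TM.moveHead] using key))
  | right => exact Hp.seq (Hp.incr hW key)
  | left =>
    refine Hp.seq (Hp.ifDec (fun h0 => Hp.skip key) fun h0 => Hp.skip ?_)
    have hv := Function.update_eq_self (Sum.inr (Sum.inl CReg.ip)) v
    rw [h0] at hv
    simpa [TM.moveHead, h0, hv] using key

/-- The bound `g + g * (w + g * m)` comes from a move to the left, where a digit from the left is
put in front of `w + g * r`. -/
theorem Hp.pushCoords {i : Fin k} {w g m : ℕ} {mv : HeadMove} (hg : 0 < g)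
    (hradix : v (.inr (.inr radix)) = g) (hl : v (.inr (.inl (.left i))) ≤ m)
    (hr : v (.inr (.inr quot)) ≤ m) (hW : g + g * (w + g * m) ≤ W)
    (h : ∀ v', (∀ r, v' (.inr (.inl r)) =
      Function.update (Function.update (fun r => v (.inr (.inl r))) (.left i)
        (pushTape g w mv (v (.inr (.inl (.left i)))) (v (.inr (.inr quot)))).1) (.right i)
        (pushTape g w mv (v (.inr (.inl (.left i)))) (v (.inr (.inr quot)))).2 r) →
      SameFrame v v' → Q v' o) :
    Hp x W P (pushCoords i w mv) v o Q := by
  have h1 : g * v (.inr (.inl (.left i))) ≤ g * m := Nat.mul_le_mul_left _ hl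
  have h2 : g * v (.inr (.inr quot)) ≤ g * m := Nat.mul_le_mul_left _ hr
  have h3 : w + g * m ≤ g * (w + g * m) := Nat.le_mul_of_pos_left _ hg
  have h4 : g * (w + g * v (.inr (.inr quot))) ≤ g * (w + g * m) :=
    Nat.mul_le_mul_left _ (by omega)
  cases mv with
  | stay =>
    refine Hp.seq (Hp.const (by omega) (Hp.mulAdd (by simp) (by simp) ?_ (h _ ?_ ⟨?_, ?_, ?_, ?_⟩)))
    · simp [hradix]; omega
    · intro r
      by_cases hr : r = .right i
      · subst hr; simp [hradix, pushTape]
      · by_cases hr' : r = .left i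
        · subst hr'; simp [pushTape]
        · simp [hr, hr']
    all_goals simp
  | right =>
    refine Hp.seq (Hp.mov (by simp) (Hp.seq (Hp.mov (by simp) (Hp.seq (Hp.const (by omega)
      (Hp.mulAdd (by simp) (by simp) ?_ (h _ ?_ ⟨?_, ?_, ?_, ?_⟩)))))))
    · simp [hradix]; omega
    · intro r
      by_cases hr : r = .right i
      · subst hr; simp [pushTape]
      · by_cases hr' : r = .left i
        · subst hr'; simp [pushTape, hradix]
        · simp [hr, hr']
    all_goals simp
  | left =>
    refine Hp.seq (Hp.const (by omega) ?_)
    refine Hp.seq (Hp.mulAdd (by simp) (by simp) (by simp [hradix]; omega) ?_)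
    refine Hp.seq (Hp.mov (by simp) ?_)
    refine Hp.seq (Hp.divMod (by simp) (by simp) (by simp) (by simp [hradix, hg]) ?_)
    have hmod := Nat.mod_lt (v (.inr (.inl (.left i)))) hg
    refine Hp.ifPos (fun h0 => ?_) fun h0 => Hp.skip (h _ ?_ ⟨?_, ?_, ?_, ?_⟩)
    · refine Hp.seq (Hp.mov (by simp) ?_)
      refine Hp.seq (Hp.mov (by simp) ?_)
      refine Hp.seq (Hp.mov (by simp) ?_)
      refine Hp.mulAdd (by simp) (by simp) (by simp [hradix]; omega) (h _ ?_ ⟨?_, ?_, ?_, ?_⟩)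
      · intro r
        simp [hradix] at h0
        by_cases hr : r = .right i
        · subst hr; simp [hradix, pushTape, h0, h0.2.not_gt]
        · by_cases hr' : r = .left i
          · subst hr'; simp [pushTape, hradix, h0, h0.2.not_gt]
          · simp [hr, hr']
      all_goals simp
    · intro r
      simp [hradix] at h0
      by_cases hr : r = .right i
      · subst hr; simp [hradix, pushTape, h0]
      · by_cases hr' : r = .left i
        · subst hr'; simp [pushTape, h0]
        · simp [hr, hr']
    all_goals simp

end Cmd

/-! ## Hardness -/

namespace Cmd

open Prog PrintReg ConfigCode CodeAux

section Simulation

variable (M : TM)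

/-- Give up: there is no transition. -/
def noTransition {k : ℕ} : Cmd (CodeReg k) := mov (.inl result) (.inl states)

variable {M} in
/-- Check the symbols read on the given tapes and change these tapes; then `p`. -/
noncomputable def tapesProg (τ : Transition M) (p : Cmd (CodeReg M.k)) :
    List (Fin M.k) → Cmd (CodeReg M.k)
  | [] => p
  | i :: is => divMod (.inr (.inl (.right i))) (.inr (.inr quot)) (.inr (.inr radix)) ;;
    ifEqConst (.inr (.inr tmp)) (.inr (.inl (.right i))) (symIndex M (τ.read i))
      (pushCoords i (symIndex M (τ.action.write i)) (τ.action.workMove i) ;; tapesProg τ p is)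
      noTransition

variable {M} in
/-- After the tapes have been changed, change the state and the input position and compute the
new code. -/
noncomputable def finishProg (τ : Transition M) : Cmd (CodeReg M.k) :=
  const (.inr (.inl .st)) (stateIndex M τ.action.next) ;; moveInput τ.action.inMove ;;
  packCoords (cregs M.k)

variable {M} in
open Classical in
/-- Execute a transition on a code. -/
noncomputable def transitionProg (τ : Transition M) : Cmd (CodeReg M.k) :=
  ifEqConst (.inr (.inr tmp)) (.inr (.inl .st)) (stateIndex M τ.state)
    (ifSym (.inr (.inl .ip)) (fun s => decide (s = τ.sym))
      (tapesProg τ (finishProg τ) (List.finRange M.k)) noTransition) noTransition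

/-- Execute the transition in the counter `letter` on the code in the counter `state`. -/
noncomputable def codeStep : Cmd (CodeReg M.k) :=
  mov (.inr (.inr quot)) (.inl state) ;; unpackCoords (cregs M.k) ;;
  mov (.inr (.inr high)) (.inl letter) ;;
  select (.inr (.inr high)) noTransition ((transitions M).map transitionProg)

/-- The code of the initial configuration. -/
noncomputable def initCode : CReg M.k → ℕ
  | .st => stateIndex M M.start
  | .ip => 0
  | .left _ => 1
  | .right _ => 0

/-- Compute the constants. -/
noncomputable def codeInit (D : ℕ) : Cmd (CodeReg M.k) :=
  addLength (.inl (.inr (.inr len))) ;; incr (.inr (.inr len)) ;;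
  mov (.inr (.inr tmp)) (.inr (.inr len)) ;; incr (.inr (.inr tmp)) ;;
  powTo (.inr (.inr base)) (.inr (.inr tmp)) (.inr (.inr quot)) D ;;
  powTo (.inl states) (.inr (.inr base)) (.inr (.inr quot)) (cregs M.k).length ;;
  const (.inr (.inr radix)) (radixOf M) ;; const (.inl letters) (transitions M).length ;;
  setCoords (initCode M) (cregs M.k) ;; packCoords (cregs M.k) ;;
  mov (.inl start) (.inl result)

open Classical in
/-- Is it the number of an accepting state? -/
noncomputable def acceptingIndex (i : ℕ) : Bool := decide (∃ q ∈ M.accepting, stateIndex M q = i)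

/-- Is the code in the counter `state` accepting? -/
noncomputable def codeMem : Cmd (CodeReg M.k) :=
  mov (.inr (.inr tmp)) (.inl state) ;;
  divMod (.inr (.inr tmp)) (.inr (.inr quot)) (.inr (.inr base)) ;;
  select (.inr (.inr tmp)) (const (.inl result) 0) ((List.range (Nat.card M.State)).map fun i =>
    const (.inl result) (acceptingIndex M i).toNat)

/-- The code to which the transition number `a` leads from the code `u`. -/
noncomputable def codeTrans (B : ℕ) (x : List Bool) (u a : ℕ) : ℕ :=
  (((transitions M)[a]?.bind fun τ =>
    stepCode x τ (unpack B (cregs M.k) (fun _ => 0) u)).map fun c =>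
      pack B c (cregs M.k)).getD (B ^ (cregs M.k).length)

variable {M}

theorem det_tapesProg (τ : Transition M) {p : Cmd (CodeReg M.k)} (hp : p.Det)
    (is : List (Fin M.k)) : (tapesProg τ p is).Det := by
  induction is with
  | nil => exact hp
  | cons i is ih =>
    exact ⟨det_divMod _ _ _, det_ifEqConst _ _ _ ⟨det_pushCoords _ _ _, ih⟩ (det_mov _ _)⟩

theorem det_finishProg (τ : Transition M) : (finishProg τ).Det :=
  ⟨det_const _ _, det_moveInput _, det_packCoords _⟩

theorem det_transitionProg (τ : Transition M) : (transitionProg τ).Det :=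
  det_ifEqConst _ _ _ (det_ifSym _ _ (det_tapesProg τ (det_finishProg τ) _) (det_mov _ _))
    (det_mov _ _)

theorem det_codeStep : (codeStep M).Det := by
  refine ⟨det_mov _ _, det_unpackCoords _, det_mov _ _, det_select _ (det_mov _ _) ?_⟩
  intro p hp
  obtain ⟨τ, -, rfl⟩ := List.mem_map.1 hp
  exact det_transitionProg τ

theorem det_codeInit (D : ℕ) : (codeInit M D).Det :=
  ⟨det_addLength _, trivial, det_mov _ _, trivial, det_powTo _ _ _ _, det_powTo _ _ _ _,
    det_const _ _, det_const _ _, det_setCoords _ _, det_packCoords _, det_mov _ _⟩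

theorem det_codeMem : (codeMem M).Det := by
  refine ⟨det_mov _ _, det_divMod _ _ _, det_select _ (det_const _ _) ?_⟩
  intro p hp
  obtain ⟨i, -, rfl⟩ := List.mem_map.1 hp
  exact det_const _ _

variable {x : List Bool} {W B : ℕ} {P : Prop} {v : CodeReg M.k → ℕ} {o : List Bool}
  {Q : (CodeReg M.k → ℕ) → List Bool → Prop}

theorem Hp.noTransition
    (h : ∀ v', v' (.inl result) = v (.inl states) → SameFrame v v' → Q v' o) :
    Hp x W P noTransition v o Q :=
  Hp.mov (by simp) (h _ (by simp) ⟨fun r hr => by simp [hr], by simp, by simp, by simp⟩)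

/-- One step on a tape raises the exponent in the bound by at most two; `B ≥ 4` absorbs the sums.
The bound has to hold for all numbers below the number of states, not only for codes of reachable
configurations. -/
theorem pushTape_le {g w e l r : ℕ} (mv : HeadMove) (hB : 4 ≤ B) (hg : g ≤ B) (hw : w < g)
    (hl : l ≤ B ^ (e + 1)) (hr : r ≤ B ^ (e + 1)) :
    g + g * (w + g * (B ^ (e + 1))) ≤ B ^ (e + 4) ∧
    (pushTape g w mv l (r / g)).1 ≤ B ^ (e + 3) ∧ (pushTape g w mv l (r / g)).2 ≤ B ^ (e + 3) := by
  have h1 : B ≤ B ^ (e + 1) := Nat.le_self_pow (by omega) B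
  have h2 : g * B ^ (e + 1) ≤ B ^ (e + 2) := by
    rw [pow_succ' B (e + 1)]; exact Nat.mul_le_mul_right _ hg
  have h12 : B ^ (e + 1) * 4 ≤ B ^ (e + 2) := by
    rw [pow_succ B (e + 1)]; exact Nat.mul_le_mul_left _ hB
  have h23 : B ^ (e + 2) * 4 ≤ B ^ (e + 3) := by
    rw [pow_succ B (e + 2)]; exact Nat.mul_le_mul_left _ hB
  have h34 : B ^ (e + 3) * 4 ≤ B ^ (e + 4) := by
    rw [pow_succ B (e + 3)]; exact Nat.mul_le_mul_left _ hB
  have h3 : g * (w + g * B ^ (e + 1)) ≤ B * (2 * B ^ (e + 2)) := Nat.mul_le_mul hg (by omega)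
  have h4 : B * (2 * B ^ (e + 2)) = 2 * B ^ (e + 3) := by ring
  have h5 : g * (r / g) ≤ r := Nat.mul_div_le r g
  have h6 : g * l ≤ g * B ^ (e + 1) := Nat.mul_le_mul_left _ hl
  have h7 : g * (w + g * (r / g)) ≤ B * (2 * B ^ (e + 1)) := Nat.mul_le_mul hg (by omega)
  have h8 : B * (2 * B ^ (e + 1)) = 2 * B ^ (e + 2) := by ring
  have h9 := Nat.mod_lt l (show 0 < g by omega)
  have h10 := Nat.div_le_self l g
  have h11 := Nat.div_le_self r g
  refine ⟨by omega, ?_⟩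
  cases mv with
  | stay => simp only [pushTape]; constructor <;> omega
  | right => simp only [pushTape]; constructor <;> omega
  | left => simp only [pushTape]; split_ifs <;> constructor <;> dsimp only <;> omega

/-- Each tape costs two in the exponent `e`, and the number of tapes depends on the machine alone;
so everything remains below a fixed power of `B`. -/
theorem Hp.tapesProg {τ : Transition M} {p : Cmd (CodeReg M.k)} (hB : 4 ≤ B)
    (hg : radixOf M ≤ B) {is : List (Fin M.k)} {c : CReg M.k → ℕ} {e : ℕ}
    (hc : ∀ r, v (.inr (.inl r)) = c r) (hce : ∀ r, c r ≤ B ^ (e + 1))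
    (hradix : v (.inr (.inr radix)) = radixOf M)
    (hW : B ^ (e + 2 * is.length + 4) ≤ W)
    (hfail : stepTapes τ is c = none → ∀ v', v' (.inl result) = v (.inl states) →
      SameFrame v v' → Q v' o)
    (hp : ∀ c', stepTapes τ is c = some c' → ∀ v', (∀ r, v' (.inr (.inl r)) = c' r) →
      (∀ r, c' r ≤ B ^ (e + 2 * is.length + 1)) → SameFrame v v' → Hp x W P p v' o Q) :
    Hp x W P (tapesProg τ p is) v o Q := by
  induction is generalizing v c e with
  | nil => exact hp c rfl v hc hce (.refl v)
  | cons i is ih =>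
    have hgW : radixOf M ≤ W :=
      hg.trans ((Nat.le_self_pow (by omega) B).trans hW)
    have hw := symIndex_lt M (τ.action.write i)
    have hpos : 0 < radixOf M := by omega
    obtain ⟨h1, h2, h3⟩ := pushTape_le (τ.action.workMove i) hB hg hw (hce (.left i))
      (hce (.right i))
    have hWe : B ^ (e + 4) ≤ W := (Nat.pow_le_pow_right (by omega) (by omega)).trans hW
    refine Hp.seq (Hp.divMod (by simp) (by simp) (by simp) (by simpa [hradix]) ?_)
    refine Hp.ifEqConst (by simp) ((symIndex_lt M _).le.trans hgW) (fun heq => ?_) fun hne => ?_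
    · simp [hc, hradix] at heq
      refine Hp.seq (Hp.pushCoords hpos (by simpa) (m := B ^ (e + 1)) ?_ ?_ (h1.trans hWe) ?_)
      · simpa [hc] using hce _
      · simpa [hc, hradix] using (Nat.div_le_self _ _).trans (hce _)
      intro v' hv' hf'
      have hf : SameFrame v v' := by
        refine SameFrame.trans ⟨?_, ?_, ?_, ?_⟩ hf' <;> simp
      have hst : ∀ r, v' (.inr (.inl r)) = stepTape τ i c r := by
        intro r
        rw [hv', stepTape]
        by_cases hr : r = .right i
        · subst hr; simp [hc, hradix]
        · by_cases hr' : r = .left i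
          · subst hr'; simp [hc, hradix]
          · simp [hr, hr', hc]
      refine ih (e := e + 2) hst ?_ (hf.radix.trans hradix) ?_ ?_ ?_
      · intro r
        rw [stepTape]
        by_cases hr : r = .right i
        · subst hr; simpa using h3
        · by_cases hr' : r = .left i
          · subst hr'; simpa using h2
          · simpa [hr, hr'] using (hce r).trans (Nat.pow_le_pow_right (by omega) (by omega))
      · refine le_trans (le_of_eq ?_) hW
        simp only [List.length_cons]; ring_nf
      · intro hn v'' hr hf''
        exact hfail (by simp [stepTapes, heq, hn]) v'' (hr.trans (hf.print _ (by simp)))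
          (hf.trans hf'')
      · intro c' hs v'' hv'' hle hf''
        refine hp c' (by simp [stepTapes, heq, hs]) v'' hv'' (fun r => (hle r).trans (le_of_eq ?_))
          (hf.trans hf'')
        simp only [List.length_cons]; ring_nf
    · simp [hc, hradix] at hne
      refine Hp.noTransition fun v' h1 h2 => hfail (by simp [stepTapes, hne]) v' ?_ ?_
      · simpa using h1
      · refine SameFrame.trans ⟨?_, ?_, ?_, ?_⟩ h2 <;> simp

theorem Hp.transitionProg {τ : Transition M} (hB : 4 ≤ B) (hg : radixOf M ≤ B)
    (hstate : ∀ q, stateIndex M q ≤ B) (hxB : x.length + 1 ≤ B) {c : CReg M.k → ℕ}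
    (hc : ∀ r, v (.inr (.inl r)) = c r) (hcB : ∀ r, c r ≤ B)
    (hradix : v (.inr (.inr radix)) = radixOf M) (hbase : v (.inr (.inr base)) = B)
    (hlen : v (.inr (.inr len)) = x.length + 1) {n : ℕ} (hn : v (.inl states) = n)
    (hW : B ^ (2 * (cregs M.k).length + 2 * M.k + 4) ≤ W)
    (h : ∀ v', v' (.inl result) = ((stepCode x τ c).map fun c' => pack B c' (cregs M.k)).getD n →
      SameFrame v v' → Q v' o) :
    Hp x W P (transitionProg τ) v o Q := by
  have hpow : ∀ e ≤ 2 * (cregs M.k).length + 2 * M.k + 4, B ^ e ≤ W := fun e he =>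
    (Nat.pow_le_pow_right (by omega) he).trans hW
  have hBW : B ≤ W := by simpa using hpow 1 (by omega)
  refine Hp.ifEqConst (by simp) ((hstate _).trans hBW) (fun hst => ?_) fun hst => ?_
  · refine Hp.ifSym (fun hs => ?_) fun hs => ?_
    · simp [hc] at hs hst
      refine Hp.tapesProg hB hg (e := 0) (c := c) (by simpa using hc) (by simpa using hcB)
        (by simpa) (hpow _ (by simp)) (fun hnone v' hr hf => ?_) fun c' hc' v' hv' hle hf => ?_
      · refine h v' ?_ (SameFrame.trans ⟨?_, ?_, ?_, ?_⟩ hf)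
        · simp [stepCode, hs, hst, hnone, hr, hn]
        all_goals simp
      · simp only [List.length_finRange, zero_add] at hle
        have hf0 : SameFrame v v' := by
          refine SameFrame.trans ⟨?_, ?_, ?_, ?_⟩ hf <;> simp
        have hB1 : ∀ e, B ≤ B ^ (e + 1) := fun e => Nat.le_self_pow (by omega) B
        -- The tapes do not affect the input position, so the move of the input head starts from the
        -- old one.
        have hip : c' .ip = c .ip := by
          rw [stepTapes_eq_some τ (List.nodup_finRange _)] at hc'
          rw [hc'.2]
        refine Hp.seq (Hp.const ((hstate _).trans hBW) (Hp.seq (Hp.moveInput ?_ ?_)))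
        · simp [hv', hip]
          have h1 := hcB .ip
          have h2 := hpow 2 (by omega)
          nlinarith
        · have hnew : (fun r => Function.update (Function.update v' (.inr (.inl .st))
              (stateIndex M τ.action.next)) (.inr (.inl .ip))
              (min (TM.moveHead τ.action.inMove (c .ip)) (x.length + 1)) (.inr (.inl r))) =
              Function.update (Function.update c' .st (stateIndex M τ.action.next)) .ip
              (min (TM.moveHead τ.action.inMove (c .ip)) (x.length + 1)) := by
            funext r
            by_cases h1 : r = .ip
            · subst h1; simp
            · by_cases h2 : r = .st
              · subst h2; simp
              · simp [h1, h2, hv']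
          have hval : Function.update (Function.update v' (.inr (.inl .st))
              (stateIndex M τ.action.next)) (.inr (.inl .ip))
              (min (TM.moveHead τ.action.inMove (Function.update v' (.inr (.inl .st))
              (stateIndex M τ.action.next) (.inr (.inl .ip)))) (Function.update v'
              (.inr (.inl .st)) (stateIndex M τ.action.next) (.inr (.inr len)))) =
              Function.update (Function.update v' (.inr (.inl .st))
              (stateIndex M τ.action.next)) (.inr (.inl .ip))
              (min (TM.moveHead τ.action.inMove (c .ip)) (x.length + 1)) := by
            simp [hv', hip, hf0.len, hlen]
          rw [hval]
          refine Hp.packCoords (B := B) (by omega) (by simp [hf0.base, hbase]) ?_ ?_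
          · rw [hnew]
            refine (pack_le (e := 2 * M.k + 1) (by omega) fun r => ?_).trans (hpow _ (by omega))
            by_cases h1 : r = .ip
            · subst h1; simpa using Or.inr (hxB.trans (hB1 _))
            · by_cases h2 : r = .st
              · subst h2; simpa using (hstate _).trans (hB1 _)
              · simpa [h1, h2] using hle r
          · intro v'' hres _ hf''
            refine h v'' ?_ (hf0.trans (SameFrame.trans ⟨?_, ?_, ?_, ?_⟩ hf''))
            · rw [hres, hnew]
              simp [stepCode, hs, hst, hc']
            all_goals simp
    · simp [hc] at hs hst
      refine Hp.noTransition fun v' hr hf => h v' ?_ (SameFrame.trans ⟨?_, ?_, ?_, ?_⟩ hf)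
      · simp [stepCode, hs, hr, hn]
      all_goals simp
  · simp [hc] at hst
    refine Hp.noTransition fun v' hr hf => h v' ?_ (SameFrame.trans ⟨?_, ?_, ?_, ?_⟩ hf)
    · simp [stepCode, hst, hr, hn]
    all_goals simp

/-- The constants that `codeInit` computes. -/
def CodeConsts (M : TM) (B : ℕ) (x : List Bool) (v : CReg M.k ⊕ CodeAux → ℕ) : Prop :=
  v (.inr len) = x.length + 1 ∧ v (.inr base) = B ∧ v (.inr radix) = radixOf M

theorem codeStep_spec (hB : 4 ≤ B) (hg : radixOf M ≤ B)
    (hstate : ∀ q, stateIndex M q ≤ B) (hxB : x.length + 1 ≤ B)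
    (hW : B ^ (2 * (cregs M.k).length + 2 * M.k + 4) ≤ W) :
    StepSpec x W P (B ^ (cregs M.k).length) (transitions M).length (CodeConsts M B x)
      (codeTrans M B x) (codeStep M) := by
  rintro v o hn ⟨hlen, hbase, hradix⟩ hu ha
  refine Hp.seq (Hp.mov (by simp) (Hp.seq (Hp.unpackCoords (B := B) (by omega) (by simpa)
    fun v' hv' hf' => ?_)))
  have hf : SameFrame v v' := by
    refine SameFrame.trans ⟨?_, ?_, ?_, ?_⟩ hf' <;> simp
  refine Hp.seq (Hp.mov (by simp) (Hp.select (fun hle => ?_) fun p hp => ?_))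
  -- The letter is smaller than the number of transitions, which excludes the default branch of
  -- `select`.
  · simp [hf.print] at hle
    omega
  · simp [hf.print] at hp
    obtain ⟨τ, hτ, rfl⟩ := hp
    have hunp : ∀ r, v' (.inr (.inl r)) = unpack B (cregs M.k) (fun _ => 0) (v (.inl state)) r := by
      intro r
      rw [hv']
      simp only [Function.update_self]
      exact unpack_congr (mem_cregs r) _ _ _
    refine Hp.transitionProg (n := B ^ (cregs M.k).length) hB hg hstate hxB (by simpa using hunp)
      (fun r => (unpack_lt (by omega) (cregs_nodup _) (mem_cregs r) _ _).le)
      (by simpa [hf.radix]) (by simpa [hf.base]) (by simpa [hf.len]) (by simp [hf.print, hn]) hW ?_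
    intro v'' hres hf''
    have hf2 : SameFrame v v'' := by
      refine hf.trans (SameFrame.trans ⟨?_, ?_, ?_, ?_⟩ hf'') <;> simp
    refine ⟨rfl, ?_, hf2.print, hf2.len.trans hlen, hf2.base.trans hbase, hf2.radix.trans hradix⟩
    rw [hres, codeTrans, hτ, Option.bind_some]

theorem codeMem_spec (hB : 0 < B) (hW : 0 < W) :
    MemSpec x W P (B ^ (cregs M.k).length) (CodeConsts M B x)
      (fun u => acceptingIndex M (u % B)) (codeMem M) := by
  rintro v o hn ⟨hlen, hbase, hradix⟩ hu
  refine Hp.seq (Hp.mov (by simp) (Hp.seq (Hp.divMod (by simp) (by simp) (by simp) (by simpa [hbase])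
    (Hp.select (fun hle => ?_) fun p hp => ?_))))
  -- A digit that is too large to be the number of a state is not accepting.
  · simp [hbase] at hle
    refine Hp.const (by omega) ⟨rfl, ?_, fun r hr => by simp [hr], by simpa, by simpa, by simpa⟩
    simp only [Function.update_self, ne_eq, not_true_eq_false, false_iff, Bool.not_eq_true,
      acceptingIndex, decide_eq_false_iff_not]
    rintro ⟨q, -, hq⟩
    have := stateIndex_lt M q
    omega
  · simp [hbase] at hp
    obtain ⟨i, hi, rfl⟩ := hp
    obtain ⟨hi, hi'⟩ := List.getElem?_eq_some_iff.1 hi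
    rw [List.getElem_range] at hi'
    refine Hp.const ((Bool.toNat_le _).trans hW) ⟨rfl, ?_, fun r hr => by simp [hr], by simpa,
      by simpa, by simpa⟩
    simp [hi']

theorem Hp.codeInit {D : ℕ} (hBD : (x.length + 2) ^ D = B) (hB : 4 ≤ B) (hg : radixOf M ≤ B)
    (hstate : ∀ q, stateIndex M q ≤ B) (hT : (transitions M).length ≤ B) (hxB : x.length + 2 ≤ B)
    (hW : B ^ (2 * (cregs M.k).length + 2 * M.k + 4) ≤ W) :
    Hp x W P (codeInit M D) (fun _ => 0) [] fun v o => o = [] ∧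
      v (.inl states) = B ^ (cregs M.k).length ∧ v (.inl letters) = (transitions M).length ∧
      v (.inl start) = pack B (initCode M) (cregs M.k) ∧ CodeConsts M B x fun i => v (.inr i) := by
  have hpow : ∀ e ≤ 2 * (cregs M.k).length + 2 * M.k + 4, B ^ e ≤ W := fun e he =>
    (Nat.pow_le_pow_right (by omega) he).trans hW
  have hBW : B ≤ W := by simpa using hpow 1 (by omega)
  have hcode : ∀ r, initCode M r ≤ B := by
    rintro (_ | _ | _ | _) <;> simp [initCode, hstate]
    omega
  refine Hp.seq (Hp.addLength (by simp; omega) ?_)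
  refine Hp.seq (Hp.incr (by simp; omega) ?_)
  refine Hp.seq (Hp.mov (by simp) ?_)
  refine Hp.seq (Hp.incr (by simp; omega) ?_)
  refine Hp.seq (Hp.powTo (by simp) (by simp) (by simp) (by simp) (by simp [hBD]; omega) fun c₁ => ?_)
  refine Hp.seq (Hp.powTo (by simp) (by simp) (by simp) (by simp)
    (by simp [hBD]; exact hpow _ (by omega)) fun c₂ => ?_)
  refine Hp.seq (Hp.const (by omega) ?_)
  refine Hp.seq (Hp.const (by omega) ?_)
  refine Hp.seq (Hp.setCoords (fun r => (hcode r).trans hBW) fun v hv h1 h2 => ?_)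
  have hv' : (fun r => v (.inr (.inl r))) = initCode M := funext fun r => hv r (mem_cregs r)
  refine Hp.seq (Hp.packCoords (B := B) (by omega) (by simp [h2, hBD]) ?_ fun v' hres _ hf => ?_)
  · rw [hv']
    refine (pack_le (e := 1) (by omega) fun r => ?_).trans (hpow _ (by omega))
    simpa using hcode r
  · rw [hv'] at hres
    refine Hp.mov (by simp) ⟨rfl, ?_, ?_, ?_, ?_, ?_, ?_⟩
    · simp [hf.print, h1, hBD]
    · simp [hf.print, h1]
    · simp [hres]
    · simp [hf.len, h2]
    · simp [hf.base, h2, hBD]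
    · simp [hf.radix, h2]

end Simulation

end Cmd

/-! ### Reachable codes and reachable configurations -/

namespace ConfigCode

open Relation

variable {M : TM} {x : List Bool}

theorem inPos_le {c : TMConfig M} (hc : M.Reachable x c) : c.inPos ≤ x.length + 1 := by
  rcases ReflTransGen.cases_tail hc with h | ⟨c', -, a, -, rfl⟩
  · subst h; exact Nat.zero_le _
  · exact min_le_right _ _

/-- A number with `O(log N)` digits in a fixed base is polynomial in `N`: replace `g` by `2 ^ g` and
use that `2 ^ (Nat.log 2 N + 1)` is at most `(N + 2) ^ 2`. -/
theorem pow_space_le (g C N : ℕ) (hg : 0 < g) :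
    g ^ (C * (Nat.log 2 N + 1) + 1) ≤ (N + 2) ^ (2 * g * (C + 1)) := by
  have h1 : 2 ^ (Nat.log 2 N + 1) ≤ (N + 2) ^ 2 := by
    have : 2 ^ Nat.log 2 N ≤ N + 1 := by
      rcases Nat.eq_zero_or_pos N with rfl | h
      · simp
      · exact (Nat.pow_log_le_self 2 h.ne').trans (by omega)
    rw [pow_succ]
    nlinarith
  calc g ^ (C * (Nat.log 2 N + 1) + 1) ≤ g ^ ((C + 1) * (Nat.log 2 N + 1)) :=
        Nat.pow_le_pow_right hg (by rw [add_mul]; omega)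
    _ ≤ (2 ^ g) ^ ((C + 1) * (Nat.log 2 N + 1)) :=
        Nat.pow_le_pow_left g.lt_two_pow_self.le _
    _ = (2 ^ (Nat.log 2 N + 1)) ^ (g * (C + 1)) := by
        rw [← pow_mul, ← pow_mul]; congr 1; ring
    _ ≤ ((N + 2) ^ 2) ^ (g * (C + 1)) := Nat.pow_le_pow_left h1 _
    _ = (N + 2) ^ (2 * g * (C + 1)) := by rw [← pow_mul]; congr 1; ring

/-- The exponent in a bound for the coordinates of codes. -/
noncomputable def codeExponent (M : TM) (C : ℕ) : ℕ :=
  2 * radixOf M * (C + 1) + Nat.card M.State + (transitions M).length + radixOf M + 2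

/-- By `c < 2 ^ c`, every constant of the machine that is a summand of the exponent lies below the
base, even for the empty input. This is why the exponent adds up these constants. -/
theorem le_codeBase {M : TM} {C N c : ℕ} (hc : c ≤ codeExponent M C) :
    c < (N + 2) ^ codeExponent M C :=
  hc.trans_lt (Nat.lt_two_pow_self.trans_le (Nat.pow_le_pow_left (by omega) _))

/-- For reachable configurations all coordinates are digits in the base, so that unpacking inverts
packing. -/
theorem encode_lt {C : ℕ} {c : TMConfig M}
    (hC : ∀ i, c.head i ≤ C * (Nat.log 2 x.length + 1)) (hc : M.Reachable x c)
    (r : CReg M.k) : encode (C * (Nat.log 2 x.length + 1)) c r <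
      (x.length + 2) ^ codeExponent M C := by
  have hg := two_le_radixOf M
  have hpow : radixOf M ^ (C * (Nat.log 2 x.length + 1) + 1) ≤
      (x.length + 2) ^ codeExponent M C :=
    (pow_space_le _ C x.length (by omega)).trans
      (Nat.pow_le_pow_right (by omega) (by simp only [codeExponent]; omega))
  cases r with
  | st => exact le_codeBase ((stateIndex_lt M _).le.trans (by simp only [codeExponent]; omega))
  | ip =>
    have h1 := inPos_le hc
    have h2 : x.length + 2 ≤ (x.length + 2) ^ codeExponent M C :=
      Nat.le_self_pow (by simp [codeExponent]) _
    simp only [encode]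
    omega
  | left i =>
    exact (leftCode_lt hg (fun j => symIndex_lt M _) _).trans_le
      ((Nat.pow_le_pow_right (by omega) (by have := hC i; omega)).trans hpow)
  | right i =>
    exact (rightCode_lt (fun j => symIndex_lt M _) _ _).trans_le
      ((Nat.pow_le_pow_right (by omega) (by omega)).trans hpow)

theorem encode_initial (L : ℕ) : encode L M.initial = Cmd.initCode M := by
  have h : ∀ h m, rightCode (radixOf M) (fun _ => 0) h m = 0 := by
    intro h m
    induction m generalizing h with
    | zero => rfl
    | succ m ih => simp [rightCode, ih]
  funext r
  cases r with
  | st => rfl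
  | ip => rfl
  | left i => simp [encode, TM.initial, leftCode, Cmd.initCode]
  | right i => simp [encode, TM.initial, symIndex_blank, h, Cmd.initCode]

/-- Induction along paths on both sides. Numbers that code no configuration may be states of the
automaton and may have transitions, but they are never reached from the initial code: successful
transitions lead from codes of reachable configurations to such codes again. -/
theorem reach_codeTrans_iff {C : ℕ}
    (hC : ∀ c, M.Reachable x c → ∀ i, c.head i ≤ C * (Nat.log 2 x.length + 1)) (u : ℕ) :
    ReflTransGen (Cmd.Trans (((x.length + 2) ^ codeExponent M C) ^ (cregs M.k).length)
      (transitions M).length (Cmd.codeTrans M ((x.length + 2) ^ codeExponent M C) x))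
      (pack ((x.length + 2) ^ codeExponent M C) (Cmd.initCode M) (cregs M.k)) u ↔
    ∃ c, M.Reachable x c ∧ u = pack ((x.length + 2) ^ codeExponent M C)
      (encode (C * (Nat.log 2 x.length + 1)) c) (cregs M.k) := by
  have henc := fun c hc => encode_lt (hC c hc) hc
  rw [← encode_initial (C * (Nat.log 2 x.length + 1))]
  generalize (x.length + 2) ^ codeExponent M C = B at *
  generalize C * (Nat.log 2 x.length + 1) = L at *
  have hunpack : ∀ c, M.Reachable x c →
      unpack B (cregs M.k) (fun _ => 0) (pack B (encode L c) (cregs M.k)) = encode L c :=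
    fun c hc => funext fun r =>
      unpack_pack (cregs_nodup _) (fun r _ => henc c hc r) (mem_cregs r) _
  have hstep : ∀ c, M.Reachable x c → ∀ τ d, stepCode x τ (encode L c) = some d ↔
      c.state = τ.state ∧ TM.readInput x c.inPos = τ.sym ∧
        (∀ i, c.tape i (c.head i) = τ.read i) ∧ d = encode L (M.act x c τ.action) :=
    fun c hc τ d => stepCode_encode τ (hC c hc) (fun ha => hC _ (hc.tail ⟨_, ha, rfl⟩))
  constructor
  · intro h
    induction h with
    | refl => exact ⟨_, .refl, rfl⟩
    | tail _ h ih =>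
      obtain ⟨c, hc, rfl⟩ := ih
      obtain ⟨hv, a, ha, hav⟩ := h
      rw [Cmd.codeTrans, hunpack c hc, List.getElem?_eq_getElem ha, Option.bind_some] at hav
      rcases hs : stepCode x (transitions M)[a] (encode L c) with _ | d
      -- A failed transition has the value `B ^ (cregs M.k).length`, the number of states; it is out
      -- of range and therefore no edge.
      · rw [hs] at hav
        simp at hav
        omega
      · rw [hs] at hav
        obtain ⟨h1, h2, h3, rfl⟩ := (hstep c hc _ _).1 hs
        refine ⟨_, hc.tail ⟨_, ?_, rfl⟩, hav.symm⟩
        simp only [TM.possible, h1, h2, h3]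
        exact (transitions M)[a].mem
  · rintro ⟨c, hc, rfl⟩
    induction hc with
    | refl => exact .refl
    | tail hc h ih =>
      rename_i c _
      obtain ⟨a, ha, rfl⟩ := h
      refine ih.tail ⟨pack_lt fun r _ => henc _ (hc.tail ⟨a, ha, rfl⟩) r, ?_⟩
      obtain ⟨i, hi, hτ⟩ := List.getElem_of_mem (mem_transitions (M := M) ⟨_, _, _, a, ha⟩)
      refine ⟨i, hi, ?_⟩
      rw [Cmd.codeTrans, hunpack c hc, List.getElem?_eq_getElem hi, Option.bind_some, hτ,
        (hstep c hc _ _).2 ⟨rfl, rfl, fun _ => rfl, rfl⟩]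
      rfl

/-- The state is the first coordinate, hence the lowest digit, so a remainder modulo the base tells
whether a code is accepting. -/
theorem exists_accepting_iff {C : ℕ}
    (hC : ∀ c, M.Reachable x c → ∀ i, c.head i ≤ C * (Nat.log 2 x.length + 1)) :
    (∃ u, ReflTransGen (Cmd.Trans (((x.length + 2) ^ codeExponent M C) ^ (cregs M.k).length)
      (transitions M).length (Cmd.codeTrans M ((x.length + 2) ^ codeExponent M C) x))
      (pack ((x.length + 2) ^ codeExponent M C) (Cmd.initCode M) (cregs M.k)) u ∧
      Cmd.acceptingIndex M (u % (x.length + 2) ^ codeExponent M C) = true) ↔ M.Accepts x := by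
  have hmod : ∀ c, M.Reachable x c → pack ((x.length + 2) ^ codeExponent M C)
      (encode (C * (Nat.log 2 x.length + 1)) c) (cregs M.k) %
        (x.length + 2) ^ codeExponent M C = stateIndex M c.state := by
    intro c hc
    have := encode_lt (hC c hc) hc .st
    simp only [cregs, List.cons_append, pack, Nat.add_mul_mod_self_left]
    exact Nat.mod_eq_of_lt this
  simp only [reach_codeTrans_iff hC, Cmd.acceptingIndex, decide_eq_true_iff]
  constructor
  · rintro ⟨_, ⟨c, hc, rfl⟩, q, hq, h⟩
    rw [hmod c hc] at h
    exact ⟨c, hc, stateIndex_injective M h ▸ hq⟩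
  · rintro ⟨c, hc, hq⟩
    exact ⟨_, ⟨c, hc, rfl⟩, c.state, hq, (hmod c hc).symm⟩

theorem logSpaceComputable_code (M : TM) (C : ℕ) :
    LogSpaceComputable fun x => Cmd.automatonBits
      (((x.length + 2) ^ codeExponent M C) ^ (cregs M.k).length) (transitions M).length
      (pack ((x.length + 2) ^ codeExponent M C) (Cmd.initCode M) (cregs M.k))
      (Cmd.codeTrans M ((x.length + 2) ^ codeExponent M C) x)
      fun u => Cmd.acceptingIndex M (u % (x.length + 2) ^ codeExponent M C) := by
  have hB : ∀ x : List Bool, 4 ≤ (x.length + 2) ^ codeExponent M C := fun x => by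
    calc 4 = 2 ^ 2 := rfl
      _ ≤ 2 ^ codeExponent M C := Nat.pow_le_pow_right (by omega) (by simp [codeExponent])
      _ ≤ _ := Nat.pow_le_pow_left (by omega) _
  have hg : ∀ x : List Bool, radixOf M ≤ (x.length + 2) ^ codeExponent M C := fun x =>
    (le_codeBase (by simp only [codeExponent]; omega)).le
  have hstate : ∀ (x : List Bool) q, stateIndex M q ≤ (x.length + 2) ^ codeExponent M C :=
    fun x q => (le_codeBase ((stateIndex_lt M q).le.trans (by simp only [codeExponent]; omega))).le
  have hxB : ∀ x : List Bool, x.length + 2 ≤ (x.length + 2) ^ codeExponent M C := fun x =>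
    Nat.le_self_pow (by simp [codeExponent]) _
  refine Cmd.logSpaceComputable_automatonBits (Cmd.codeInit M (codeExponent M C)) (Cmd.codeStep M)
    (Cmd.codeMem M) (Cmd.det_codeInit _) Cmd.det_codeStep Cmd.det_codeMem
    -- The first factor is the exponent of the base as a power of `x.length + 2`; the second bounds
    -- all counters by a power of the base.
    (codeExponent M C * (2 * (cregs M.k).length + 2 * M.k + 4)) _ _ _ _ _
    (fun x => Cmd.CodeConsts M ((x.length + 2) ^ codeExponent M C) x) (fun x => ?_) (fun x => ?_)
    fun x => ?_
  · exact Cmd.Hp.codeInit rfl (hB x) (hg x) (hstate x)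
      (le_codeBase (by simp only [codeExponent]; omega)).le (hxB x) (pow_mul _ _ _).ge
  · exact Cmd.codeStep_spec (hB x) (hg x) (hstate x) (by have := hxB x; omega) (pow_mul _ _ _).ge
  · exact Cmd.codeMem_spec (by have := hB x; omega) (by positivity)

end ConfigCode

/-- Total extensibility in synchronizing automata is hard for NL. -/
theorem totallyExtensibleSync_NLHard : totallyExtensibleSync.NLHard := by
  rintro L ⟨M, ⟨C, hC⟩, hL⟩
  have hstart : ∀ x : List Bool, ConfigCode.pack ((x.length + 2) ^ ConfigCode.codeExponent M C)
      (Cmd.initCode M) (ConfigCode.cregs M.k) <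
      ((x.length + 2) ^ ConfigCode.codeExponent M C) ^ (ConfigCode.cregs M.k).length := fun x => by
    rw [← ConfigCode.encode_initial (C * (Nat.log 2 x.length + 1))]
    exact ConfigCode.pack_lt fun r _ => ConfigCode.encode_lt (hC x _ .refl) .refl r
  refine ⟨_, ConfigCode.logSpaceComputable_code M C, fun x hx => ?_, fun x hx => ?_⟩
  · exact Cmd.automatonBits_mem_yes (hstart x)
      ((ConfigCode.exists_accepting_iff (hC x)).2 ((hL x).1 hx))
  · exact Cmd.automatonBits_mem_no (hstart x)
      fun h => hx ((hL x).2 ((ConfigCode.exists_accepting_iff (hC x)).1 h))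

/-! ## A nondeterministic algorithm -/

namespace Cmd

open Prog

section Exec

variable {ι : Type} [DecidableEq ι] {x : List Bool} {B : ℕ} {v : ι → ℕ} {o : List Bool}
  {Q : (ι → ℕ) → List Bool → Prop} {p q : Cmd ι}

/-- Started with the visible counters `v` and the output `o`, the program has an execution that
leads to a situation that satisfies `Q`. -/
def Ex (x : List Bool) (B : ℕ) (p : Cmd ι) (v : ι → ℕ) (o : List Bool)
    (Q : (ι → ℕ) → List Bool → Prop) : Prop :=
  (∀ i, v i ≤ B) → ∀ pos K, ∃ v' pos' o', (∀ i, v' i ≤ B) ∧ Q v' o' ∧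
    Relation.ReflTransGen (CStep code x) (p :: K, lift v pos o) (K, lift v' pos' o')

theorem Hp.ex (h : Hp x B True p v o Q) : Ex x B p v o Q := by
  intro hv pos K
  obtain ⟨_, hm, ⟨v', pos', o', rfl, hq⟩, hr⟩ := (h pos).exists_exec
    (by rintro (i | i); exacts [hv i, Nat.zero_le _]) K trivial
  exact ⟨v', pos', o', fun i => hm (.inl i), hq, hr⟩

namespace Ex

theorem seq (h : Ex x B p v o fun v' o' => Ex x B q v' o' Q) : Ex x B (p ;; q) v o Q := by
  intro hv pos K
  obtain ⟨v₁, pos₁, o₁, hv₁, h₁, hr₁⟩ := h hv pos (q :: K)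
  obtain ⟨v₂, pos₂, o₂, hv₂, h₂, hr₂⟩ := h₁ hv₁ pos₁ K
  exact ⟨v₂, pos₂, o₂, hv₂, h₂, .head (by simp [CStep, code]) (hr₁.trans hr₂)⟩

theorem guess_left (h : Ex x B p v o Q) : Ex x B (.guess p q) v o Q := by
  intro hv pos K
  obtain ⟨v₁, pos₁, o₁, hv₁, h₁, hr₁⟩ := h hv pos K
  exact ⟨v₁, pos₁, o₁, hv₁, h₁, .head (by simp [CStep, code]) hr₁⟩

theorem guess_right (h : Ex x B q v o Q) : Ex x B (.guess p q) v o Q := by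
  intro hv pos K
  obtain ⟨v₁, pos₁, o₁, hv₁, h₁, hr₁⟩ := h hv pos K
  exact ⟨v₁, pos₁, o₁, hv₁, h₁, .head (by simp [CStep, code]) hr₁⟩

/-- The invariant is indexed by the rounds completed, and the induction is on the rounds that
remain; every round may choose its own guesses. -/
theorem repeatFor {t s : ι} (hts : t ≠ s) (I : ℕ → (ι → ℕ) → List Bool → Prop)
    (hI : I 0 (Function.update v t (v s)) o)
    (h1 : ∀ j < v s, ∀ v' o', I j v' o' → v' t = v s - j →
      Ex x B p (Function.update v' t (v s - (j + 1))) o'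
        fun v'' o'' => v'' t = v s - (j + 1) ∧ I (j + 1) v'' o'')
    (h0 : ∀ v' o', I (v s) v' o' → v' t = 0 → Q v' o') :
    Ex x B (repeatFor t s p) v o Q := by
  have key : ∀ j ≤ v s, ∀ v' o', I (v s - j) v' o' → v' t = j →
      Ex x B (.whileDec (.inl t) p) v' o' Q := by
    intro j
    induction j with
    | zero =>
      intro _ v' o' hI' ht hv pos K
      refine ⟨v', pos, o', hv, h0 v' o' hI' ht, .single ?_⟩
      simp [CStep, code, lift, ht]
    | succ j ih =>
      intro hj v' o' hI' ht hv pos K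
      have hv' : ∀ i, Function.update v' t j i ≤ B := by
        intro i
        by_cases hi : i = t
        · subst hi
          have := hv i
          simp only [Function.update_self]
          omega
        · simpa [hi] using hv i
      have hbody := h1 (v s - (j + 1)) (by omega) v' o' hI' (by omega)
      rw [show v s - (v s - (j + 1) + 1) = j by omega,
        show v s - (j + 1) + 1 = v s - j by omega] at hbody
      obtain ⟨v₁, pos₁, o₁, hv₁, ⟨ht₁, hI₁⟩, hr₁⟩ := hbody hv' pos (.whileDec (.inl t) p :: K)
      obtain ⟨v₂, pos₂, o₂, hv₂, h₂, hr₂⟩ := ih (by omega) v₁ o₁ hI₁ ht₁ hv₁ pos₁ K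
      refine ⟨v₂, pos₂, o₂, hv₂, h₂, .head ?_ (hr₁.trans hr₂)⟩
      simp [CStep, code, lift, ht]
  exact seq (Hp.ex (Hp.mov hts (key (v s) le_rfl _ _ (by simpa using hI) (by simp))))

end Ex

end Exec

/-- A path in a finite set can be traversed in as many steps as there are elements. -/
theorem exists_short_path {r : ℕ → ℕ → Prop} {n q u : ℕ} (hr : ∀ i j, r i j → j < n) (hq : q < n)
    (h : Relation.ReflTransGen r q u) :
    ∃ f : ℕ → ℕ, f 0 = q ∧ f n = u ∧ (∀ i, f i < n) ∧
      ∀ i, f (i + 1) = f i ∨ r (f i) (f (i + 1)) := by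
  classical
  -- Paths are functions on `ℕ` with a length, so that `Nat.find` can select a shortest one.
  have hex : ∃ m, ∃ f : ℕ → ℕ, f 0 = q ∧ f m = u ∧ ∀ i < m, r (f i) (f (i + 1)) := by
    induction h with
    | refl => exact ⟨0, fun _ => q, rfl, rfl, by simp⟩
    | @tail b c _ hs ih =>
      obtain ⟨m, f, h0, hm, hf⟩ := ih
      refine ⟨m + 1, Function.update f (m + 1) c, by simp [h0], by simp, fun i hi => ?_⟩
      rcases Nat.lt_succ_iff_lt_or_eq.1 hi with hi | rfl
      · rw [Function.update_of_ne (by omega), Function.update_of_ne (by omega)]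
        exact hf i hi
      · rw [Function.update_of_ne (by omega), Function.update_self, hm]
        exact hs
  obtain ⟨f, h0, hm, hf⟩ := Nat.find_spec hex
  generalize hmdef : Nat.find hex = m at *
  have hlt : ∀ i ≤ m, f i < n := by
    intro i hi
    cases i with
    | zero => omega
    | succ i => exact hr _ _ (hf i (by omega))
  -- A repeated vertex would allow the part between its two visits to be cut out.
  have hinj : ∀ i j, i < j → j ≤ m → f i ≠ f j := by
    intro i j hij hj heq
    refine Nat.find_min hex (m := m - (j - i)) (by omega)
      ⟨fun t => if t ≤ i then f t else f (t + (j - i)), by simp [h0], ?_, fun t ht => ?_⟩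
    · dsimp only
      split_ifs with h
      · obtain rfl : j = m := by omega
        rw [← hm, ← heq]
        congr 1
        omega
      · rw [← hm]
        congr 1
        omega
    · dsimp only
      rcases lt_trichotomy t i with h | rfl | h
      · rw [if_pos h.le, if_pos (by omega)]
        exact hf t (by omega)
      · rw [if_pos le_rfl, if_neg (by omega), heq, show t + 1 + (j - t) = j + 1 by omega]
        exact hf j (by omega)
      · rw [if_neg (by omega), if_neg (by omega), show t + 1 + (j - i) = t + (j - i) + 1 by omega]
        exact hf _ (by omega)
  have hcard : m + 1 ≤ n := by
    have := Fintype.card_le_of_injective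
      (fun i : Fin (m + 1) => (⟨f i, hlt i (by omega)⟩ : Fin n)) fun i j hij => by
        simp only [Fin.mk.injEq] at hij
        rcases lt_trichotomy i.1 j.1 with h | h | h
        · exact absurd hij (hinj _ _ h (by omega))
        · exact Fin.ext h
        · exact absurd hij.symm (hinj _ _ h (by omega))
    simpa using this
  -- The path waits at its end, so that exactly `n` rounds are filled.
  refine ⟨fun t => f (min t m), by simp [h0], ?_, fun i => hlt _ (by omega), fun i => ?_⟩
  · dsimp only
    rw [min_eq_right (by omega), hm]
  · dsimp only
    by_cases hi : i < m
    · rw [min_eq_left (by omega), min_eq_left (by omega)]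
      exact .inr (hf i hi)
    · rw [min_eq_right (by omega), min_eq_right (by omega)]
      exact .inl rfl

/-! ### Reading automata -/

/-- The number of states in an instance. -/
def stateCount (x : List Bool) : ℕ := ones x 0

/-- The number of letters in an instance. -/
def letterCount (x : List Bool) : ℕ := ones x (stateCount x + 1)

/-- The position of the transition table in an instance. -/
def tablePos (x : List Bool) : ℕ := stateCount x + letterCount x + 2

/-- The position of the set of states in an instance. -/
def setPos (x : List Bool) : ℕ :=
  tablePos x + stateCount x * letterCount x * stateCount x

/-- The transition function in an instance. -/
def readTrans (x : List Bool) (u a : ℕ) : ℕ :=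
  lastBelow (fun p => bitAt x (tablePos x + (u * letterCount x + a) * stateCount x + p))
    (stateCount x)

/-- The relation between states that is given by the transition function in an instance. -/
abbrev ReadStep (x : List Bool) : ℕ → ℕ → Prop :=
  Trans (stateCount x) (letterCount x) (readTrans x)

/-- From every state in the instance the set can be reached. -/
def AllReach (x : List Bool) : Prop :=
  ∀ q < stateCount x, ∃ u, Relation.ReflTransGen (ReadStep x) q u ∧ bitAt x (setPos x + u) = true

theorem lastBelow_lt {χ : ℕ → Bool} {n : ℕ} (hn : 0 < n) : lastBelow χ n < n := by
  induction n with
  | zero => omega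
  | succ n ih =>
    simp only [lastBelow]
    split_ifs
    · omega
    · rcases Nat.eq_zero_or_pos n with rfl | h
      · simp [lastBelow]
      · exact (ih h).trans (by omega)

/-- The counters of the nondeterministic algorithm. -/
inductive PathReg where
  | len
  | states
  | letters
  | table
  | set
  | origin
  | current
  | next
  | letter
  | candidate
  | cursor
  | tmp
  | fail
  | outer
  | middle
  | inner
  | time
  deriving DecidableEq

open PathReg

instance : Finite PathReg :=
  Set.finite_univ_iff.1 ((Set.toFinite {.len, .states, .letters, .table, .set, .origin,
    .current, .next, .letter, .candidate, .cursor, .tmp, .fail, .outer, .middle, .inner, .time}).subset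
    fun r _ => by cases r <;> simp)

/-- Find the parts of the input. -/
def pathInit : Cmd PathReg :=
  addLength (.inl len) ;; incr table ;; scanOnes time len table ;;
  mov states table ;; const tmp 1 ;; sub states tmp ;;
  incr table ;; scanOnes time len table ;;
  mov letters table ;; sub letters states ;; const tmp 2 ;; sub letters tmp ;;
  mov set table ;; zero (.inl tmp) ;; mulAdd tmp states letters ;; mulAdd set tmp states

/-- Follow the transition for the letter in the counter `letter`. -/
def pathStep : Cmd PathReg :=
  zero (.inl next) ;; zero (.inl candidate) ;; mov cursor table ;;
  mov tmp letter ;; mulAdd tmp current letters ;; mulAdd cursor tmp states ;; incr cursor ;;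
  repeatFor time states
    (ifSym cursor isOne (mov next candidate) .skip ;; incr candidate ;; incr cursor) ;;
  mov current next

/-- Guess a path. -/
def guessPath : Cmd PathReg :=
  mov current origin ;;
  repeatFor middle states (zero (.inl letter) ;;
    repeatFor inner letters (.guess .skip pathStep ;; incr letter))

/-- Check whether the set has been reached. -/
def checkPath : Cmd PathReg :=
  mov cursor set ;; add cursor current ;; incr cursor ;;
  ifSym cursor isOne .skip (const fail 1) ;; incr origin

/-- Guess paths from all states. -/
def guessPaths : Cmd PathReg := repeatFor outer states (guessPath ;; checkPath)

/-- Guess paths from all states, and accept if all of them lead to the set. -/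
def pathProg : Cmd PathReg := (pathInit ;; guessPaths) ;; ifPos fail .skip .accept

variable {x : List Bool} {P : Prop}

theorem stateCount_le (x : List Bool) : stateCount x ≤ x.length := ones_le x 0

theorem letterCount_le (x : List Bool) : letterCount x ≤ x.length :=
  (ones_le x _).trans (Nat.sub_le _ _)

/-- The table occupies a number of bits that is cubic in the parameters, each at most the length of
the input. Again the input need not encode an automaton. -/
theorem setPos_add_le (x : List Bool) :
    setPos x + stateCount x + 1 ≤ (x.length + 2) ^ 3 ∧
    stateCount x * letterCount x ≤ (x.length + 2) ^ 3 ∧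
    tablePos x ≤ (x.length + 2) ^ 3 := by
  have h1 := stateCount_le x
  have h2 := letterCount_le x
  have h3 : stateCount x * letterCount x ≤ x.length * x.length := Nat.mul_le_mul h1 h2
  have h4 : stateCount x * letterCount x * stateCount x ≤ x.length * x.length * x.length :=
    Nat.mul_le_mul h3 h1
  have h5 : (x.length + 2) ^ 3 = x.length * x.length * x.length + 6 * (x.length * x.length) +
    12 * x.length + 8 := by ring
  simp only [setPos, tablePos]
  omega

/-- The counters hold the parts of the input. -/
structure HasParts (x : List Bool) (v : PathReg → ℕ) : Prop where
  states : v states = stateCount x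
  letters : v letters = letterCount x
  table : v table = tablePos x
  set : v set = setPos x

theorem Hp.pathInit : Hp x ((x.length + 2) ^ 3) P pathInit (fun _ => 0) [] fun v _ =>
    HasParts x v ∧ v origin = 0 ∧ v fail = 0 := by
  have h1 := stateCount_le x
  have h2 := ones_le x (stateCount x + 1)
  obtain ⟨h3, h4, h5⟩ := setPos_add_le x
  have hn : ones x 0 = stateCount x := rfl
  have hk : ones x (stateCount x + 1) = letterCount x := rfl
  rw [hk] at h2
  have hset : setPos x = tablePos x + stateCount x * letterCount x * stateCount x := rfl
  have htable : tablePos x = stateCount x + letterCount x + 2 := rfl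
  have hB : x.length + 2 ≤ (x.length + 2) ^ 3 := Nat.le_self_pow (by omega) _
  generalize (x.length + 2) ^ 3 = B at *
  refine Hp.seq (Hp.addLength (by simp; omega) ?_)
  refine Hp.seq (Hp.incr (by simp; omega) ?_)
  refine Hp.seq (Hp.scanOnes (i := 0) (by simp) (by simp) (by simp) (by simp)
    (by simp; omega) (by omega) ?_)
  refine Hp.seq (Hp.mov (by simp) ?_)
  refine Hp.seq (Hp.const (by omega) ?_)
  refine Hp.seq (Hp.sub (by simp) ?_)
  refine Hp.seq (Hp.incr (by simp; omega) ?_)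
  refine Hp.seq (Hp.scanOnes (i := stateCount x + 1) (by simp) (by simp) (by simp) (by simp [hn])
    (by simp; omega) (by omega) ?_)
  refine Hp.seq (Hp.mov (by simp) ?_)
  refine Hp.seq (Hp.sub (by simp) ?_)
  refine Hp.seq (Hp.const (by omega) ?_)
  refine Hp.seq (Hp.sub (by simp) ?_)
  refine Hp.seq (Hp.mov (by simp) ?_)
  refine Hp.seq (Hp.clr ?_)
  -- The cell of the second zero has the number `n + k + 2`, which is also the index of the first
  -- bit of the table; subtracting `n` and `2` gives the number of letters.
  have e1 : tablePos x - stateCount x - 2 = letterCount x := by omega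
  have e2 : stateCount x + 1 + letterCount x + 1 = tablePos x := by omega
  refine Hp.seq (Hp.mulAdd (by simp) (by simp) (by simp [hn, hk, e1, e2]; omega) ?_)
  refine Hp.mulAdd (by simp) (by simp) (by simp [hn, hk, e1, e2]; omega) ?_
  exact ⟨⟨by simp [hn], by simp [hn, hk, e1, e2], by simp [hk, e2], by simp [hn, hk, e1, e2, hset]⟩,
    by simp, by simp⟩

theorem Hp.pathStep {v : PathReg → ℕ} {o : List Bool} {Q : (PathReg → ℕ) → List Bool → Prop}
    (hv : HasParts x v) (hc : v current < stateCount x) (ha : v letter < letterCount x)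
    (h : ∀ v' o', HasParts x v' → v' current = readTrans x (v current) (v letter) →
      (∀ r ∈ [origin, letter, fail, outer, middle, inner], v' r = v r) → Q v' o') :
    Hp x ((x.length + 2) ^ 3) P pathStep v o Q := by
  obtain ⟨h1, h2, h3, h4⟩ := hv
  obtain ⟨hB, hB', -⟩ := setPos_add_le x
  have hb : v letter + v current * letterCount x + 1 ≤ stateCount x * letterCount x := by
    have := Nat.mul_le_mul_right (letterCount x) (show v current + 1 ≤ stateCount x from hc)
    rw [add_mul] at this
    omega
  have hb' := Nat.mul_le_mul_right (stateCount x) hb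
  have hset : setPos x = tablePos x + stateCount x * letterCount x * stateCount x := rfl
  have hread : readTrans x (v current) (v letter) = lastBelow (fun p => bitAt x (tablePos x +
    (v letter + v current * letterCount x) * stateCount x + p)) (stateCount x) := by
    rw [readTrans, add_comm (v letter)]
  rw [add_mul, one_mul] at hb'
  generalize (x.length + 2) ^ 3 = B at *
  generalize hidx : (v letter + v current * letterCount x) * stateCount x = idx at *
  refine Hp.seq (Hp.clr ?_)
  refine Hp.seq (Hp.clr ?_)
  refine Hp.seq (Hp.mov (by simp) ?_)
  refine Hp.seq (Hp.mov (by simp) ?_)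
  refine Hp.seq (Hp.mulAdd (by simp) (by simp) (by simp [h2]; omega) ?_)
  refine Hp.seq (Hp.mulAdd (by simp) (by simp) (by simp [h1, h2, h3, hidx]; omega) ?_)
  refine Hp.seq (Hp.incr (by simp [h1, h2, h3, hidx]; omega) ?_)
  refine Hp.seq (Hp.repeatFor (by simp) (fun j v' _ => HasParts x v' ∧ v' candidate = j ∧
    v' cursor = tablePos x + idx + j + 1 ∧
    v' next = lastBelow (fun p => bitAt x (tablePos x + idx + p)) j ∧
    ∀ r ∈ [origin, letter, fail, outer, middle, inner], v' r = v r) ?_ ?_ ?_)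
  · refine ⟨⟨by simp [h1], by simp [h2], by simp [h3], by simp [h4]⟩, by simp,
      by simp [h1, h2, h3, hidx], by simp [lastBelow], by simp⟩
  · rintro j hj v' o' ⟨⟨g1, g2, g3, g4⟩, hj', hcur, hnext, hsame⟩ ht
    simp [h1] at hj ht ⊢
    refine Hp.seq (Hp.ifSym (fun hf => Hp.mov (by simp) ?_) fun hf => Hp.skip ?_)
    all_goals
      simp only [ne_eq, reduceCtorEq, not_false_eq_true, Function.update_of_ne, hcur,
        isOne_readInput] at hf
      refine Hp.seq (Hp.incr (by simp; omega) (Hp.incr (by simp; omega) ?_))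
      simp at hsame
      refine ⟨by simp, ⟨by simp [g1], by simp [g2], by simp [g3], by simp [g4]⟩, by simp [hj'],
        by simp [hcur]; omega, by simp [lastBelow, hf, hj', hnext], by simp [hsame]⟩
  · rintro v' o' ⟨⟨g1, g2, g3, g4⟩, hj', hcur, hnext, hsame⟩ ht
    simp at hsame
    refine Hp.mov (by simp) (h _ _ ⟨by simp [g1], by simp [g2], by simp [g3], by simp [g4]⟩ ?_
      (by simp [hsame]))
    simp [hnext, hread, h1]

theorem Hp.checkPath {v : PathReg → ℕ} {o : List Bool} {Q : (PathReg → ℕ) → List Bool → Prop}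
    (hv : HasParts x v) (hc : v current < stateCount x) (ho : v origin < stateCount x)
    (h : ∀ v' o', HasParts x v' → v' origin = v origin + 1 →
      (v' fail = if bitAt x (setPos x + v current) then v fail else 1) →
      v' outer = v outer → Q v' o') :
    Hp x ((x.length + 2) ^ 3) P checkPath v o Q := by
  obtain ⟨h1, h2, h3, h4⟩ := hv
  obtain ⟨hB, -, -⟩ := setPos_add_le x
  generalize (x.length + 2) ^ 3 = B at *
  refine Hp.seq (Hp.mov (by simp) ?_)
  refine Hp.seq (Hp.add (by simp) (by simp [h4]; omega) ?_)
  refine Hp.seq (Hp.incr (by simp [h4]; omega) ?_)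
  refine Hp.seq (Hp.ifSym (fun hf => Hp.skip ?_) fun hf => Hp.const (by omega) ?_)
  all_goals
    simp [h4, isOne_readInput] at hf
    refine Hp.incr (by simp; omega) (h _ _ ⟨by simp [h1], by simp [h2], by simp [h3], by simp [h4]⟩
      (by simp) (by simp [hf]) (by simp))

theorem HasParts.update {v : PathReg → ℕ} (hv : HasParts x v) {r : PathReg} (c : ℕ)
    (hr : r ∉ [PathReg.states, .letters, .table, .set]) : HasParts x (Function.update v r c) := by
  simp only [List.mem_cons, List.not_mem_nil, or_false, not_or] at hr
  obtain ⟨h1, h2, h3, h4⟩ := hv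
  obtain ⟨r1, r2, r3, r4⟩ := hr
  exact ⟨by rw [Function.update_of_ne (Ne.symm r1), h1], by rw [Function.update_of_ne (Ne.symm r2), h2],
    by rw [Function.update_of_ne (Ne.symm r3), h3], by rw [Function.update_of_ne (Ne.symm r4), h4]⟩

/-- In a row without ones `lastBelow` defaults to `0`, so even on malformed inputs the current state
stays in range. -/
theorem readTrans_lt (u a : ℕ) (hx : 0 < stateCount x) : readTrans x u a < stateCount x :=
  lastBelow_lt hx

/-- Every execution of `guessPath` leads to a state that can be reached. -/
theorem Hp.guessPath {v : PathReg → ℕ} {o : List Bool} {Q : (PathReg → ℕ) → List Bool → Prop}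
    (hv : HasParts x v) (ho : v origin < stateCount x)
    (h : ∀ v' o', HasParts x v' → Relation.ReflTransGen (ReadStep x) (v origin) (v' current) →
      v' current < stateCount x → v' origin = v origin → v' fail = v fail →
      v' outer = v outer → Q v' o') :
    Hp x ((x.length + 2) ^ 3) P guessPath v o Q := by
  have hk := letterCount_le x
  have hB : x.length + 2 ≤ (x.length + 2) ^ 3 := Nat.le_self_pow (by omega) _
  refine Hp.seq (Hp.mov (by simp) ?_)
  refine Hp.repeatFor (by simp) (fun _ v' _ => HasParts x v' ∧
    Relation.ReflTransGen (ReadStep x) (v origin) (v' current) ∧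
    v' current < stateCount x ∧ v' origin = v origin ∧ v' fail = v fail ∧ v' outer = v outer)
    ⟨(hv.update _ (by simp)).update _ (by simp), by simp; exact .refl, by simpa, by simp, by simp,
      by simp⟩ ?_ ?_
  · rintro i hi v₁ o₁ ⟨hp, hr, hc, h1, h2, h3⟩ ht
    refine Hp.seq (Hp.clr ?_)
    have hp' := (hp.update (r := .middle) (Function.update v current (v origin) PathReg.states -
      (i + 1)) (by simp)).update (r := .letter) 0 (by simp)
    refine Hp.repeatFor (by simp) (fun j v' _ => HasParts x v' ∧ v' letter = j ∧
      Relation.ReflTransGen (ReadStep x) (v origin) (v' current) ∧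
      v' current < stateCount x ∧ v' origin = v origin ∧ v' fail = v fail ∧ v' outer = v outer ∧
      v' middle = Function.update v current (v origin) PathReg.states - (i + 1))
      ⟨hp'.update _ (by simp), by simp, by simpa, by simpa, by simpa, by simpa, by simpa,
        by simp⟩ ?_ ?_
    · rintro j hj v₂ o₂ ⟨hp₂, hl, hr₂, hc₂, g1, g2, g3, g4⟩ ht₂
      rw [hp'.letters] at hj ht₂ ⊢
      -- One round may follow several letters in succession. This is harmless for soundness, as
      -- every single one is a step of the relation.
      refine Hp.seq (Hp.guess (Hp.skip ?_) (Hp.pathStep (hp₂.update _ (by simp)) (by simpa)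
        (by simp [hl, hj]) fun v₃ o₃ hp₃ hcur hsame => ?_))
      · refine Hp.incr (by simp [hl]; omega) ⟨by simp, (hp₂.update _ (by simp)).update _ (by simp),
          by simp [hl], ?_⟩
        simp [*]
      · simp at hsame hcur
        refine Hp.incr (by simp [hsame, hl]; omega) ⟨by simp [hsame], hp₃.update _ (by simp),
          by simp [hsame, hl], ?_⟩
        have hlt : readTrans x (v₂ current) (v₂ letter) < stateCount x :=
          readTrans_lt _ _ (by omega)
        refine ⟨?_, ?_, by simp [hsame, g1], by simp [hsame, g2], by simp [hsame, g3],
          by simpa [hsame] using g4⟩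
        · simp [hcur]
          exact hr₂.tail ⟨hlt, _, by omega, rfl⟩
        · simpa [hcur] using hlt
    · rintro v₂ o₂ ⟨hp₂, -, hr₂, hc₂, g1, g2, g3, g4⟩ ht₂
      exact ⟨g4, hp₂, hr₂, hc₂, g1, g2, g3⟩
  · rintro v' o' ⟨hp, hr, hc, h1, h2, h3⟩ -
    exact h v' o' hp hr hc h1 h2 h3

/-- Some execution of `guessPath` leads to a given state that can be reached. -/
theorem Ex.guessPath {v : PathReg → ℕ} {o : List Bool} {Q : (PathReg → ℕ) → List Bool → Prop}
    (hv : HasParts x v) (ho : v origin < stateCount x) {u : ℕ}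
    (hu : Relation.ReflTransGen (ReadStep x) (v origin) u)
    (h : ∀ v' o', HasParts x v' → v' current = u → u < stateCount x →
      v' origin = v origin → v' fail = v fail → v' outer = v outer → Q v' o') :
    Ex x ((x.length + 2) ^ 3) guessPath v o Q := by
  have hk := letterCount_le x
  have hB : x.length + 2 ≤ (x.length + 2) ^ 3 := Nat.le_self_pow (by omega) _
  obtain ⟨f, hf0, hfn, hflt, hf⟩ := exists_short_path (fun _ _ h => h.1) ho hu
  refine Ex.seq (Hp.ex (Hp.mov (by simp) ?_))
  refine Ex.repeatFor (by simp) (fun i v' _ => HasParts x v' ∧ v' current = f i ∧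
    v' origin = v origin ∧ v' fail = v fail ∧ v' outer = v outer)
    ⟨(hv.update _ (by simp)).update _ (by simp), by simp [hf0], by simp, by simp, by simp⟩ ?_ ?_
  · rintro i hi v₁ o₁ ⟨hp, hc, h1, h2, h3⟩ ht
    -- `b` is the only letter at which this round makes a transition; if the path waits, `b` is the
    -- number of letters and is never met.
    obtain ⟨b, hb, hb'⟩ : ∃ b, (b < letterCount x → readTrans x (f i) b = f (i + 1)) ∧
        (letterCount x ≤ b → f (i + 1) = f i) := by
      rcases hf i with h | ⟨-, b, hb, h⟩
      · exact ⟨letterCount x, by simp, fun _ => h⟩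
      · exact ⟨b, fun _ => h, by omega⟩
    refine Ex.seq (Hp.ex (Hp.clr ?_))
    have hp' := (hp.update (r := .middle) (Function.update v current (v origin) PathReg.states -
      (i + 1)) (by simp)).update (r := .letter) 0 (by simp)
    refine Ex.repeatFor (by simp) (fun j v' _ => HasParts x v' ∧ v' letter = j ∧
      v' current = (if b < j then f (i + 1) else f i) ∧
      v' origin = v origin ∧ v' fail = v fail ∧ v' outer = v outer ∧
      v' middle = Function.update v current (v origin) PathReg.states - (i + 1))
      ⟨hp'.update _ (by simp), by simp, by simpa, by simpa, by simpa, by simpa, by simp⟩ ?_ ?_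
    · rintro j hj v₂ o₂ ⟨hp₂, hl, hc₂, g1, g2, g3, g4⟩ ht₂
      rw [hp'.letters] at hj ht₂ ⊢
      by_cases hjb : j = b
      · subst hjb
        rw [if_neg (by omega)] at hc₂
        refine Ex.seq (Ex.guess_right (Hp.ex (Hp.pathStep (hp₂.update _ (by simp))
          (by simp [hc₂, hflt]) (by simp [hl, hj]) fun v₃ o₃ hp₃ hcur hsame => Hp.ex ?_)))
        simp at hsame hcur
        refine Hp.incr (by simp [hsame, hl]; omega) ⟨by simp [hsame], hp₃.update _ (by simp),
          by simp [hsame, hl], ?_⟩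
        refine ⟨?_, by simp [hsame, g1], by simp [hsame, g2], by simp [hsame, g3],
          by simpa [hsame] using g4⟩
        simp [hcur, hc₂, hl, hb hj]
      · refine Ex.seq (Ex.guess_left (Hp.ex (Hp.skip (Hp.ex ?_))))
        refine Hp.incr (by simp [hl]; omega) ⟨by simp, (hp₂.update _ (by simp)).update _ (by simp),
          by simp [hl], ?_⟩
        have : b < j + 1 ↔ b < j := by omega
        simp [this, g1, g2, g3, hc₂]
        simpa using g4
    · rintro v₂ o₂ ⟨hp₂, -, hc₂, g1, g2, g3, g4⟩ ht₂
      rw [hp'.letters] at hc₂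
      refine ⟨g4, hp₂, ?_, g1, g2, g3⟩
      split_ifs at hc₂ with hbk
      · exact hc₂
      · rw [hc₂, hb' (by omega)]
  · rintro v' o' ⟨hp, hc, h1, h2, h3⟩ -
    simp only [ne_eq, reduceCtorEq, not_false_eq_true, Function.update_of_ne, hv.states] at hc
    rw [hfn] at hc
    exact h v' o' hp hc (hfn ▸ hflt _) h1 h2 h3

/-- Soundness: once set, `fail` remains set, so `fail = 0` at the end certifies that every guessed
path ended in the set. -/
theorem Hp.guessPaths {v : PathReg → ℕ} {o : List Bool} (hv : HasParts x v) (ho : v origin = 0) :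
    Hp x ((x.length + 2) ^ 3) P guessPaths v o fun v' _ => v' fail = 0 → AllReach x := by
  refine Hp.repeatFor (by simp) (fun j v' _ => HasParts x v' ∧ v' origin = j ∧
    (v' fail = 0 → ∀ q < j, ∃ u, Relation.ReflTransGen (ReadStep x) q u ∧
      bitAt x (setPos x + u) = true)) ⟨hv.update _ (by simp), by simpa, by simp⟩ ?_ ?_
  · rintro j hj v₁ o₁ ⟨hp, ho₁, hall⟩ ht
    rw [hv.states] at hj ⊢
    refine Hp.seq (Hp.guessPath (hp.update _ (by simp)) (by simp [ho₁, hj])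
      fun v₂ o₂ hp₂ hr hc h1 h2 h3 => Hp.checkPath hp₂ hc (by simp [h1, ho₁, hj])
      fun v₃ o₃ hp₃ g1 g2 g3 => ?_)
    simp at h1 h2 h3 hr
    refine ⟨by simp [g3, h3], hp₃, by simp [g1, h1, ho₁], fun hf q hq => ?_⟩
    rw [g2] at hf
    split_ifs at hf with hbit
    rcases Nat.lt_succ_iff_lt_or_eq.1 hq with hq | rfl
    · exact hall (by omega) q hq
    · exact ⟨_, ho₁ ▸ hr, hbit⟩
  · rintro v' o' ⟨-, -, hall⟩ - hf
    rw [hv.states] at hall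
    exact hall hf

/-- Completeness: from each state guess a path that ends in the set; then `fail` stays zero. -/
theorem Ex.guessPaths {v : PathReg → ℕ} {o : List Bool} (hv : HasParts x v) (ho : v origin = 0)
    (hf : v fail = 0) (hx : AllReach x) :
    Ex x ((x.length + 2) ^ 3) guessPaths v o fun v' _ => v' fail = 0 := by
  refine Ex.repeatFor (by simp) (fun j v' _ => HasParts x v' ∧ v' origin = j ∧ v' fail = 0)
    ⟨hv.update _ (by simp), by simpa, by simpa⟩ ?_ ?_
  · rintro j hj v₁ o₁ ⟨hp, ho₁, hf₁⟩ ht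
    rw [hv.states] at hj ⊢
    obtain ⟨u, hu, hbit⟩ := hx j hj
    refine Ex.seq (Ex.guessPath (hp.update _ (by simp)) (by simp [ho₁, hj]) (u := u)
      (by simpa [ho₁] using hu) fun v₂ o₂ hp₂ hc hlt h1 h2 h3 => Hp.ex (Hp.checkPath hp₂ (hc ▸ hlt)
      (by simp [h1, ho₁, hj]) fun v₃ o₃ hp₃ g1 g2 g3 => ?_))
    simp at h1 h2 h3
    rw [hc, if_pos hbit] at g2
    exact ⟨by simp [g3, h3], hp₃, by simp [g1, h1, ho₁], by simp [g2, h2, hf₁]⟩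
  · rintro v' o' ⟨-, -, hf'⟩ -
    exact hf'

/-- `AllReach` is defined for all bit strings, so it provides a language that solves the promise
problem; synchronizability is not checked but enters only through the criterion for total
extensibility. -/
theorem allReach_mem_classNL : {x | AllReach x} ∈ classNL := by
  have h0 : Mem.init (PathReg ⊕ Fin 3) = lift (fun _ => 0) 0 [] := by
    ext r
    · rcases r with r | r <;> rfl
    · rfl
    · rfl
  refine mem_classNL pathProg 3 _ (fun x => ?_) fun x hx => ?_
  · have : Hp x ((x.length + 2) ^ 3) (x ∈ {x | AllReach x}) pathProg (fun _ => 0) []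
        fun _ _ => True := by
      refine Hp.seq (Hp.seq (Hp.pathInit.mono fun v o h => (Hp.guessPaths h.1 h.2.1).mono
        fun v' o' h' => ?_))
      exact Hp.ifPos (fun _ => Hp.skip trivial) fun hf => Hp.accept (h' hf) trivial
    rw [h0]
    exact (this 0).mono fun _ _ => trivial
  · have : Ex x ((x.length + 2) ^ 3) (pathInit ;; guessPaths) (fun _ => 0) [] fun v _ =>
        v fail = 0 :=
      Ex.seq (Hp.ex (Hp.pathInit.mono fun v o h => Ex.guessPaths h.1 h.2.1 h.2.2 hx))
    obtain ⟨v, pos, o, -, hf, hr⟩ := this (fun _ => Nat.zero_le _) 0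
      [Cmd.ifPos fail Prog.skip Prog.accept]
    rw [h0]
    refine ⟨[], lift v pos o, .head ?_ (hr.tail ?_)⟩
    · simp [CStep, code, pathProg]
    · simp [CStep, code, Cmd.ifPos, lift, hf]

/-! ### Instances -/

section Instances

variable {n k : ℕ} (A : Semiautomaton (Fin n) (Fin k)) (S : Finset (Fin n))

theorem stateCount_instanceBits : stateCount (instanceBits A S) = n := by
  have := ones_append [] (List.replicate k true ++ [false] ++
    ((List.finRange n).flatMap fun q => (List.finRange k).flatMap fun a =>
      (List.finRange n).map fun p => decide (A.step q a = p)) ++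
    (List.finRange n).map fun q => decide (q ∈ S)) n
  simpa [stateCount, instanceBits] using this

theorem letterCount_instanceBits : letterCount (instanceBits A S) = k := by
  have := ones_append (List.replicate n true ++ [false])
    (((List.finRange n).flatMap fun q => (List.finRange k).flatMap fun a =>
      (List.finRange n).map fun p => decide (A.step q a = p)) ++
    (List.finRange n).map fun q => decide (q ∈ S)) k
  rw [letterCount, stateCount_instanceBits]
  simpa [instanceBits] using this

theorem tablePos_instanceBits : tablePos (instanceBits A S) = n + k + 2 := by
  rw [tablePos, stateCount_instanceBits, letterCount_instanceBits]

theorem length_rows (q : Fin n) : ((List.finRange k).flatMap fun a => (List.finRange n).map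
    fun p => decide (A.step q a = p)).length = k * n :=
  length_flatMap_finRange _ (by simp)

theorem length_table : ((List.finRange n).flatMap fun q => (List.finRange k).flatMap fun a =>
    (List.finRange n).map fun p => decide (A.step q a = p)).length = n * (k * n) :=
  length_flatMap_finRange _ (length_rows A)

theorem bitAt_instanceBits_table (q p : Fin n) (a : Fin k) :
    bitAt (instanceBits A S) (n + k + 2 + (q * k + a) * n + p) = decide (A.step q a = p) := by
  have h1 : a.1 * n + p.1 < k * n := by
    have := Nat.mul_le_mul_right n (show a.1 + 1 ≤ k from a.2)
    rw [add_mul] at this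
    omega
  have h2 : q.1 * (k * n) + (a.1 * n + p.1) < n * (k * n) := by
    have := Nat.mul_le_mul_right (k * n) (show q.1 + 1 ≤ n from q.2)
    rw [add_mul] at this
    omega
  have h3 := getElem?_flatMap_finRange (fun q => (List.finRange k).flatMap fun a =>
    (List.finRange n).map fun p => decide (A.step q a = p)) (length_rows A) q h1
  have h4 := getElem?_flatMap_finRange (fun a => (List.finRange n).map
    fun p => decide (A.step q a = p)) (by simp) a p.2
  have h5 := length_table A
  simp only [bitAt, instanceBits, List.getD]
  rw [show n + k + 2 + (q.1 * k + a.1) * n + p.1 = n + k + 2 + (q.1 * (k * n) + (a.1 * n + p.1)) by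
    ring]
  rw [List.getElem?_append_left (by
      simp only [List.length_append, List.length_replicate, List.length_singleton, h5]; omega),
    List.getElem?_append_right (by
      simp only [List.length_append, List.length_replicate, List.length_singleton]; omega)]
  simp only [List.length_append, List.length_replicate, List.length_singleton]
  rw [show n + k + 2 + (q.1 * (k * n) + (a.1 * n + p.1)) - (n + 1 + k + 1) =
    q.1 * (k * n) + (a.1 * n + p.1) by omega, h3, h4]
  simp

theorem bitAt_instanceBits_set (q : Fin n) :
    bitAt (instanceBits A S) (n + k + 2 + n * k * n + q) = decide (q ∈ S) := by
  have h5 := length_table A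
  simp only [bitAt, instanceBits, List.getD]
  rw [mul_assoc, List.getElem?_append_right (by
    simp only [List.length_append, List.length_replicate, List.length_singleton, h5]; omega)]
  simp only [List.length_append, List.length_replicate, List.length_singleton, h5]
  rw [show n + k + 2 + n * (k * n) + q.1 - (n + 1 + k + 1 + n * (k * n)) = q.1 by omega]
  simp

theorem readTrans_instanceBits (q : Fin n) (a : Fin k) :
    readTrans (instanceBits A S) q a = A.step q a := by
  rw [readTrans, stateCount_instanceBits, letterCount_instanceBits, tablePos_instanceBits]
  refine lastBelow_eq (A.step q a).2 fun i hi => ?_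
  have := bitAt_instanceBits_table A S q ⟨i, hi⟩ a
  rw [this, decide_eq_true_iff, Fin.ext_iff]
  exact eq_comm

theorem reach_readStep_iff (q : Fin n) (u : ℕ) :
    Relation.ReflTransGen (ReadStep (instanceBits A S)) q u ↔ ∃ p : Fin n, p.1 = u ∧ A.Reaches q p := by
  constructor
  · intro h
    induction h with
    | refl => exact ⟨q, rfl, .refl q⟩
    | tail _ h ih =>
      obtain ⟨p, rfl, hp⟩ := ih
      obtain ⟨-, a, ha, hav⟩ := h
      rw [letterCount_instanceBits] at ha
      have := readTrans_instanceBits A S p ⟨a, ha⟩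
      exact ⟨A.step p ⟨a, ha⟩, by rw [← this, ← hav], hp.trans ⟨[⟨a, ha⟩], rfl⟩⟩
  · rintro ⟨p, rfl, w, rfl⟩
    induction w generalizing q with
    | nil => exact .refl
    | cons a w ih =>
      refine .head ⟨?_, a, ?_, readTrans_instanceBits A S q a⟩ (ih (A.step q a))
      · rw [stateCount_instanceBits]
        exact (A.step q a).2
      · rw [letterCount_instanceBits]
        exact a.2

theorem allReach_instanceBits_iff :
    AllReach (instanceBits A S) ↔ ∀ q, ∃ p ∈ (S : Set (Fin n)), A.Reaches q p := by
  simp only [AllReach, stateCount_instanceBits, setPos, letterCount_instanceBits,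
    tablePos_instanceBits]
  constructor
  · intro h q
    obtain ⟨u, hu, hbit⟩ := h q q.2
    obtain ⟨p, rfl, hp⟩ := (reach_readStep_iff A S q u).1 hu
    rw [bitAt_instanceBits_set, decide_eq_true_iff] at hbit
    exact ⟨p, hbit, hp⟩
  · intro h q hq
    obtain ⟨p, hpS, hp⟩ := h ⟨q, hq⟩
    exact ⟨p, (reach_readStep_iff A S ⟨q, hq⟩ p).2 ⟨p, rfl, hp⟩, by
      rw [bitAt_instanceBits_set, decide_eq_true_iff]
      exact hpS⟩

end Instances

end Cmd

/-- Total extensibility in synchronizing automata can be decided in nondeterministic logarithmic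
space. -/
theorem totallyExtensibleSync_inNL : totallyExtensibleSync.InNL := by
  refine ⟨_, Cmd.allReach_mem_classNL, ?_, ?_⟩
  · rintro _ ⟨n, k, A, S, hA, hS, rfl⟩
    exact (Cmd.allReach_instanceBits_iff A S).2 ((hA.totallyExtensible_iff _).1 hS)
  · rw [Set.disjoint_left]
    rintro _ ⟨n, k, A, S, hA, hS, rfl⟩ h
    exact hS ((hA.totallyExtensible_iff _).2 ((Cmd.allReach_instanceBits_iff A S).1 h))

/-! ## A linear-time algorithm -/

namespace RAM

/-- No number in the configuration exceeds `W`. -/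
def Bounded (W : ℕ) (c : RAMConfig) : Prop := (∀ i, c.reg i ≤ W) ∧ ∀ i, c.mem i ≤ W

/-- From the configuration `c` the program `P` reaches a configuration with the property `Q` after
at most `T` steps, with numbers bounded by `W`. -/
def Reach (P : RAM) (W T : ℕ) (c : RAMConfig) (Q : RAMConfig → Prop) : Prop :=
  Bounded W c → ∃ t ≤ T, (∀ s ≤ t, Bounded W ((step P)^[s] c)) ∧ Q ((step P)^[t] c)

namespace Reach

variable {P : RAM} {W T pc : ℕ} {c : RAMConfig} {reg mem : ℕ → ℕ} {Q : RAMConfig → Prop}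

theorem done (h : Q c) : Reach P W T c Q :=
  fun hb => ⟨0, Nat.zero_le _, fun s hs => by obtain rfl : s = 0 := by omega
                                              exact hb, h⟩

theorem mono {T' : ℕ} (h : Reach P W T c Q) (hT : T ≤ T') : Reach P W T' c Q := fun hb => by
  obtain ⟨t, ht, h1, h2⟩ := h hb
  exact ⟨t, ht.trans hT, h1, h2⟩

theorem step {i : RAMInstr} (hi : P[c.pc]? = some i) (hb : Bounded W c → Bounded W (exec c i))
    (h : Reach P W T (exec c i) Q) : Reach P W (T + 1) c Q := by
  intro hc
  obtain ⟨t, ht, h1, h2⟩ := h (hb hc)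
  have hs : RAM.step P c = exec c i := by simp [RAM.step, hi]
  refine ⟨t + 1, by omega, fun s hs' => ?_, ?_⟩
  · cases s with
    | zero => exact hc
    | succ s =>
      rw [Function.iterate_succ_apply, hs]
      exact h1 s (by omega)
  · rwa [Function.iterate_succ_apply, hs]

theorem update_le {f : ℕ → ℕ} (hf : ∀ i, f i ≤ W) {d v : ℕ} (hv : v ≤ W) (i : ℕ) :
    Function.update f d v i ≤ W := by
  by_cases h : i = d
  · subst h; simpa
  · simpa [h] using hf i

theorem const {d v : ℕ} (hi : P[pc]? = some (.const d v)) (hW : v ≤ W)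
    (h : Reach P W T ⟨pc + 1, Function.update reg d v, mem⟩ Q) :
    Reach P W (T + 1) ⟨pc, reg, mem⟩ Q :=
  step hi (fun hb => ⟨update_le hb.1 hW, hb.2⟩) h

theorem add {d a b : ℕ} (hi : P[pc]? = some (.add d a b)) (hW : reg a + reg b ≤ W)
    (h : Reach P W T ⟨pc + 1, Function.update reg d (reg a + reg b), mem⟩ Q) :
    Reach P W (T + 1) ⟨pc, reg, mem⟩ Q :=
  step hi (fun hb => ⟨update_le hb.1 hW, hb.2⟩) h

theorem mul {d a b : ℕ} (hi : P[pc]? = some (.mul d a b)) (hW : reg a * reg b ≤ W)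
    (h : Reach P W T ⟨pc + 1, Function.update reg d (reg a * reg b), mem⟩ Q) :
    Reach P W (T + 1) ⟨pc, reg, mem⟩ Q :=
  step hi (fun hb => ⟨update_le hb.1 hW, hb.2⟩) h

theorem sub {d a b : ℕ} (hi : P[pc]? = some (.sub d a b))
    (h : Reach P W T ⟨pc + 1, Function.update reg d (reg a - reg b), mem⟩ Q) :
    Reach P W (T + 1) ⟨pc, reg, mem⟩ Q :=
  step hi (fun hb => ⟨update_le hb.1 ((Nat.sub_le _ _).trans (hb.1 a)), hb.2⟩) h

theorem load {d a : ℕ} (hi : P[pc]? = some (.load d a))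
    (h : Reach P W T ⟨pc + 1, Function.update reg d (mem (reg a)), mem⟩ Q) :
    Reach P W (T + 1) ⟨pc, reg, mem⟩ Q :=
  step hi (fun hb => ⟨update_le hb.1 (hb.2 _), hb.2⟩) h

theorem store {a b : ℕ} (hi : P[pc]? = some (.store a b))
    (h : Reach P W T ⟨pc + 1, reg, Function.update mem (reg a) (reg b)⟩ Q) :
    Reach P W (T + 1) ⟨pc, reg, mem⟩ Q :=
  step hi (fun hb => ⟨hb.1, update_le hb.2 (hb.1 b)⟩) h

theorem jump {l : ℕ} (hi : P[pc]? = some (.jump l)) (h : Reach P W T ⟨l, reg, mem⟩ Q) :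
    Reach P W (T + 1) ⟨pc, reg, mem⟩ Q :=
  step hi (fun hb => hb) h

theorem jumpLt {a b l : ℕ} (hi : P[pc]? = some (.jumpLt a b l))
    (h1 : reg a < reg b → Reach P W T ⟨l, reg, mem⟩ Q)
    (h0 : reg b ≤ reg a → Reach P W T ⟨pc + 1, reg, mem⟩ Q) :
    Reach P W (T + 1) ⟨pc, reg, mem⟩ Q := by
  refine step hi (fun hb => hb) ?_
  simp only [exec]
  split_ifs with h
  · exact h1 h
  · exact h0 (by omega)

end Reach

/-- A halted machine does not change, so a bound up to the halting time is a bound for all times. -/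
theorem decides_of_reach {P : RAM} {input : List ℕ} {p : Prop} {T W : ℕ}
    (hb : Bounded W (initial input))
    (h : Reach P W T (initial input) fun c => (p ∧ P[c.pc]? = some .accept) ∨
      (¬ p ∧ P[c.pc]? = some .reject)) :
    P.Decides input p T W := by
  obtain ⟨t, ht, h1, h2⟩ := h hb
  refine ⟨⟨t, ht, h2⟩, fun s i => ?_⟩
  have hfix : step P ((step P)^[t] (initial input)) = (step P)^[t] (initial input) := by
    rcases h2 with ⟨-, h2⟩ | ⟨-, h2⟩ <;> simp [step, h2, exec]
  have key : Bounded W (P.after input s) := by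
    rcases le_total s t with hs | hs
    · exact h1 s hs
    · obtain ⟨d, rfl⟩ := Nat.exists_eq_add_of_le hs
      rw [after, add_comm, Function.iterate_add_apply, Function.iterate_fixed hfix]
      exact h1 t le_rfl
  exact ⟨key.1 i, key.2 i⟩

/-! ### Backward search -/

/-- The program. After the input it stores, for every state, the first transition that leads to
it, for every transition, its source, and a queue of states. The transition table is replaced by
pointers that link the transitions with the same target. The registers are:
`r₁ = 1`, `r₂` the number of states, `r₃` the number of letters, `r₄`, `r₅`, `r₇` the addresses
of the characteristic vector, of the first transitions and of the queue, `r₆` the distance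
between the sources and the table, `r₁₁` the end and `r₁₅` the head of the queue. -/
def backwardSearch : RAM :=
  -- Positions 0 to 9: read the parameters and compute the addresses. Register `10` starts at `2`,
  -- the address of the first table entry.
  [.const 1 1, .load 2 0, .load 3 1, .mul 4 2 3, .const 10 2, .add 4 4 10, .add 5 4 2, .add 6 5 2,
    .sub 6 6 10, .add 7 6 4,
    -- Positions 10 to 24: for each transition store its source and put it in front of the list of
    -- its target. Registers `8` and `9` track source and letter, which avoids a division.
    .jumpLt 10 4 12, .jump 25, .add 12 10 6, .store 12 8, .load 14 10, .add 12 5 14, .load 13 12,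
    .store 10 13, .store 12 10, .add 10 10 1, .add 9 9 1, .jumpLt 9 3 10, .const 9 0, .add 8 8 1,
    .jump 10,
    -- Positions 25 to 36: enqueue the states of the given set.
    .const 8 0, .jumpLt 8 2 28, .jump 37, .add 12 4 8, .load 13 12, .jumpLt 0 13 33, .add 8 8 1,
    .jump 26, .add 12 7 11, .store 12 8, .add 11 11 1, .jump 31,
    -- Positions 37 to 56: take a state from the queue, run through the transitions into it, and
    -- mark and enqueue the sources not yet visited. The pointer `0` ends a list.
    .jumpLt 15 11 39, .jump 57, .add 12 7 15, .load 14 12, .add 15 15 1, .add 12 5 14,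
    .load 10 12, .jumpLt 0 10 46, .jump 37, .add 12 10 6, .load 8 12, .add 12 4 8, .load 13 12,
    .load 10 10, .jumpLt 0 13 44, .store 12 1, .add 12 7 11, .store 12 8, .add 11 11 1, .jump 44,
    -- Positions 57 to 59: accept if all states have entered the queue.
    .jumpLt 11 2 59, .accept, .reject]

/-- The transitions with numbers less than `e` that lead to `p`. -/
def inLinks (tgt : ℕ → ℕ) (p : ℕ) : ℕ → List ℕ
  | 0 => []
  | e + 1 => if tgt e = p then e :: inLinks tgt p e else inLinks tgt p e

theorem mem_inLinks {tgt : ℕ → ℕ} {p e m : ℕ} : e ∈ inLinks tgt p m ↔ e < m ∧ tgt e = p := by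
  induction m with
  | zero => simp [inLinks]
  | succ m ih =>
    simp only [inLinks]
    split_ifs with h
    · rw [List.mem_cons, ih]
      constructor
      · rintro (rfl | h')
        · exact ⟨by omega, h⟩
        · exact ⟨by omega, h'.2⟩
      · rintro ⟨h1, h2⟩
        rcases Nat.lt_succ_iff_lt_or_eq.1 h1 with h1 | h1
        · exact .inr ⟨h1, h2⟩
        · exact .inl h1
    · rw [ih]
      constructor
      · rintro ⟨h1, h2⟩
        exact ⟨by omega, h2⟩
      · rintro ⟨h1, h2⟩
        rcases Nat.lt_succ_iff_lt_or_eq.1 h1 with h1 | rfl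
        · exact ⟨h1, h2⟩
        · exact absurd h2 h

/-- The amortization: every transition is in the list of one target only, so the lists of distinct
states have total length at most the number of transitions. -/
theorem sum_length_inLinks_le (tgt : ℕ → ℕ) {ps : List ℕ} (hps : ps.Nodup) (m : ℕ) :
    (ps.map fun p => (inLinks tgt p m).length).sum ≤ m := by
  induction m with
  | zero => simp [inLinks]
  | succ m ih =>
    have key : ∀ ps : List ℕ, (ps.map fun p => (inLinks tgt p (m + 1)).length).sum =
        (ps.map fun p => (inLinks tgt p m).length).sum + ps.count (tgt m) := by
      intro ps
      induction ps with
      | nil => simp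
      | cons p ps ih =>
        have hl : (inLinks tgt p (m + 1)).length =
            (inLinks tgt p m).length + if p = tgt m then 1 else 0 := by
          simp only [inLinks, eq_comm (a := p)]
          split_ifs <;> simp
        simp only [List.map_cons, List.sum_cons, ih, List.count_cons, hl, beq_iff_eq]
        omega
    rw [key]
    have := List.nodup_iff_count_le_one.1 hps (tgt m)
    omega

/-- The list of the transitions in `l` is stored in the memory with the first pointer `a`. -/
def Linked (mem : ℕ → ℕ) : ℕ → List ℕ → Prop
  | a, [] => a = 0
  | a, e :: l => a = e + 2 ∧ Linked mem (mem (e + 2)) l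

theorem Linked.congr {mem mem' : ℕ → ℕ} {a : ℕ} {l : List ℕ} (h : Linked mem a l)
    (hm : ∀ e ∈ l, mem' (e + 2) = mem (e + 2)) : Linked mem' a l := by
  induction l generalizing a with
  | nil => exact h
  | cons e l ih =>
    refine ⟨h.1, ?_⟩
    rw [hm e (by simp)]
    exact ih h.2 fun e' he' => hm e' (by simp [he'])

/-- The constants of the program; `m` is the size of the table. -/
structure Consts (n k m : ℕ) (reg : ℕ → ℕ) : Prop where
  r0 : reg 0 = 0
  r1 : reg 1 = 1
  r2 : reg 2 = n
  r3 : reg 3 = k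
  r4 : reg 4 = m + 2
  r5 : reg 5 = m + 2 + n
  r6 : reg 6 = m + 2 * n
  r7 : reg 7 = 2 * m + 2 * n + 2

theorem Consts.update {n k m : ℕ} {reg : ℕ → ℕ} (h : Consts n k m reg) {d : ℕ} (hd : 8 ≤ d)
    (v : ℕ) : Consts n k m (Function.update reg d v) := by
  obtain ⟨h0, h1, h2, h3, h4, h5, h6, h7⟩ := h
  constructor <;> rw [Function.update_of_ne (by omega)] <;> assumption

/-- The lists of transitions with the same target, and the sources of the transitions, for the
first `e` transitions. -/
structure Links (n k m : ℕ) (tgt : ℕ → ℕ) (e : ℕ) (mem : ℕ → ℕ) : Prop where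
  linked : ∀ p < n, Linked mem (mem (m + 2 + n + p)) (inLinks tgt p e)
  source : ∀ i < e, mem (i + 2 + (m + 2 * n)) = i / k

/-- The admissible addresses are those of the characteristic vector and those from the start of the
queue on; table, first pointers and sources lie outside of both ranges. -/
theorem Links.update {n k m : ℕ} {tgt : ℕ → ℕ} {mem : ℕ → ℕ} (h : Links n k m tgt m mem) {a : ℕ}
    (ha : (m + 2 ≤ a ∧ a < m + 2 + n) ∨ 2 * m + 2 * n + 2 ≤ a) (v : ℕ) :
    Links n k m tgt m (Function.update mem a v) := by
  refine ⟨fun p hp => ?_, fun i hi => ?_⟩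
  · rw [Function.update_of_ne (by omega)]
    refine (h.linked p hp).congr fun e he => ?_
    have := (mem_inLinks.1 he).1
    rw [Function.update_of_ne (by omega)]
  · rw [Function.update_of_ne (by omega)]
    exact h.source i hi

section Phases

variable {n k m W : ℕ} {tgt : ℕ → ℕ} {χ : ℕ → ℕ} {reg mem : ℕ → ℕ} {Q : RAMConfig → Prop} {T : ℕ}

/-- At most 14 instructions per transition. The entry of transition `e` is needed only until its
target has been read and then becomes its link; the entries of later transitions are still
untouched. -/
theorem reach_links (hm : n * k = m) (hkm : k ≤ m) (hnm : n ≤ m + 1) (hW : 8 * (m + 2) ≤ W)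
    (htgt : ∀ e < m, tgt e < n)
    (hQ : ∀ reg mem, Consts n k m reg → reg 11 = 0 → reg 15 = 0 → Links n k m tgt m mem →
      (∀ q < n, mem (m + 2 + q) = χ q) → Reach backwardSearch W T ⟨25, reg, mem⟩ Q)
    (r : ℕ) {e q j : ℕ} (hr : e + r = m) (hqj : q * k + j = e) (hj : j < k ∨ k = 0)
    (hreg : Consts n k m reg) (h8 : reg 8 = q) (h9 : reg 9 = j) (h10 : reg 10 = e + 2)
    (h11 : reg 11 = 0) (h15 : reg 15 = 0) (hlinks : Links n k m tgt e mem)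
    (hchi : ∀ q < n, mem (m + 2 + q) = χ q) (htab : ∀ i, e ≤ i → i < m → mem (i + 2) = tgt i) :
    Reach backwardSearch W (T + 14 * r + 2) ⟨10, reg, mem⟩ Q := by
  induction r generalizing e q j reg mem with
  | zero =>
    obtain rfl : e = m := by omega
    refine .jumpLt rfl (fun h => ?_) fun h => .jump rfl (hQ _ _ hreg h11 h15 hlinks hchi)
    rw [h10, hreg.r4] at h
    omega
  | succ r ih =>
    have hem : e < m := by omega
    have hk : 0 < k := by
      rcases Nat.eq_zero_or_pos k with rfl | h
      · omega
      · exact h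
    have hqn : q < n := by
      by_contra hqn
      have := Nat.mul_le_mul_right k (not_lt.1 hqn)
      omega
    have hdiv : e / k = q := by
      rw [← hqj, mul_comm, Nat.mul_add_div hk, Nat.div_eq_of_lt (by omega), add_zero]
    have hp := htgt e hem
    obtain ⟨c0, c1, c2, c3, c4, c5, c6, c7⟩ := hreg
    have htab' := htab e le_rfl hem
    rw [show T + 14 * (r + 1) + 2 = T + 14 * r + 2 + 14 by omega]
    refine .jumpLt rfl (fun _ => ?_) fun h => by rw [h10, c4] at h; omega
    refine .add rfl (by rw [h10, c6]; omega) ?_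
    refine .store rfl ?_
    refine .load rfl ?_
    have hmem1 : ∀ a, a < m + 2 * n + 2 → Function.update mem (e + 2 + (m + 2 * n)) q a = mem a :=
      fun a ha => Function.update_of_ne (by omega) _ _
    simp only [Function.update_self, ne_eq, Nat.reduceEqDiff, not_false_eq_true,
      Function.update_of_ne, h10, c6, h8, Nat.reduceAdd]
    rw [hmem1 _ (by omega), htab']
    refine .add rfl (by simp [c5]; omega) ?_
    refine .load rfl ?_
    refine .store rfl ?_
    refine .store rfl ?_
    simp only [Function.update_self, ne_eq, Nat.reduceEqDiff, not_false_eq_true,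
      Function.update_of_ne, h10, c5, Nat.reduceAdd]
    rw [hmem1 _ (by omega)]
    refine .add rfl (by simp [h10, c1]; omega) ?_
    refine .add rfl (by simp [h9, c1]; omega) ?_
    set mem' := Function.update (Function.update (Function.update mem (e + 2 + (m + 2 * n)) q)
      (e + 2) (mem (m + 2 + n + tgt e))) (m + 2 + n + tgt e) (e + 2) with hmem'
    have hne : ∀ a, a ≠ e + 2 + (m + 2 * n) → a ≠ e + 2 → a ≠ m + 2 + n + tgt e →
        mem' a = mem a := fun a h1 h2 h3 => by
      rw [hmem', Function.update_of_ne h3, Function.update_of_ne h2, Function.update_of_ne h1]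
    have hlinks' : Links n k m tgt (e + 1) mem' := by
      refine ⟨fun p' hp' => ?_, fun i hi => ?_⟩
      · have hold := (hlinks.linked p' hp').congr (mem' := mem') fun i hi => by
          have := (mem_inLinks.1 hi).1
          exact hne _ (by omega) (by omega) (by omega)
        simp only [inLinks]
        split_ifs with hpp
        · subst hpp
          refine ⟨by simp [hmem'], ?_⟩
          rw [hmem', Function.update_of_ne (by omega), Function.update_self]
          exact hold
        · rwa [hne _ (by omega) (by omega) (by omega)]
      · rcases Nat.lt_succ_iff_lt_or_eq.1 hi with hi | rfl
        · rw [hne _ (by omega) (by omega) (by omega)]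
          exact hlinks.source i hi
        · rw [hmem', Function.update_of_ne (by omega), Function.update_of_ne (by omega),
            Function.update_self, hdiv]
    have hchi' : ∀ q < n, mem' (m + 2 + q) = χ q := fun q hq => by
      rw [hne _ (by omega) (by omega) (by omega), hchi q hq]
    have htab'' : ∀ i, e + 1 ≤ i → i < m → mem' (i + 2) = tgt i := fun i h1 h2 => by
      rw [hne _ (by omega) (by omega) (by omega), htab i (by omega) h2]
    have hconst : Consts n k m reg := ⟨c0, c1, c2, c3, c4, c5, c6, c7⟩
    refine .jumpLt rfl (fun hlt => ?_) fun hle => ?_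
    · simp [h9, c1, c3] at hlt
      refine Reach.mono (ih (q := q) (j := j + 1) (by omega) (by omega) (.inl hlt) ?_ (by simp [h8])
        (by simp [h9, c1]) (by simp [h10, c1, add_right_comm]) (by simp [h11]) (by simp [h15]) hlinks' hchi'
        htab'') (by omega)
      repeat refine Consts.update ?_ (by omega) _
      exact hconst
    · simp [h9, c1, c3] at hle
      refine .const rfl (Nat.zero_le _) (.add rfl (by simp [h8, c1]; omega) (.jump rfl ?_))
      refine Reach.mono (ih (q := q + 1) (j := 0) (by omega) (by rw [add_mul]; omega) (.inl hk) ?_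
        (by simp [h8, c1]) (by simp) (by simp [h10, c1, add_right_comm]) (by simp [h11]) (by simp [h15])
        hlinks' hchi' htab'') (by omega)
      repeat refine Consts.update ?_ (by omega) _
      exact hconst

/-- The queue holds the states in `qs`. -/
structure Queue (n m : ℕ) (reg mem : ℕ → ℕ) (qs : List ℕ) : Prop where
  tail : reg 11 = qs.length
  get : ∀ i (h : i < qs.length), mem (2 * m + 2 * n + 2 + i) = qs[i]
  nodup : qs.Nodup
  lt : ∀ q ∈ qs, q < n

/-- No state is enqueued twice; this bounds both the memory for the queue and the number of rounds.
-/
theorem Queue.length_le {qs : List ℕ} (h : Queue n m reg mem qs) : qs.length ≤ n := by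
  rw [← List.toFinset_card_of_nodup h.nodup, ← Finset.card_range n]
  exact Finset.card_le_card fun q hq => by simpa using h.lt q (by simpa using hq)

theorem Queue.push {reg' mem' : ℕ → ℕ} {qs : List ℕ} {q : ℕ} (h : Queue n m reg mem qs)
    (hq : q ∉ qs) (hqn : q < n) (hreg : reg' 11 = qs.length + 1)
    (hmem : ∀ i < qs.length, mem' (2 * m + 2 * n + 2 + i) = mem (2 * m + 2 * n + 2 + i))
    (hmem' : mem' (2 * m + 2 * n + 2 + qs.length) = q) : Queue n m reg' mem' (qs ++ [q]) := by
  refine ⟨by simp [hreg], fun i hi => ?_, ?_, ?_⟩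
  · simp only [List.length_append, List.length_singleton] at hi
    rcases Nat.lt_succ_iff_lt_or_eq.1 hi with hi | rfl
    · rw [hmem i hi, h.get i hi, List.getElem_append_left]
    · rw [hmem', List.getElem_concat_length rfl]
  · rw [List.nodup_append]
    refine ⟨h.nodup, by simp, fun a ha b hb => ?_⟩
    rw [List.mem_singleton.1 hb]
    exact fun hab => hq (hab ▸ ha)
  · intro q' hq'
    rcases List.mem_append.1 hq' with h' | h'
    · exact h.lt q' h'
    · rw [List.mem_singleton.1 h']
      exact hqn

/-- At most 10 instructions per state. From here on the characteristic vector serves as the array of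
visited flags, since the queue holds exactly the marked states. -/
theorem reach_marked (hW : 8 * (m + 2) ≤ W) (hnm : n ≤ m + 1)
    (hQ : ∀ reg mem, Consts n k m reg → reg 15 = 0 → Links n k m tgt m mem →
      (∀ q < n, mem (m + 2 + q) = χ q) →
      Queue n m reg mem ((List.range n).filter fun q => 0 < χ q) →
      Reach backwardSearch W T ⟨37, reg, mem⟩ Q)
    (r : ℕ) {q : ℕ} (hr : q + r = n)
    (hreg : Consts n k m reg) (h8 : reg 8 = q) (h15 : reg 15 = 0)
    (hlinks : Links n k m tgt m mem) (hchi : ∀ q < n, mem (m + 2 + q) = χ q)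
    (hqueue : Queue n m reg mem ((List.range q).filter fun q => 0 < χ q)) :
    Reach backwardSearch W (T + 10 * r + 2) ⟨26, reg, mem⟩ Q := by
  induction r generalizing q reg mem with
  | zero =>
    obtain rfl : q = n := by omega
    refine .jumpLt rfl (fun h => ?_) fun h => .jump rfl (hQ _ _ hreg h15 hlinks hchi hqueue)
    rw [h8, hreg.r2] at h
    omega
  | succ r ih =>
    obtain ⟨c0, c1, c2, c3, c4, c5, c6, c7⟩ := hreg
    have hconst : Consts n k m reg := ⟨c0, c1, c2, c3, c4, c5, c6, c7⟩
    have hlen := hqueue.length_le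
    have htail := hqueue.tail
    rw [show T + 10 * (r + 1) + 2 = T + 10 * r + 2 + 10 by omega]
    refine .jumpLt rfl (fun _ => ?_) fun h => by rw [h8, c2] at h; omega
    refine .add rfl (by rw [h8, c4]; omega) ?_
    refine .load rfl ?_
    refine .jumpLt rfl (fun hpos => ?_) fun hzero => ?_
    · simp [h8, c0, c4, hchi q (by omega)] at hpos
      refine .add rfl (by simp [c7, htail]; omega) ?_
      refine .store rfl ?_
      refine .add rfl (by simp [c1, htail]; omega) ?_
      refine .jump rfl ?_
      refine .add rfl (by simp [c1, h8]; omega) ?_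
      refine .jump rfl ?_
      simp only [Function.update_self, ne_eq, Nat.reduceEqDiff, not_false_eq_true,
        Function.update_of_ne, c7, h8, htail]
      refine Reach.mono (ih (q := q + 1) (by omega) ?_ (by simp [c1]) (by simp [h15])
        (hlinks.update (by omega) _) (fun q' hq' => ?_) ?_) (by omega)
      · repeat refine Consts.update ?_ (by omega) _
        exact hconst
      · rw [Function.update_of_ne (by omega), hchi q' hq']
      · rw [List.range_succ, List.filter_append, List.filter_singleton, decide_eq_true hpos,
          cond_true]
        refine hqueue.push (by simp) (by omega) (by simp [c1]) (fun i hi => ?_) (by simp)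
        rw [Function.update_of_ne (by omega)]
    · simp [h8, c0, c4, hchi q (by omega)] at hzero
      refine .add rfl (by simp [c1, h8]; omega) ?_
      refine .jump rfl ?_
      refine Reach.mono (ih (q := q + 1) (by omega) ?_ (by simp [c1, h8]) (by simp [h15])
        hlinks hchi ?_) (by omega)
      · repeat refine Consts.update ?_ (by omega) _
        exact hconst
      · rw [List.range_succ, List.filter_append, List.filter_singleton,
          decide_eq_false (by omega), cond_false, List.append_nil]
        exact ⟨by simp [htail], hqueue.get, hqueue.nodup, hqueue.lt⟩

/-- The states in the queue are those that have been visited; `R` holds for them. -/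
structure Search (n k m : ℕ) (tgt : ℕ → ℕ) (χ : ℕ → ℕ) (R : ℕ → Prop) (reg mem : ℕ → ℕ)
    (qs : List ℕ) : Prop where
  consts : Consts n k m reg
  links : Links n k m tgt m mem
  queue : Queue n m reg mem qs
  visited : ∀ q < n, (0 < mem (m + 2 + q) ↔ q ∈ qs)
  sound : ∀ q ∈ qs, R q
  marked : ∀ q < n, 0 < χ q → q ∈ qs

theorem Search.update {R : ℕ → Prop} {qs : List ℕ} (h : Search n k m tgt χ R reg mem qs) {d : ℕ}
    (hd : 8 ≤ d) (hd' : d ≠ 11) (v : ℕ) : Search n k m tgt χ R (Function.update reg d v) mem qs :=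
  ⟨h.consts.update hd v, h.links,
    ⟨by rw [Function.update_of_ne hd'.symm, h.queue.tail], h.queue.get, h.queue.nodup, h.queue.lt⟩,
    h.visited, h.sound, h.marked⟩

/-- Invariant: a transition into `p` is either still on the remaining list `l`, or its source is in
the queue. The part `rs` of the queue grows in an unspecified way; the predicate `U` transports the
fact that old members stay. -/
theorem reach_predecessors {R : ℕ → Prop} (hR : ∀ e < m, R (tgt e) → R (e / k))
    (hsrc : ∀ e < m, e / k < n) (hW : 8 * (m + 2) ≤ W) (hnm : n ≤ m + 1) {p h : ℕ} (hp : R p)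
    {qs : List ℕ} {U : ℕ → Prop}
    (hQ : ∀ reg mem rs, Search n k m tgt χ R reg mem (qs ++ rs) → reg 15 = h →
      (∀ q, U q → q ∈ qs ++ rs) →
      (∀ e < m, tgt e = p → e / k ∈ qs ++ rs) →
      Reach backwardSearch W T ⟨37, reg, mem⟩ Q)
    (l : List ℕ) (rs : List ℕ) (hs : Search n k m tgt χ R reg mem (qs ++ rs)) (h15 : reg 15 = h)
    (hU : ∀ q, U q → q ∈ qs ++ rs) (hl : Linked mem (reg 10) l) (hlm : ∀ e ∈ l, e < m ∧ tgt e = p)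
    (hdone : ∀ e < m, tgt e = p → e ∈ l ∨ e / k ∈ qs ++ rs) :
    Reach backwardSearch W (T + 12 * l.length + 2) ⟨44, reg, mem⟩ Q := by
  induction l generalizing rs reg mem with
  | nil =>
    refine .jumpLt rfl (fun hlt => ?_) fun _ => .jump rfl (hQ _ _ rs hs h15 hU fun e he hep => ?_)
    · rw [show reg 10 = 0 from hl, hs.consts.r0] at hlt
      omega
    · simpa using hdone e he hep
  | cons e l ih =>
    obtain ⟨h10, hl⟩ := hl
    obtain ⟨hem, hep⟩ := hlm e (by simp)
    have hq := hsrc e hem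
    obtain ⟨c0, c1, c2, c3, c4, c5, c6, c7⟩ := hs.consts
    have hlen := hs.queue.length_le
    have htail := hs.queue.tail
    have hsource := hs.links.source e hem
    rw [List.length_cons, show T + 12 * (l.length + 1) + 2 = T + 12 * l.length + 2 + 12 by omega]
    refine .jumpLt rfl (fun _ => ?_) fun hle => by rw [h10, c0] at hle; omega
    refine .add rfl (by rw [h10, c6]; omega) ?_
    refine .load rfl ?_
    simp only [Function.update_self, h10, c6, hsource, Nat.reduceAdd]
    refine .add rfl (by simp [c4]; omega) ?_
    refine .load rfl ?_
    refine .load rfl ?_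
    simp only [Function.update_self, ne_eq, Nat.reduceEqDiff, not_false_eq_true,
      Function.update_of_ne, h10, c4, Nat.reduceAdd]
    refine .jumpLt rfl (fun hpos => ?_) fun hzero => ?_
    · simp [c0] at hpos
      rw [hs.visited _ hq] at hpos
      refine Reach.mono (ih rs ?_ (by simp [h15]) hU (by simpa using hl)
        (fun e' he' => hlm e' (by simp [he'])) fun e' he' hep' => ?_) (by omega)
      · repeat refine Search.update ?_ (by omega) (by omega) _
        exact hs
      · rcases hdone e' he' hep' with h | h
        · rcases List.mem_cons.1 h with rfl | h
          · exact .inr hpos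
          · exact .inl h
        · exact .inr h
    · simp [c0] at hzero
      have hnot : e / k ∉ qs ++ rs := fun h => by
        have := (hs.visited _ hq).2 h
        omega
      -- The queue has room for the new state: with it the entries would still be distinct states,
      -- so their number is at most `n`.
      have hlen' : (qs ++ rs).length < n := by
        have := (hs.queue.push (reg' := fun _ => (qs ++ rs).length + 1)
          (mem' := fun a => if a = 2 * m + 2 * n + 2 + (qs ++ rs).length then e / k else mem a)
          hnot hq rfl (fun i hi => by rw [if_neg (by omega)]) (by simp)).length_le
        simp only [List.length_append, List.length_singleton] at this ⊢
        omega
      refine .store rfl ?_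
      refine .add rfl (by simp only [ne_eq, Nat.reduceEqDiff, not_false_eq_true,
        Function.update_of_ne, c7, htail]; omega) ?_
      refine .store rfl ?_
      refine .add rfl (by simp only [ne_eq, Nat.reduceEqDiff, not_false_eq_true,
        Function.update_of_ne, c1, htail]; omega) ?_
      refine .jump rfl ?_
      simp only [Function.update_self, ne_eq, Nat.reduceEqDiff, not_false_eq_true,
        Function.update_of_ne, c1, c7, htail]
      have hmem : ∀ a, a ≠ m + 2 + e / k → a ≠ 2 * m + 2 * n + 2 + (qs ++ rs).length →
          Function.update (Function.update mem (m + 2 + e / k) 1)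
            (2 * m + 2 * n + 2 + (qs ++ rs).length) (e / k) a = mem a := fun a h1 h2 => by
        rw [Function.update_of_ne h2, Function.update_of_ne h1]
      refine Reach.mono (ih (rs ++ [e / k]) ?_ (by simp [h15])
        (fun q hq => by rw [← List.append_assoc]; exact List.mem_append_left _ (hU q hq)) ?_
        (fun e' he' => hlm e' (by simp [he'])) fun e' he' hep' => ?_) (by omega)
      · rw [← List.append_assoc]
        refine ⟨?_, (hs.links.update (by omega) _).update (by omega) _,
          hs.queue.push hnot hq (by simp) (fun i hi => hmem _ (by omega) (by omega)) (by simp),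
          fun q hqn => ?_, fun q hq => ?_, fun q hqn hq => ?_⟩
        · repeat refine Consts.update ?_ (by omega) _
          exact hs.consts
        · by_cases hqe : q = e / k
          · subst hqe
            rw [Function.update_of_ne (by omega), Function.update_self]
            simp
          · rw [hmem _ (by omega) (by omega), hs.visited q hqn]
            simp [hqe]
        · rcases List.mem_append.1 hq with h | h
          · exact hs.sound q h
          · rw [List.mem_singleton.1 h]
            exact hR e hem (hep ▸ hp)
        · exact List.mem_append_left _ (hs.marked q hqn hq)
      · refine Linked.congr (mem := mem) (by simpa using hl) fun e' he' => ?_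
        have := (hlm e' (by simp [he'])).1
        exact hmem _ (by omega) (by omega)
      · rw [← List.append_assoc]
        rcases hdone e' he' hep' with h | h
        · rcases List.mem_cons.1 h with rfl | h
          · exact .inr (by simp)
          · exact .inl h
        · exact .inr (List.mem_append_left _ h)

/-- `ps` has been processed and `rs` is waiting. The time bound charges 8 to each state yet to be
processed and 12 to each transition whose target has not been processed; sources of transitions into
`ps` are already in the queue, so an empty `rs` means closure under predecessors. -/
theorem reach_search {R : ℕ → Prop} (hR : ∀ e < m, R (tgt e) → R (e / k))
    (hsrc : ∀ e < m, e / k < n) (hW : 8 * (m + 2) ≤ W) (hnm : n ≤ m + 1)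
    (hQ : ∀ reg mem qs, Search n k m tgt χ R reg mem qs →
      (∀ e < m, tgt e ∈ qs → e / k ∈ qs) → Reach backwardSearch W T ⟨57, reg, mem⟩ Q)
    (r : ℕ) (ps rs : List ℕ) (hr : ps.length + r = n)
    (hs : Search n k m tgt χ R reg mem (ps ++ rs)) (h15 : reg 15 = ps.length)
    (hclosed : ∀ e < m, tgt e ∈ ps → e / k ∈ ps ++ rs) :
    Reach backwardSearch W (T + 8 * r + 12 * (m - (ps.map fun p => (inLinks tgt p m).length).sum) +
      2) ⟨37, reg, mem⟩ Q := by
  induction r generalizing ps rs reg mem with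
  | zero =>
    have hlen := hs.queue.length_le
    have htail := hs.queue.tail
    rw [List.length_append] at hlen htail
    obtain rfl : rs = [] := List.length_eq_zero_iff.1 (by omega)
    refine .jumpLt rfl (fun h => ?_) fun _ => .jump rfl (Reach.mono (hQ _ _ _ hs ?_) (by omega))
    · rw [h15, htail, List.length_nil] at h
      omega
    · simpa using hclosed
  | succ r ih =>
    have htail := hs.queue.tail
    obtain ⟨c0, c1, c2, c3, c4, c5, c6, c7⟩ := hs.consts
    cases rs with
    | nil =>
      refine .jumpLt rfl (fun h => ?_) fun _ => .jump rfl (Reach.mono (hQ _ _ _ hs ?_) (by omega))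
      · rw [h15, htail, List.append_nil] at h
        omega
      · simpa using hclosed
    | cons p rs =>
      have hp : p < n := hs.queue.lt p (by simp)
      have hget := hs.queue.get ps.length (by simp)
      rw [List.getElem_append_right le_rfl] at hget
      simp only [Nat.sub_self, List.getElem_cons_zero] at hget
      have hassoc : ∀ rs', ps ++ p :: rs' = ps ++ [p] ++ rs' := by simp
      have hsum := sum_length_inLinks_le tgt (ps := ps ++ [p]) (by
        have := hs.queue.nodup
        rw [hassoc] at this
        exact (List.nodup_append.1 this).1) m
      have hsum' : ((ps ++ [p]).map fun p => (inLinks tgt p m).length).sum =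
          (ps.map fun p => (inLinks tgt p m).length).sum + (inLinks tgt p m).length := by simp
      -- Six instructions take `p` from the queue, its list costs 12 per transition and 2 for
      -- leaving the loop; the sum over processed states grows by the length of that list.
      refine Reach.mono (T := T + 8 * r + 12 * (m - ((ps ++ [p]).map fun p =>
        (inLinks tgt p m).length).sum) + 2 + 12 * (inLinks tgt p m).length + 2 + 6) ?_ (by omega)
      refine .jumpLt rfl (fun _ => ?_) fun hle => ?_
      · refine .add rfl (by rw [h15, c7]; omega) ?_
        refine .load rfl ?_
        simp only [Function.update_self, h15, c7, hget, Nat.reduceAdd]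
        refine .add rfl (by simp [h15, c1]; omega) ?_
        refine .add rfl (by simp [c5]; omega) ?_
        refine .load rfl ?_
        simp only [Function.update_self, ne_eq, Nat.reduceEqDiff, not_false_eq_true,
          Function.update_of_ne, h15, c1, c5, Nat.reduceAdd]
        refine reach_predecessors (χ := χ) (U := fun q => q ∈ ps ++ p :: rs) (p := p) (h := ps.length + 1) (qs := ps ++ [p]) hR hsrc hW hnm
          (hs.sound p (by simp)) ?_ _ rs ?_ (by simp) (fun q hq => by rwa [← hassoc]) (by simpa using hs.links.linked p hp)
          (fun e he => mem_inLinks.1 he) fun e he hep => .inl (mem_inLinks.2 ⟨he, hep⟩)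
        · intro reg' mem' rs' hs' h15' hU' hclosed'
          refine ih (ps ++ [p]) rs' (by simp; omega) hs' (by simpa) fun e he hmem => ?_
          rcases List.mem_append.1 hmem with h | h
          · exact hU' _ (hclosed e he h)
          · exact hclosed' e he (List.mem_singleton.1 h)
        · rw [← hassoc]
          repeat refine Search.update ?_ (by omega) (by omega) _
          exact hs
      · rw [h15, htail, List.length_append, List.length_cons] at hle
        omega

end Phases

end RAM

namespace RAM

section Instances

variable {n k : ℕ} (A : Semiautomaton (Fin n) (Fin k)) (S : Finset (Fin n))

/-- The initial contents of the memory. -/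
def inputMem (i : ℕ) : ℕ := (instanceWords A S).getD i 0

theorem length_transitionTable : ((List.finRange n).flatMap fun q =>
    (List.finRange k).map fun a => (A.step q a : ℕ)).length = n * k :=
  Cmd.length_flatMap_finRange _ (by simp)

theorem inputMem_zero : inputMem A S 0 = n := rfl

theorem inputMem_one : inputMem A S 1 = k := rfl

theorem inputMem_table (q : Fin n) (a : Fin k) :
    inputMem A S (q * k + a + 2) = A.step q a := by
  have h1 : q.1 * k + a.1 < n * k := by
    have := Nat.mul_le_mul_right k (show q.1 + 1 ≤ n from q.2)
    rw [add_mul] at this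
    omega
  have h := Cmd.getElem?_flatMap_finRange (fun q => (List.finRange k).map
    fun a => (A.step q a : ℕ)) (by simp) q a.2
  have hl := length_transitionTable A
  simp only [inputMem, instanceWords, List.getD, List.cons_append,
    List.getElem?_cons_succ, List.nil_append]
  rw [List.getElem?_append_left (by omega), h]
  simp

theorem inputMem_set (q : Fin n) :
    inputMem A S (n * k + 2 + q) = if q ∈ S then 1 else 0 := by
  have hl := length_transitionTable A
  rw [show n * k + 2 + q.1 = n * k + q.1 + 2 by omega]
  simp only [inputMem, instanceWords, List.getD, List.cons_append,
    List.getElem?_cons_succ, List.nil_append]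
  rw [List.getElem?_append_right (by omega), hl, Nat.add_sub_cancel_left]
  simp

theorem inputMem_of_le {i : ℕ} (hi : n * k + 2 + n ≤ i) : inputMem A S i = 0 := by
  have hl := length_transitionTable A
  simp only [inputMem, instanceWords, List.getD]
  rw [List.getElem?_eq_none]
  · rfl
  · simp only [List.length_append, List.length_cons, List.length_nil, hl, List.length_map,
      List.length_finRange]
    omega

theorem inputMem_le {W : ℕ} (hn : n ≤ W) (hk : k ≤ W) (hW : 1 ≤ W) (i : ℕ) :
    inputMem A S i ≤ W := by
  have hall : ∀ v ∈ instanceWords A S, v ≤ W := by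
    intro v hv
    simp only [instanceWords, List.mem_append, List.mem_cons, List.not_mem_nil, or_false,
      List.mem_flatMap, List.mem_map] at hv
    rcases hv with ((rfl | rfl) | ⟨q, -, a, -, rfl⟩) | ⟨q, -, rfl⟩
    · exact hn
    · exact hk
    · exact (A.step q a).2.le.trans hn
    · split_ifs <;> omega
  rw [inputMem, List.getD]
  rcases h : (instanceWords A S)[i]? with _ | v
  · exact Nat.zero_le _
  · exact hall v (List.mem_of_getElem? h)

variable {A}

/-- The final queue contains `S`, is closed under predecessors, and holds only states from which `S`
can be reached; hence it holds all such states. By `totallyExtensible_iff` the answer is yes if and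
only if these are all states. -/
theorem backwardSearch_decides (hA : A.Synchronizing) :
    backwardSearch.Decides (instanceWords A S) (A.TotallyExtensible (S : Set (Fin n)))
      (64 * (k * n + 1)) ((k * n + 2) ^ 64) := by
  obtain ⟨m, hm⟩ : ∃ m, n * k = m := ⟨_, rfl⟩
  have hn : 0 < n := by
    obtain ⟨w, c, -⟩ := hA.exists_run_eq
    exact c.pos
  have hkm : k ≤ m := hm ▸ Nat.le_mul_of_pos_left k hn
  -- Without letters only the empty word can be a reset word, so `n = 1`; with a letter, `n ≤ n *
  -- k`. This makes the work per state linear in the table size.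
  have hnm : n ≤ m + 1 := by
    rcases Nat.eq_zero_or_pos k with rfl | hk
    · obtain ⟨w, c, hw⟩ := hA.exists_run_eq
      obtain rfl : w = [] := List.eq_nil_of_length_eq_zero (by
        rcases w with _ | ⟨a, w⟩
        · rfl
        · exact a.elim0)
      have h0 := hw ⟨0, hn⟩
      have h1 := hw ⟨n - 1, by omega⟩
      rw [← h0] at h1
      have := congrArg Fin.val h1
      simp [Semiautomaton.run] at this
      omega
    · have := Nat.le_mul_of_pos_right n hk
      omega
  rw [mul_comm k n, hm]
  -- All numbers and addresses stay below `8 * (m + 2)`; the exponent `4` would suffice, and `64` is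
  -- used because the same constant bounds the time.
  have hW : 8 * (m + 2) ≤ (m + 2) ^ 64 := by
    calc 8 * (m + 2) = 2 ^ 3 * (m + 2) := rfl
      _ ≤ (m + 2) ^ 3 * (m + 2) := Nat.mul_le_mul_right _ (Nat.pow_le_pow_left (by omega) 3)
      _ = (m + 2) ^ 4 := by ring
      _ ≤ (m + 2) ^ 64 := Nat.pow_le_pow_right (by omega) (by omega)
  generalize (m + 2) ^ 64 = W at *
  have hcode : ∀ (q : Fin n) (a : Fin k), q.1 * k + a.1 < m ∧ (q.1 * k + a.1) / k = q := by
    intro q a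
    have ha := a.2
    have := Nat.mul_le_mul_right k (show q.1 + 1 ≤ n from q.2)
    rw [add_mul] at this
    refine ⟨by omega, ?_⟩
    rw [mul_comm, Nat.mul_add_div (by omega), Nat.div_eq_of_lt ha, add_zero]
  have hdecode : ∀ e < m, ∃ (q : Fin n) (a : Fin k), e = q * k + a := by
    intro e he
    have hk : 0 < k := by
      rcases Nat.eq_zero_or_pos k with rfl | h
      · omega
      · exact h
    exact ⟨⟨e / k, (Nat.div_lt_iff_lt_mul hk).2 (by omega)⟩, ⟨e % k, Nat.mod_lt _ hk⟩,
      (Nat.div_add_mod' e k).symm⟩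
  have htab : ∀ (q : Fin n) (a : Fin k), inputMem A S (q * k + a + 2) = A.step q a :=
    inputMem_table A S
  have hset : ∀ q : Fin n, inputMem A S (m + 2 + q) = if q ∈ S then 1 else 0 := fun q => by
    rw [← hm, inputMem_set]
  let R : ℕ → Prop := fun q => ∃ h : q < n, ∃ p ∈ S, A.Reaches ⟨q, h⟩ p
  have hR : ∀ e < m, R (inputMem A S (e + 2)) → R (e / k) := by
    intro e he hRe
    obtain ⟨q, a, rfl⟩ := hdecode e he
    obtain ⟨hlt, p, hp, h⟩ := hRe
    rw [show (⟨_, hlt⟩ : Fin n) = A.step q a from Fin.ext (htab q a)] at h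
    rw [(hcode q a).2]
    exact ⟨q.2, p, hp, .trans ⟨[a], rfl⟩ h⟩
  have hsrc : ∀ e < m, e / k < n := by
    intro e he
    obtain ⟨q, a, rfl⟩ := hdecode e he
    rw [(hcode q a).2]
    exact q.2
  have htgt : ∀ e < m, inputMem A S (e + 2) < n := by
    intro e he
    obtain ⟨q, a, rfl⟩ := hdecode e he
    rw [htab]
    exact (A.step q a).2
  refine decides_of_reach ⟨fun _ => Nat.zero_le _,
    inputMem_le A S (by omega) (by omega) (by omega)⟩ ?_
  -- In total `26 * m + 18 * n + 19` steps, which is at most `44 * m + 37` because of `n ≤ m + 1`.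
  refine Reach.mono (T := 2 + 8 * n + 12 * (m - 0) + 2 + 10 * n + 2 + 1 + 14 * m + 2 + 10) ?_
    (by omega)
  rw [show initial (instanceWords A S) = ⟨0, fun _ => 0, inputMem A S⟩ from rfl]
  have h0 := inputMem_zero A S
  have h1 := inputMem_one A S
  refine .const rfl (by omega) ?_
  refine .load rfl ?_
  refine .load rfl ?_
  refine .mul rfl (by simp [h0, h1, hm]; omega) ?_
  refine .const rfl (by omega) ?_
  refine .add rfl (by simp [h0, h1, hm]; omega) ?_
  refine .add rfl (by simp [h0, h1, hm]; omega) ?_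
  refine .add rfl (by simp [h0, h1, hm]; omega) ?_
  refine .sub rfl ?_
  refine .add rfl (by simp [h0, h1, hm]; omega) ?_
  refine reach_links (n := n) (k := k) (tgt := fun e => inputMem A S (e + 2))
    (χ := fun q => inputMem A S (m + 2 + q)) hm hkm hnm hW htgt ?_ m (e := 0) (q := 0) (j := 0)
    (by omega) (by omega) (by omega) ?_ (by simp) (by simp) (by simp) (by simp) (by simp)
    ⟨fun p hp => ?_, by simp⟩ (fun _ _ => rfl) fun _ _ _ => rfl
  · intro reg mem hreg h11 h15 hlinks hchi
    refine .const rfl (by omega) ?_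
    refine reach_marked (k := k) hW hnm ?_ n (q := 0) (by omega) (hreg.update (by omega) _)
      (by simp) (by simpa using h15) hlinks hchi ⟨by simpa using h11, by simp, by simp, by simp⟩
    intro reg mem hreg h15 hlinks hchi hqueue
    refine reach_search (χ := fun q => inputMem A S (m + 2 + q)) (R := R) hR hsrc hW hnm ?_ n []
      ((List.range n).filter fun q => 0 < inputMem A S (m + 2 + q)) (by simp)
      ⟨hreg, hlinks, hqueue, fun q hq => ?_, fun q hq => ?_, fun q hq hpos => ?_⟩ (by simpa using h15)
      (by simp)
    · intro reg mem qs hs hclosed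
      -- Closure under predecessors is extended from letters to words.
      have hback : ∀ (w : List (Fin k)) (q : Fin n), (A.run q w).1 ∈ qs → q.1 ∈ qs := by
        intro w
        induction w with
        | nil => exact fun q h => h
        | cons a w ih =>
          intro q h
          have := hclosed (q * k + a) (hcode q a).1 (by
            rw [htab]
            exact ih _ h)
          rwa [(hcode q a).2] at this
      have hall : A.TotallyExtensible (S : Set (Fin n)) ↔ ∀ q : Fin n, q.1 ∈ qs := by
        rw [hA.totallyExtensible_iff]
        constructor
        · intro h q
          obtain ⟨p, hp, w, rfl⟩ := h q
          refine hback w q (hs.marked _ (A.run q w).2 ?_)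
          rw [hset, if_pos (Finset.mem_coe.1 hp)]
          exact one_pos
        · intro h q
          obtain ⟨_, p, hp, hr⟩ := hs.sound q (h q)
          exact ⟨p, hp, hr⟩
      have hlen := hs.queue.length_le
      refine .jumpLt rfl (fun hlt => .done (.inr ⟨fun h => ?_, rfl⟩)) fun hle =>
        .done (.inl ⟨hall.2 fun q => ?_, rfl⟩)
      · rw [hs.queue.tail, hs.consts.r2] at hlt
        rw [hall] at h
        have : Finset.range n ⊆ qs.toFinset := fun q hq => by
          simpa using h ⟨q, by simpa using hq⟩
        have := (Finset.card_le_card this).trans (List.toFinset_card_le qs)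
        rw [Finset.card_range] at this
        omega
      · rw [hs.queue.tail, hs.consts.r2] at hle
        have hsub : qs.toFinset ⊆ Finset.range n := fun q hq => by
          simpa using hs.queue.lt q (by simpa using hq)
        have heq := Finset.eq_of_subset_of_card_le hsub (by
          rw [List.toFinset_card_of_nodup hs.queue.nodup, Finset.card_range]
          exact hle)
        have : q.1 ∈ qs.toFinset := by
          rw [heq]
          simp
        simpa using this
    · rw [hchi q hq]
      simp [hq]
    · simp only [List.nil_append, List.mem_filter, List.mem_range, decide_eq_true_eq] at hq
      refine ⟨hq.1, ⟨q, hq.1⟩, ?_, .refl _⟩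
      by_contra hS
      have h2 := hset ⟨q, hq.1⟩
      rw [if_neg hS] at h2
      exact absurd h2 hq.2.ne'
    · simpa using ⟨hq, hpos⟩
  · constructor <;> simp [h0, h1, hm] <;> omega
  -- Memory beyond the input is zero, so all lists are initially empty without any initialization.
  · simp only [inLinks, Linked]
    exact inputMem_of_le A S (by omega)

end Instances

end RAM

theorem mainTheorem7 :
    (∀ (Q : Type*) (α : Type*) [Finite Q] [Finite α] (A : Semiautomaton Q α),
      A.Synchronizing →
        ∃ C : Set Q, A.IsSinkComponent C ∧
          (∀ C' : Set Q, A.IsSinkComponent C' → C' = C) ∧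
          (∀ p : Q, ∀ q ∈ C, A.Reaches p q) ∧
          ∀ S : Set Q, A.TotallyExtensible S ↔ (S ∩ C).Nonempty) ∧
    (∃ (P : RAM) (K : ℕ), ∀ (n k : ℕ) (A : Semiautomaton (Fin n) (Fin k)) (S : Finset (Fin n)),
      A.Synchronizing →
        P.Decides (instanceWords A S) (A.TotallyExtensible (S : Set (Fin n)))
          (K * (k * n + 1)) ((k * n + 2) ^ K)) ∧
    totallyExtensibleSync.NLComplete ∧
    stConnectivity.LogSpaceReduces totallyExtensibleSync := by
  exact ⟨fun Q α _ _ A hA => hA.exists_sinkComponent,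
    ⟨RAM.backwardSearch, 64, fun n k A S hA => RAM.backwardSearch_decides S hA⟩,
    ⟨totallyExtensibleSync_inNL, totallyExtensibleSync_NLHard⟩,
    Cmd.stConnectivity_logSpaceReduces⟩
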